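/- **Model.** Let $1\le K\le N$ be integers and $\lambda_s,\lambda_d,c>0$. An access point multicasts status updates $j=0,1,2,\dots$ to devices $1,\dots,N$. The service times $T_{n,j}$ and the deadlines $T_{\mathrm D,j}$ are mutually independent; $T_{n,j}-c$ is exponential with rate $\lambda_s$ and $T_{\mathrm D,j}-c$ is exponential with rate $\lambda_d$. Let $T_N(k)$ be the $k$-th smallest of $T_{1,j},\dots,T_{N,j}$. Update $j$ is generated at $t_j$ ($t_0=0$) and terminated at $t_{j+1}=t_j+X_j$, where $X_j=\min\{T_{\mathrm D,j},T_N(K)\}$. Device $n$ receives it (event $\mathcal C_{\mathrm S}$), at time $t_j+T_{n,j}$, if $T_{n,j}\le X_j$; otherwise $\mathcal C_{\mathrm F}$ occurs. Let $\mathcal C_{\mathrm S,1},\mathcal C_{\mathrm F,1}$ be the intersections of these events with $\{T_N(K)<T_{\mathrm D,j}\}$, and $\mathcal C_{\mathrm S,2},\mathcal C_{\mathrm F,2}$ those with $\{T_{\mathrm D,j}<T_N(K)\}$; $\mathbb P(\mathcal C_{\mathrm S,i})$ and $\mathbb P(\mathcal C_{\mathrm F,i})$ denote conditional probabilities given $\mathcal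 C_{\mathrm S}$ and $\mathcal C_{\mathrm F}$ respectively. Let $u_n(t)$ be the generation time of the most recent update received by device $n$ by time $t$ (some $u_0\le 0$ before the first reception), and let $\Delta_n(t)=t-u_n(t)$ be its age of information (AoI). $\mathcal X^{\mathrm F}$ and $\mathcal X^{\mathrm S}$ denote $X_j$ conditioned on $\mathcal C_{\mathrm F}$ and $\mathcal C_{\mathrm S}$; $\mathcal M$ is the number of updates after one received by device $n$ up to and including the next one it receives; $\mathcal W$ is the sum of $X_j$ over the $\mathcal M-1$ failed ones in between; $\hat{\mathcal T}$ is the service time $T_{n,j}$ of a received update. The peak AoI is the value of $\Delta_n$ immediately before a reception. **Result.** For every device $n$, almost surely and for every $u_0\le0$, $$\lim_{\tau\to\infty}\frac1\tau\int_0^\tau\Delta_n(t)\,dt=\frac{\mathbb E[\mathcal W^2]+2(\mathbb E[\hat{\mathcal T}]+\mathbb E[\mathcal X^{\mathrm S}])\mathbb E[\mathcal W]+2\mathbb E[\mathcal X^{\mathrm S}]\mathbb E[\hat{\mathcal T}]+\mathbb E[(\mathcal X^{\mathrm S})^2]}{2\mathbb E[\mathcal W]+2\mathbb E[\mathcal X^{\mathrm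 S}]},$$ and the empirical average of the first $Q$ peak AoIs converges almost surely, as $Q\to\infty$, to $\mathbb E[\mathcal X^{\mathrm S}]+\mathbb E[\mathcal W]+\mathbb E[\hat{\mathcal T}]$, which is also the expectation of each peak AoI other than the first. All these expectations are finite and are given as follows. For $1\le h\le N$, $0\le j<h$ put $$B_{h,j}=h\binom Nh\binom{h-1}j(-1)^j,\quad U_{h,j}=N-h+1+j,\quad H_{h,j}=\lambda_sU_{h,j}+\lambda_d,$$ $$\mathcal R_h=\sum_{j=0}^{h-1}B_{h,j}\Big(\frac1{U_{h,j}}-\frac{\lambda_s}{H_{h,j}}\Big),$$ $$S_1(h)=\sum_{j=0}^{h-1}B_{h,j}\lambda_s\frac{cH_{h,j}+1}{H_{h,j}^2},\quad S_2(h)=\sum_{j=0}^{h-1}B_{h,j}\lambda_s\frac{c^2H_{h,j}^2+2cH_{h,j}+2}{H_{h,j}^3},$$ $$D_1(h)=\sum_{j=0}^{h-1}B_{h,j}\lambda_d\frac{cH_{h,j}+1}{U_{h,j}H_{h,j}^2},\quad D_2(h)=\sum_{j=0}^{h-1}B_{h,j}\lambda_d\frac{c^2H_{h,j}^2+2cH_{h,j}+2}{U_{h,j}H_{h,j}^3}.$$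 Then $\mathbb P(T_{\mathrm D,j}<T_N(h))=\mathcal R_h$ for $1\le h\le N$, and $$\mathbb P(\mathcal C_{\mathrm S})=\frac1N\sum_{h=1}^K(1-\mathcal R_h),\qquad \mathbb P(\mathcal C_{\mathrm S,1})=\frac{K(1-\mathcal R_K)}{\sum_{h=1}^K(1-\mathcal R_h)}=1-\mathbb P(\mathcal C_{\mathrm S,2}),$$ $$\mathbb P(\mathcal C_{\mathrm F,2})=\frac{\big(\sum_{h=1}^K\mathcal R_h+(N-K)\mathcal R_K\big)(\lambda_s+\lambda_d)}{N\lambda_d+\big(N-K-\sum_{h=K+1}^N\mathcal R_h\big)(\lambda_s+\lambda_d)}=1-\mathbb P(\mathcal C_{\mathrm F,1}).$$ For $i=1,2$, $$\mathbb E[T_N(K)^i\mid\mathcal C_{\mathrm S,1}]=\frac{S_i(K)}{1-\mathcal R_K},\qquad \mathbb E[T_N(K)^i\mid\mathcal C_{\mathrm F,1}]=\frac{S_i(K)}{1-\mathcal R_K}\ \text{ if }K<N,$$ $$\mathbb E[T_{\mathrm D,j}^i\mid\mathcal C_{\mathrm F,2}]=\frac{\sum_{h=1}^KD_i(h)+(N-K)D_i(K)}{\sum_{h=1}^K\mathcal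 R_h+(N-K)\mathcal R_K},$$ $$\mathbb E[T_{\mathrm D,j}^i\mid\mathcal C_{\mathrm S,2}]=\frac{KD_i(K)-\sum_{h=1}^KD_i(h)}{K\mathcal R_K-\sum_{h=1}^K\mathcal R_h}\ \text{ if }K\ge2,$$ $$\mathbb E[(\mathcal X^{\mathrm F})^i]=\mathbb P(\mathcal C_{\mathrm F,1})\,\mathbb E[T_N(K)^i\mid\mathcal C_{\mathrm F,1}]+\mathbb P(\mathcal C_{\mathrm F,2})\,\mathbb E[T_{\mathrm D,j}^i\mid\mathcal C_{\mathrm F,2}],$$ $$\mathbb E[(\mathcal X^{\mathrm S})^i]=\mathbb P(\mathcal C_{\mathrm S,1})\,\mathbb E[T_N(K)^i\mid\mathcal C_{\mathrm S,1}]+\mathbb P(\mathcal C_{\mathrm S,2})\,\mathbb E[T_{\mathrm D,j}^i\mid\mathcal C_{\mathrm S,2}]$$ (with the given closed forms substituted; if $K=N$, then $\mathbb P(\mathcal C_{\mathrm F,1})=0$, and if $K=1$, then $\mathbb P(\mathcal C_{\mathrm S,2})=0$, and the corresponding summand is $0$), and $$\mathbb E[\mathcal M]=\frac1{\mathbb P(\mathcal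 C_{\mathrm S})},\quad \mathbb E[\mathcal M^2]=\frac{2-\mathbb P(\mathcal C_{\mathrm S})}{\mathbb P(\mathcal C_{\mathrm S})^2},\quad \mathbb E[\mathcal W]=(\mathbb E[\mathcal M]-1)\,\mathbb E[\mathcal X^{\mathrm F}],$$ $$\mathbb E[\mathcal W^2]=(\mathbb E[\mathcal M]-1)\big(\mathbb E[(\mathcal X^{\mathrm F})^2]-\mathbb E[\mathcal X^{\mathrm F}]^2\big)+\mathbb E[\mathcal X^{\mathrm F}]^2\big(\mathbb E[\mathcal M^2]-\mathbb E[\mathcal M]^2\big)+\mathbb E[\mathcal W]^2,$$ $$\mathbb E[\hat{\mathcal T}]=\mathbb E[T_{n,j}\mid\mathcal C_{\mathrm S}]=\frac1{N\,\mathbb P(\mathcal C_{\mathrm S})}\sum_{h=1}^KS_1(h).$$ -/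

import Mathlib

open MeasureTheory ProbabilityTheory Filter
open scoped Topology

namespace MulticastAoI

noncomputable section

/-! ### Probability -/

/-- The exponential distribution with rate `r`, shifted to the right by `c`. -/
def shiftedExp (c r : ℝ) : Measure ℝ := (expMeasure r).map (fun x => c + x)

/-- `Y` is integrable and its expectation under `P` is `m`. -/
def HasMean {Ω : Type*} [MeasurableSpace Ω] (P : Measure Ω) (Y : Ω → ℝ) (m : ℝ) : Prop :=
  Integrable Y P ∧ ∫ ω, Y ω ∂P = m

/-! ### The system along one sample path

`x : Fin N → ℝ` are the service times of one status update and `d : ℝ` is its deadline.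
For a whole path, `T j m` is the service time of update `j` to device `m`, and `D j` is the deadline
of update `j`; updates are numbered `0, 1, 2, …` and update `0` is generated at time `0`. -/

/-- The `k`-th smallest of the numbers `x m` (for `1 ≤ k ≤ N`): the first time at which at
least `k` devices have obtained the update. -/
def kthSmallest {N : ℕ} (x : Fin N → ℝ) (k : ℕ) : ℝ :=
  sInf {t : ℝ | k ≤ (Finset.univ.filter (fun m => x m ≤ t)).card}

/-- Time from generation to termination of an update: it is served (`K` devices have it) or its
deadline expires, whichever comes first. This is also the inter-generation time. -/
def duration {N : ℕ} (K : ℕ) (x : Fin N → ℝ) (d : ℝ) : ℝ := min d (kthSmallest x K)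

/-- Device `n` successfully receives the update. -/
def Received {N : ℕ} (K : ℕ) (x : Fin N → ℝ) (d : ℝ) (n : Fin N) : Prop :=
  x n ≤ duration K x d

/-- Generation time of update `j`. -/
def genTime {N : ℕ} (K : ℕ) (T : ℕ → Fin N → ℝ) (D : ℕ → ℝ) (j : ℕ) : ℝ :=
  ∑ i ∈ Finset.range j, duration K (T i) (D i)

/-- Generation time of the most recent update that device `n` has received by time `t`;
`u₀ ≤ 0` is the generation time of what the device holds at time `0`. -/
def latestGen {N : ℕ} (K : ℕ) (T : ℕ → Fin N → ℝ) (D : ℕ → ℝ) (n : Fin N) (u₀ t : ℝ) : ℝ :=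
  sSup (insert u₀ {s : ℝ | ∃ j, Received K (T j) (D j) n ∧ genTime K T D j + T j n ≤ t ∧
    s = genTime K T D j})

/-- Instantaneous age of information of device `n` at time `t`. -/
def age {N : ℕ} (K : ℕ) (T : ℕ → Fin N → ℝ) (D : ℕ → ℝ) (n : Fin N) (u₀ t : ℝ) : ℝ :=
  t - latestGen K T D n u₀ t

/-- Index of the `q`-th update (`q = 0, 1, …`) that device `n` receives. -/
def succIdx {N : ℕ} (K : ℕ) (T : ℕ → Fin N → ℝ) (D : ℕ → ℝ) (n : Fin N) (q : ℕ) : ℕ :=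
  Nat.nth (fun j => Received K (T j) (D j) n) q

/-- Number of updates transmitted from the `q`-th successful one (exclusive) up to the next
successful one (inclusive). -/
def attempts {N : ℕ} (K : ℕ) (T : ℕ → Fin N → ℝ) (D : ℕ → ℝ) (n : Fin N) (q : ℕ) : ℝ :=
  (succIdx K T D n (q + 1) : ℝ) - (succIdx K T D n q : ℝ)

/-- Total inter-generation time of the failed updates between the `q`-th and the next successful
update. -/
def failTime {N : ℕ} (K : ℕ) (T : ℕ → Fin N → ℝ) (D : ℕ → ℝ) (n : Fin N) (q : ℕ) : ℝ :=
  ∑ i ∈ Finset.Ioo (succIdx K T D n q) (succIdx K T D n (q + 1)), duration K (T i) (D i)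

/-- Service time of the `q`-th update that device `n` receives. -/
def succService {N : ℕ} (K : ℕ) (T : ℕ → Fin N → ℝ) (D : ℕ → ℝ) (n : Fin N) (q : ℕ) : ℝ :=
  T (succIdx K T D n q) n

/-- The `q`-th peak age: the age immediately before the `q`-th successful reception. -/
def peakAge {N : ℕ} (K : ℕ) (T : ℕ → Fin N → ℝ) (D : ℕ → ℝ) (n : Fin N) (u₀ : ℝ) (q : ℕ) : ℝ :=
  Function.leftLim (age K T D n u₀)
    (genTime K T D (succIdx K T D n q) + succService K T D n q)

/-! ### Closed forms -/

/-- Parameters: number of devices `N`, multicast threshold `K`, service rate `lamS`,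
deadline rate `lamD`, common shift `c`. -/
structure Params where
  N : ℕ
  K : ℕ
  lamS : ℝ
  lamD : ℝ
  c : ℝ

namespace Params

variable (p : Params)

def B (h j : ℕ) : ℝ := (h : ℝ) * (p.N.choose h : ℝ) * ((h - 1).choose j : ℝ) * (-1) ^ j

def U (h j : ℕ) : ℝ := (p.N : ℝ) - h + 1 + j

def H (h j : ℕ) : ℝ := p.lamS * p.U h j + p.lamD

def R (h : ℕ) : ℝ := ∑ j ∈ Finset.range h, p.B h j * (1 / p.U h j - p.lamS / p.H h j)

/-- The sum `R 1 + ⋯ + R K`. -/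
def sumR : ℝ := ∑ h ∈ Finset.Icc 1 p.K, p.R h

def S₁ (h : ℕ) : ℝ :=
  ∑ j ∈ Finset.range h, p.B h j * p.lamS * (p.c * p.H h j + 1) / (p.H h j) ^ 2

def S₂ (h : ℕ) : ℝ :=
  ∑ j ∈ Finset.range h,
    p.B h j * p.lamS * (p.c ^ 2 * (p.H h j) ^ 2 + 2 * p.c * p.H h j + 2) / (p.H h j) ^ 3

def D₁ (h : ℕ) : ℝ :=
  ∑ j ∈ Finset.range h,
    p.B h j * p.lamD * (p.c * p.H h j + 1) / (p.U h j * (p.H h j) ^ 2)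

def D₂ (h : ℕ) : ℝ :=
  ∑ j ∈ Finset.range h,
    p.B h j * p.lamD * (p.c ^ 2 * (p.H h j) ^ 2 + 2 * p.c * p.H h j + 2)
      / (p.U h j * (p.H h j) ^ 3)

/-- Probability that a given device receives a given update. -/
def probS : ℝ := (1 / (p.N : ℝ)) * ∑ h ∈ Finset.Icc 1 p.K, (1 - p.R h)

/-- Probability, given failure, that the deadline expires first. -/
def probF2 : ℝ :=
  (p.sumR + ((p.N : ℝ) - p.K) * p.R p.K) * (p.lamS + p.lamD) /
    ((p.N : ℝ) * p.lamD +
      ((p.N : ℝ) - p.K - ∑ h ∈ Finset.Icc (p.K + 1) p.N, p.R h) * (p.lamS + p.lamD))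

/-- Probability, given success, that the update is served before its deadline. -/
def probS1 : ℝ := (p.K : ℝ) * (1 - p.R p.K) / ∑ h ∈ Finset.Icc 1 p.K, (1 - p.R h)

def meanServe : ℝ := p.S₁ p.K / (1 - p.R p.K)

def sqServe : ℝ := p.S₂ p.K / (1 - p.R p.K)

def meanDeadlineF : ℝ :=
  (∑ h ∈ Finset.Icc 1 p.K, p.D₁ h + ((p.N : ℝ) - p.K) * p.D₁ p.K) /
    (p.sumR + ((p.N : ℝ) - p.K) * p.R p.K)

def sqDeadlineF : ℝ :=
  (∑ h ∈ Finset.Icc 1 p.K, p.D₂ h + ((p.N : ℝ) - p.K) * p.D₂ p.K) /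
    (p.sumR + ((p.N : ℝ) - p.K) * p.R p.K)

/-- For `K = 1` this is `0 / 0 = 0`; it is then only used with the factor `1 - probS1 = 0`. -/
def meanDeadlineS : ℝ :=
  ((p.K : ℝ) * p.D₁ p.K - ∑ h ∈ Finset.Icc 1 p.K, p.D₁ h) / ((p.K : ℝ) * p.R p.K - p.sumR)

/-- For `K = 1` this is `0 / 0 = 0`; it is then only used with the factor `1 - probS1 = 0`. -/
def sqDeadlineS : ℝ :=
  ((p.K : ℝ) * p.D₂ p.K - ∑ h ∈ Finset.Icc 1 p.K, p.D₂ h) / ((p.K : ℝ) * p.R p.K - p.sumR)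

def meanXF : ℝ := (1 - p.probF2) * p.meanServe + p.probF2 * p.meanDeadlineF

def sqXF : ℝ := (1 - p.probF2) * p.sqServe + p.probF2 * p.sqDeadlineF

def meanXS : ℝ := p.probS1 * p.meanServe + (1 - p.probS1) * p.meanDeadlineS

def sqXS : ℝ := p.probS1 * p.sqServe + (1 - p.probS1) * p.sqDeadlineS

def meanM : ℝ := 1 / p.probS

def sqM : ℝ := (2 - p.probS) / p.probS ^ 2

def meanW : ℝ := (p.meanM - 1) * p.meanXF

def sqW : ℝ :=
  (p.meanM - 1) * (p.sqXF - p.meanXF ^ 2) + p.meanXF ^ 2 * (p.sqM - p.meanM ^ 2) + p.meanW ^ 2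

def meanT : ℝ := (1 / ((p.N : ℝ) * p.probS)) * ∑ h ∈ Finset.Icc 1 p.K, p.S₁ h

/-- The average age of information. -/
def averageAoI : ℝ :=
  (p.sqW + 2 * (p.meanT + p.meanXS) * p.meanW) / (2 * p.meanW + 2 * p.meanXS) +
    (2 * p.meanXS * p.meanT + p.sqXS) / (2 * p.meanW + 2 * p.meanXS)

/-- The average peak age of information. -/
def averagePeakAoI : ℝ := p.meanXS + p.meanW + p.meanT

end Params

/-! ### Events concerning one update

`T ω j m` and `D ω j` are the random service times and deadlines; the events concern update `j` and
device `n`. -/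

section Events

variable {Ω : Type*} {N : ℕ} (K : ℕ) (T : Ω → ℕ → Fin N → ℝ) (D : Ω → ℕ → ℝ) (n : Fin N) (j : ℕ)

/-- Device `n` receives update `j`. -/
def evS : Set Ω := {ω | T ω j n ≤ min (D ω j) (kthSmallest (T ω j) K)}

/-- Device `n` receives update `j`, which is served before its deadline. -/
def evS1 : Set Ω := evS K T D n j ∩ {ω | kthSmallest (T ω j) K < D ω j}

/-- Device `n` receives update `j`, whose deadline expires before it is served. -/
def evS2 : Set Ω := evS K T D n j ∩ {ω | D ω j < kthSmallest (T ω j) K}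

/-- Device `n` fails to receive update `j`. -/
def evF : Set Ω := {ω | min (D ω j) (kthSmallest (T ω j) K) < T ω j n}

/-- Device `n` fails to receive update `j`, which is served before its deadline. -/
def evF1 : Set Ω := evF K T D n j ∩ {ω | kthSmallest (T ω j) K < D ω j}

/-- Device `n` fails to receive update `j`, whose deadline expires before it is served. -/
def evF2 : Set Ω := evF K T D n j ∩ {ω | D ω j < kthSmallest (T ω j) K}

end Events

end

end MulticastAoI

open MulticastAoI

namespace MulticastAoI

open Set Real

/-! ### Shifted exponential distributions -/

/-! One update. With y = exp(-λ_s(t - c)), the probability that one service time exceeds t ≥ c, the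
tail P(T_N(h) > t) is a binomial tail in y. Its derivative in y telescopes to a single term, whose
binomial expansion has the coefficients B_{h,j}; integrating back, the tail is the sum of (B/U) y^U
(`binomialTail_eq`), a combination of exponentials of rates λ_s U. Against the independent deadline
the rates add up to H = λ_s U + λ_d, so every moment on {D < T_N(h)} or {T_N(h) < D} is an integral
of a quadratic against an exponential (`integral_deadline`, `integral_kthSmallest`). Device n enters
by exchangeability: N times the expectation of a function of (T_n, T_N(K), D) is the expected sum of
that function over all ranks, T_N(h) replacing T_n (`mul_integral_eq_integral_sum`). Without ties,
rank h succeeds iff h ≤ K and T_N(h) < D, so each event becomes a count of ranks. The denominator of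
P(C_F,2) needs one more identity, Σ_h R_h = N λ_d/(λ_s + λ_d) (`sum_R_eq`).

Renewals. The updates form an i.i.d. sequence, and receptions are its visits to a set S of
probability P(C_S). Decomposing over the time of the first visit shows that the block ending there
is independent of the rest, and that the rest has the law of the whole path
(`indepFun_block_afterHit`, `measurePreserving_afterHit`). The term at the visit has the conditional
law given S (`map_hitTerm`). The sum W of f before the visit satisfies W = 1{z 0 ∉ S}(f(z 0) +
W∘shift); taking first and second moments and solving the two linear equations gives E W and E W²
(`integral_preHitSum`), once truncation and Fatou have shown W ∈ L² (`memLp_preHitSum`). The same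
recursion shows that W and the term at the visit are uncorrelated (`integral_preHitSum_mul`).

Age. Let G_q be the time between the generations of the q-th received update and the next one, and
V_q the service time of the q-th. Between consecutive receptions the age is linear, with integral
G_q²/2 + G_q V_{q+1} + (V_{q+1}² - V_q²)/2; the last term telescopes, and the peak is G_q + V_{q+1}.
These quantities depend on two successive blocks, so they are independent only at distance two; the
strong law is applied to even and odd indices separately (`tendsto_average_of_indepFun_two`). As G_q
is the duration of a received update plus the W of the following block, E[G_q V_{q+1}] = E[G] E[V],
and the average age is (E[G²]/2 + E[G] E[V]) / E[G]. -/

theorem shiftedExp_isProbabilityMeasure {c r : ℝ} (hr : 0 < r) :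
    IsProbabilityMeasure (shiftedExp c r) := by
  have := isProbabilityMeasure_expMeasure hr
  exact Measure.isProbabilityMeasure_map (by fun_prop)

theorem shiftedExp_Iic {c r t : ℝ} (hr : 0 < r) (ht : c ≤ t) :
    shiftedExp c r (Iic t) = ENNReal.ofReal (1 - exp (-(r * (t - c)))) := by
  have hpre : (fun x => c + x) ⁻¹' (Iic t) = Iic (t - c) := by
    ext x; simp [le_sub_iff_add_le, add_comm]
  have h : expMeasure r = volume.withDensity (exponentialPDF r) := rfl
  rw [shiftedExp, Measure.map_apply (by fun_prop) measurableSet_Iic, hpre, h,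
    withDensity_apply _ measurableSet_Iic, lintegral_exponentialPDF_eq_antiDeriv hr,
    if_pos (sub_nonneg.2 ht)]

/-- A finite measure on the line is determined by its values on the sets `Iic t`. For t ≥ c these
agree by the fundamental theorem of calculus; below c both vanish because G c = 1 leaves no mass
there. It serves both the shifted exponential and the order statistics. -/
theorem eq_withDensity_of_tail (ν : Measure ℝ) [IsProbabilityMeasure ν] {f G : ℝ → ℝ} {c : ℝ}
    (hν : ∀ t, c ≤ t → ν (Iic t) = ENNReal.ofReal (1 - G t))
    (hG : ∀ t, HasDerivAt G (-(f t)) t) (hf : ∀ t, c ≤ t → 0 ≤ f t) (hc : G c = 1)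
    (hlim : Tendsto G atTop (𝓝 0)) :
    ν = (volume.restrict (Ioi c)).withDensity (fun t => ENNReal.ofReal (f t)) := by
  have hd : ∀ x ∈ Ici c, HasDerivAt (fun t => -G t) (f x) x := fun x _ => by
    exact (hG x).neg.congr_deriv (neg_neg _)
  have hlim' : Tendsto (fun t => -G t) atTop (𝓝 0) := by simpa using hlim.neg
  -- Integrability costs nothing: f is a nonnegative derivative of a function with a finite limit.
  have hint : IntegrableOn f (Ioi c) :=
    integrableOn_Ioi_deriv_of_nonneg' hd (fun x hx => hf x (le_of_lt hx)) hlim'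
  refine Measure.ext_of_Iic _ _ fun t => ?_
  rw [withDensity_apply _ measurableSet_Iic, Measure.restrict_restrict measurableSet_Iic]
  rcases lt_or_ge t c with ht | ht
  · have h0 : ν (Iic t) = 0 := by
      refine measure_mono_null (Iic_subset_Iic.2 ht.le) ?_
      rw [hν c le_rfl, hc]; simp
    have h1 : Iic t ∩ Ioi c = ∅ := by
      ext x; simp only [mem_inter_iff, mem_Iic, mem_Ioi, mem_empty_iff_false, iff_false]
      rintro ⟨h, h'⟩; linarith
    rw [h0, h1]; simp
  · rw [inter_comm, Ioi_inter_Iic, hν t ht,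
      ← ofReal_integral_eq_lintegral_ofReal (hint.mono_set Ioc_subset_Ioi_self)
        ((ae_restrict_iff' measurableSet_Ioc).2 (Eventually.of_forall fun x hx => hf x hx.1.le)),
      ← intervalIntegral.integral_of_le ht,
      intervalIntegral.integral_eq_sub_of_hasDerivAt (f := fun t => -G t) (fun x hx => ?_)
        ((intervalIntegrable_iff_integrableOn_Ioc_of_le ht).2
          (hint.mono_set Ioc_subset_Ioi_self)), hc]
    · congr 1; ring
    · rw [uIcc_of_le ht] at hx; exact hd x hx.1

/-- The value of `∫ t > c, (α + β t + γ t²) e^{-H (t - c)}`. -/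
noncomputable def expMoment (c H α β γ : ℝ) : ℝ :=
  (α + β * c + γ * c ^ 2) / H + (β + 2 * γ * c) / H ^ 2 + 2 * γ / H ^ 3

theorem tendsto_pow_mul_exp_shift {c H : ℝ} (hH : 0 < H) (k : ℕ) :
    Tendsto (fun t : ℝ => t ^ k * exp (-(H * (t - c)))) atTop (𝓝 0) := by
  have h := (tendsto_rpow_mul_exp_neg_mul_atTop_nhds_zero k H hH).mul_const (exp (H * c))
  simp only [zero_mul, rpow_natCast] at h
  refine h.congr fun t => ?_
  rw [mul_assoc, ← exp_add]; congr 2; ring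

/-- Repeated integration by parts gives the antiderivative A. Nonnegative coefficients and c ≥ 0
keep the integrand nonnegative, so the limit of A yields integrability and value at once. The
choices (1,0,0), (0,1,0), (0,0,1) of (α,β,γ) later give probabilities, first moments and second
moments from one computation. -/
theorem integrableOn_and_integral_exp {c H α β γ : ℝ} (hc : 0 ≤ c) (hH : 0 < H) (hα : 0 ≤ α)
    (hβ : 0 ≤ β) (hγ : 0 ≤ γ) :
    IntegrableOn (fun t => (α + β * t + γ * t ^ 2) * exp (-(H * (t - c)))) (Ioi c) ∧
    ∫ t in Ioi c, (α + β * t + γ * t ^ 2) * exp (-(H * (t - c))) = expMoment c H α β γ := by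
  set A : ℝ → ℝ := fun t => -(((α + β * t + γ * t ^ 2) / H + (β + 2 * γ * t) / H ^ 2
    + 2 * γ / H ^ 3) * exp (-(H * (t - c)))) with hA
  have hd : ∀ x ∈ Ici c, HasDerivAt A ((α + β * x + γ * x ^ 2) * exp (-(H * (x - c)))) x := by
    intro x _
    have he : HasDerivAt (fun t => exp (-(H * (t - c)))) (exp (-(H * (x - c))) * (-(H * 1))) x :=
      ((((hasDerivAt_id x).sub_const c).const_mul H).neg).exp
    have hp : HasDerivAt (fun t : ℝ => (α + β * t + γ * t ^ 2) / H + (β + 2 * γ * t) / H ^ 2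
        + 2 * γ / H ^ 3) ((β + 2 * γ * x) / H + 2 * γ / H ^ 2) x := by
      have h1 : HasDerivAt (fun t : ℝ => α + β * t + γ * t ^ 2) (β * 1 + γ * (2 * x ^ 1 * 1)) x := by
        exact (((hasDerivAt_id x).const_mul β).const_add α).add
          (((hasDerivAt_id x).pow 2).const_mul γ)
      have h2 : HasDerivAt (fun t : ℝ => β + 2 * γ * t) (2 * γ * 1) x :=
        (((hasDerivAt_id x).const_mul (2 * γ)).const_add β)
      refine (((h1.div_const H).add (h2.div_const (H ^ 2))).add_const (2 * γ / H ^ 3)).congr_deriv ?_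
      field_simp
    refine (hp.mul he).neg.congr_deriv ?_
    field_simp
    ring
  have hnn : ∀ x ∈ Ioi c, 0 ≤ (α + β * x + γ * x ^ 2) * exp (-(H * (x - c))) := by
    intro x hx
    have : 0 ≤ x := hc.trans (le_of_lt hx)
    positivity
  have hlim : Tendsto A atTop (𝓝 0) := by
    have h0 := tendsto_pow_mul_exp_shift (c := c) hH 0
    have h1 := tendsto_pow_mul_exp_shift (c := c) hH 1
    have h2 := tendsto_pow_mul_exp_shift (c := c) hH 2
    have := ((h0.const_mul (-(α / H + β / H ^ 2 + 2 * γ / H ^ 3))).add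
      (h1.const_mul (-(β / H + 2 * γ / H ^ 2)))).add (h2.const_mul (-(γ / H)))
    simp only [mul_zero, add_zero] at this
    refine this.congr fun t => ?_
    rw [hA]; ring
  refine ⟨integrableOn_Ioi_deriv_of_nonneg' hd hnn hlim, ?_⟩
  rw [integral_Ioi_of_hasDerivAt_of_nonneg' hd hnn hlim, hA]
  simp [expMoment]

theorem integral_of_tail (ν : Measure ℝ) [IsProbabilityMeasure ν] {f G : ℝ → ℝ} {c : ℝ}
    (hfm : Measurable f)
    (hν : ∀ t, c ≤ t → ν (Iic t) = ENNReal.ofReal (1 - G t))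
    (hG : ∀ t, HasDerivAt G (-(f t)) t) (hf : ∀ t, c ≤ t → 0 ≤ f t) (hc : G c = 1)
    (hlim : Tendsto G atTop (𝓝 0)) (φ : ℝ → ℝ) :
    (Integrable φ ν ↔ IntegrableOn (fun t => f t * φ t) (Ioi c)) ∧
    ∫ t, φ t ∂ν = ∫ t in Ioi c, f t * φ t := by
  have hcongr : (fun t => (ENNReal.ofReal (f t)).toReal • φ t) =ᵐ[volume.restrict (Ioi c)]
      fun t => f t * φ t := by
    filter_upwards [ae_restrict_mem measurableSet_Ioi] with t ht
    rw [ENNReal.toReal_ofReal (hf t (le_of_lt ht)), smul_eq_mul]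
  rw [eq_withDensity_of_tail ν hν hG hf hc hlim]
  constructor
  · rw [integrable_withDensity_iff_integrable_smul' (by fun_prop) (by simp),
      integrable_congr hcongr, IntegrableOn]
  · rw [integral_withDensity_eq_integral_toReal_smul (by fun_prop) (by simp),
      integral_congr_ae hcongr]

theorem noAtoms_of_tail (ν : Measure ℝ) [IsProbabilityMeasure ν] {f G : ℝ → ℝ} {c : ℝ}
    (hν : ∀ t, c ≤ t → ν (Iic t) = ENNReal.ofReal (1 - G t))
    (hG : ∀ t, HasDerivAt G (-(f t)) t) (hf : ∀ t, c ≤ t → 0 ≤ f t) (hc : G c = 1)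
    (hlim : Tendsto G atTop (𝓝 0)) : NullSingletonClass ν := by
  rw [eq_withDensity_of_tail ν hν hG hf hc hlim]
  infer_instance

theorem hasDerivAt_exp_shift (r c t : ℝ) :
    HasDerivAt (fun t => exp (-(r * (t - c)))) (-(r * exp (-(r * (t - c))))) t := by
  refine ((((hasDerivAt_id t).sub_const c).const_mul r).neg).exp.congr_deriv ?_
  simp only [mul_one, Pi.neg_apply, id]
  ring

theorem tendsto_exp_shift {r : ℝ} (hr : 0 < r) (c : ℝ) :
    Tendsto (fun t => exp (-(r * (t - c)))) atTop (𝓝 0) := by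
  simpa using tendsto_pow_mul_exp_shift (c := c) hr 0

theorem integral_shiftedExp {c r : ℝ} (hr : 0 < r) (φ : ℝ → ℝ) :
    (Integrable φ (shiftedExp c r) ↔
      IntegrableOn (fun t => r * exp (-(r * (t - c))) * φ t) (Ioi c)) ∧
    ∫ t, φ t ∂(shiftedExp c r) = ∫ t in Ioi c, r * exp (-(r * (t - c))) * φ t := by
  have := shiftedExp_isProbabilityMeasure (c := c) hr
  exact integral_of_tail _ (by fun_prop) (fun t ht => shiftedExp_Iic hr ht)
    (fun t => hasDerivAt_exp_shift r c t) (fun t _ => by positivity) (by simp)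
    (tendsto_exp_shift hr c) φ

theorem shiftedExp_noAtoms {c r : ℝ} (hr : 0 < r) : NullSingletonClass (shiftedExp c r) := by
  have := shiftedExp_isProbabilityMeasure (c := c) hr
  exact noAtoms_of_tail (f := fun t => r * exp (-(r * (t - c)))) _
    (fun t ht => shiftedExp_Iic hr ht)
    (fun t => hasDerivAt_exp_shift r c t) (fun t _ => by positivity) (by simp)
    (tendsto_exp_shift hr c)

theorem shiftedExp_ae_gt {c r : ℝ} (hr : 0 < r) : ∀ᵐ t ∂(shiftedExp c r), c < t := by
  rw [ae_iff]
  have : {a | ¬ c < a} = Iic c := by ext; simp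
  rw [this, shiftedExp_Iic hr le_rfl]; simp

theorem integrable_quadratic_shiftedExp {c r : ℝ} (hc : 0 ≤ c) (hr : 0 < r) {α β γ : ℝ}
    (hα : 0 ≤ α) (hβ : 0 ≤ β) (hγ : 0 ≤ γ) :
    Integrable (fun t => α + β * t + γ * t ^ 2) (shiftedExp c r) := by
  rw [(integral_shiftedExp hr _).1]
  exact IntegrableOn.congr_fun ((integrableOn_and_integral_exp hc hr hα hβ hγ).1.const_mul r)
    (fun t _ => by ring) measurableSet_Ioi

end MulticastAoI

namespace MulticastAoI

open Set Real

/-! ### Order statistics -/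

section OrderStatistics

variable {N : ℕ}

theorem card_filter_comp_perm (x : Fin N → ℝ) (σ : Equiv.Perm (Fin N)) (t : ℝ) :
    (Finset.univ.filter (fun m => x (σ m) ≤ t)).card =
      (Finset.univ.filter (fun m => x m ≤ t)).card :=
  Finset.card_equiv σ (by simp)

theorem kthSmallest_comp_perm (x : Fin N → ℝ) (σ : Equiv.Perm (Fin N)) (k : ℕ) :
    kthSmallest (x ∘ σ) k = kthSmallest x k := by
  simp only [kthSmallest, Function.comp_apply, card_filter_comp_perm]

/-- At least i + 1 values are at most t exactly when t reaches the sorted value of index i, so the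
infimum runs over a closed half-line. The shift by one arises because `Tuple.sort` indexes from 0
and `kthSmallest` counts from 1. -/
theorem kthSmallest_succ (x : Fin N → ℝ) (i : Fin N) :
    kthSmallest x (i + 1) = x (Tuple.sort x i) := by
  have h : {t : ℝ | (i : ℕ) + 1 ≤ (Finset.univ.filter (fun m => x m ≤ t)).card} =
      Ici (x (Tuple.sort x i)) := by
    ext t
    rw [mem_ofPred_eq, mem_Ici, ← card_filter_comp_perm x (Tuple.sort x) t, Nat.succ_le_iff]
    exact Tuple.lt_card_le_iff_apply_le_of_monotone (Tuple.monotone_sort x)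
  rw [kthSmallest, h, csInf_Ici]

theorem exists_kthSmallest_eq (x : Fin N → ℝ) {h : ℕ} (h1 : 1 ≤ h) (hN : h ≤ N) :
    ∃ i : Fin N, (i : ℕ) + 1 = h ∧ kthSmallest x h = x (Tuple.sort x i) := by
  refine ⟨⟨h - 1, by omega⟩, by simp; omega, ?_⟩
  rw [← kthSmallest_succ x, Fin.val_mk, Nat.sub_add_cancel h1]

/-- Reduces order statistics to counting, through which both measurability and the law are obtained.
-/
theorem kthSmallest_le_iff (x : Fin N → ℝ) {h : ℕ} (h1 : 1 ≤ h) (hN : h ≤ N) (t : ℝ) :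
    kthSmallest x h ≤ t ↔ h ≤ (Finset.univ.filter (fun m => x m ≤ t)).card := by
  obtain ⟨i, hi, he⟩ := exists_kthSmallest_eq x h1 hN
  rw [he, ← card_filter_comp_perm x (Tuple.sort x) t, ← hi, Nat.succ_le_iff]
  exact (Tuple.lt_card_le_iff_apply_le_of_monotone (Tuple.monotone_sort x)).symm

theorem kthSmallest_lt (x : Fin N → ℝ) (hx : Function.Injective x) {h k : ℕ} (h1 : 1 ≤ h)
    (hk : h < k) (hN : k ≤ N) : kthSmallest x h < kthSmallest x k := by
  obtain ⟨i, hi, he⟩ := exists_kthSmallest_eq x h1 (hk.le.trans hN)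
  obtain ⟨j, hj, he'⟩ := exists_kthSmallest_eq x (h1.trans hk.le) hN
  have hs : StrictMono (x ∘ Tuple.sort x) :=
    (Tuple.monotone_sort x).strictMono_of_injective (hx.comp (Tuple.sort x).injective)
  rw [he, he']
  exact hs (Fin.lt_def.2 (by omega))

theorem kthSmallest_le (x : Fin N → ℝ) {h k : ℕ} (h1 : 1 ≤ h)
    (hk : h ≤ k) (hN : k ≤ N) : kthSmallest x h ≤ kthSmallest x k := by
  rw [kthSmallest_le_iff x h1 (hk.trans hN)]
  exact hk.trans ((kthSmallest_le_iff x (h1.trans hk) hN _).1 le_rfl)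

/-- Reindexing by the sorting permutation. This is the deterministic half of the passage from
devices to ranks. -/
theorem sum_comp_eq_sum_kthSmallest (x : Fin N → ℝ) (φ : ℝ → ℝ) :
    ∑ m, φ (x m) = ∑ h ∈ Finset.Icc 1 N, φ (kthSmallest x h) := by
  rw [← Equiv.sum_comp (Tuple.sort x) (fun m => φ (x m))]
  simp only [← kthSmallest_succ]
  rw [Fin.sum_univ_eq_sum_range (fun i => φ (kthSmallest x (i + 1))) N, Finset.range_eq_Ico,
    Finset.sum_Ico_add' (fun i => φ (kthSmallest x i)) 0 N 1]
  rfl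

theorem kthSmallest_pos (x : Fin N → ℝ) {h : ℕ} (h1 : 1 ≤ h) (hN : h ≤ N) {c : ℝ}
    (hx : ∀ m, c < x m) : c < kthSmallest x h := by
  obtain ⟨i, -, he⟩ := exists_kthSmallest_eq x h1 hN
  rw [he]; exact hx _

theorem measurableSet_card_le (h : ℕ) (t : ℝ) :
    MeasurableSet {x : Fin N → ℝ | h ≤ (Finset.univ.filter (fun m => x m ≤ t)).card} := by
  have : Measurable fun x : Fin N → ℝ => (Finset.univ.filter (fun m => x m ≤ t)).card := by
    simp only [Finset.card_filter]
    refine Finset.measurable_sum _ fun m _ => ?_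
    exact Measurable.ite (measurableSet_le (measurable_pi_apply m) measurable_const)
      measurable_const measurable_const
  exact this (measurableSet_Ici (a := h))

theorem measurable_kthSmallest {h : ℕ} (h1 : 1 ≤ h) (hN : h ≤ N) :
    Measurable fun x : Fin N → ℝ => kthSmallest x h := by
  refine measurable_of_Iic fun t => ?_
  have : (fun x : Fin N → ℝ => kthSmallest x h) ⁻¹' Iic t =
      {x | h ≤ (Finset.univ.filter (fun m => x m ≤ t)).card} := by
    ext x; exact kthSmallest_le_iff x h1 hN t
  rw [this]; exact measurableSet_card_le h t

/-- The probability that fewer than `h` out of `N` independent events of probability `1 - y`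
occur. -/
noncomputable def binomialTail (N h : ℕ) (y : ℝ) : ℝ :=
  ∑ i ∈ Finset.range h, (N.choose i : ℝ) * (1 - y) ^ i * y ^ (N - i)

/-- Prescribing exactly which coordinates are at most t describes a box, so the product measure
factorizes. -/
theorem pi_real_filter_eq (ν : Measure ℝ) [IsProbabilityMeasure ν] (t : ℝ) (A : Finset (Fin N)) :
    (Measure.pi fun _ : Fin N => ν).real {x | Finset.univ.filter (fun m => x m ≤ t) = A} =
      ν.real (Iic t) ^ A.card * (1 - ν.real (Iic t)) ^ (N - A.card) := by
  classical
  have hset : {x : Fin N → ℝ | Finset.univ.filter (fun m => x m ≤ t) = A} =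
      Set.pi univ (fun m => if m ∈ A then Iic t else (Iic t)ᶜ) := by
    ext x
    simp only [mem_ofPred_eq, Set.mem_pi, mem_univ, forall_true_left, Finset.ext_iff,
      Finset.mem_filter, Finset.mem_univ, true_and]
    refine forall_congr' fun m => ?_
    by_cases hm : m ∈ A <;> simp [hm]
  rw [hset, measureReal_def, Measure.pi_pi, ENNReal.toReal_prod]
  have : ∀ m, (ν (if m ∈ A then Iic t else (Iic t)ᶜ)).toReal =
      if m ∈ A then ν.real (Iic t) else 1 - ν.real (Iic t) := by
    intro m
    split_ifs
    · rfl
    · exact probReal_compl_eq_one_sub measurableSet_Iic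
  simp only [this]
  rw [Finset.prod_ite]
  simp [Finset.filter_not, Finset.card_sdiff]

theorem pi_real_lt_kthSmallest (ν : Measure ℝ) [IsProbabilityMeasure ν] {h : ℕ} (h1 : 1 ≤ h)
    (hN : h ≤ N) (t : ℝ) :
    (Measure.pi fun _ : Fin N => ν).real {x | t < kthSmallest x h} =
      binomialTail N h (1 - ν.real (Iic t)) := by
  classical
  set P := (Measure.pi fun _ : Fin N => ν)
  have hset : {x : Fin N → ℝ | t < kthSmallest x h} =
      ⋃ A ∈ (Finset.univ.filter fun A : Finset (Fin N) => A.card < h),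
        {x | Finset.univ.filter (fun m => x m ≤ t) = A} := by
    ext x
    rw [mem_ofPred_eq, ← not_le, kthSmallest_le_iff x h1 hN]
    simp
  have hmeas : ∀ A : Finset (Fin N),
      MeasurableSet {x : Fin N → ℝ | Finset.univ.filter (fun m => x m ≤ t) = A} := by
    intro A
    have : {x : Fin N → ℝ | Finset.univ.filter (fun m => x m ≤ t) = A} =
      ⋂ m, {x | x m ≤ t ↔ m ∈ A} := by
      ext x; simp [Finset.ext_iff]
    rw [this]
    refine MeasurableSet.iInter fun m => ?_
    by_cases hm : m ∈ A
    · simpa [hm] using measurableSet_le (measurable_pi_apply m) measurable_const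
    · simpa [hm] using measurableSet_lt measurable_const (measurable_pi_apply m)
  rw [hset, measureReal_biUnion_finset (fun A _ B _ hAB => ?_) (fun A _ => hmeas A)]
  · simp only [P, pi_real_filter_eq]
    -- The weight of A depends only on its cardinality; grouping by cardinality produces the
    -- binomial coefficients.
    rw [binomialTail, ← Finset.sum_fiberwise_of_maps_to (g := Finset.card) (t := Finset.range h)
      (by simp)]
    refine Finset.sum_congr rfl fun i hi => ?_
    rw [Finset.sum_congr rfl (g := fun _ => ν.real (Iic t) ^ i * (1 - ν.real (Iic t)) ^ (N - i))
      (by intro A hA; rw [(Finset.mem_filter.1 hA).2])]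
    have hc : (Finset.filter (fun A => A.card = i)
        (Finset.univ.filter fun A : Finset (Fin N) => A.card < h)) =
        Finset.powersetCard i Finset.univ := by
      ext A
      have := Finset.mem_range.1 hi
      simp only [Finset.mem_filter, Finset.mem_univ, true_and, Finset.mem_powersetCard,
        Finset.subset_univ]
      constructor
      · exact fun h => h.2
      · exact fun h => ⟨by omega, h⟩
    rw [Finset.sum_const, hc, Finset.card_powersetCard]
    simp; ring
  · exact Set.disjoint_left.2 fun x hx hx' => hAB (hx.symm.trans hx')

/-- The differentiated sum telescopes: the second half of each term cancels the first half of the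
next, because C(N,i)(N - i) = C(N,i+1)(i + 1). Only one term survives. -/
theorem hasDerivAt_binomialTail {h : ℕ} (hN : h + 1 ≤ N) (y : ℝ) :
    HasDerivAt (binomialTail N (h + 1))
      ((h + 1 : ℝ) * (N.choose (h + 1) : ℝ) * (1 - y) ^ h * y ^ (N - (h + 1))) y := by
  have hterm : ∀ i, HasDerivAt (fun y : ℝ => (N.choose i : ℝ) * (1 - y) ^ i * y ^ (N - i))
      ((N.choose i : ℝ) * (i * (1 - y) ^ (i - 1) * (-1)) * y ^ (N - i) +
        (N.choose i : ℝ) * (1 - y) ^ i * (((N - i : ℕ) : ℝ) * y ^ (N - i - 1))) y := by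
    intro i
    have h1 : HasDerivAt (fun y : ℝ => (1 - y) ^ i) (i * (1 - y) ^ (i - 1) * (-1)) y := by
      exact ((hasDerivAt_id y).const_sub 1).pow i
    exact (h1.const_mul _).mul (hasDerivAt_pow _ _)
  induction h with
  | zero =>
    have := hterm 0
    unfold binomialTail
    simpa using this
  | succ h ih =>
    have hfun : binomialTail N (h + 1 + 1) = fun y => binomialTail N (h + 1) y +
        (N.choose (h + 1) : ℝ) * (1 - y) ^ (h + 1) * y ^ (N - (h + 1)) := by
      ext y; rw [binomialTail, Finset.sum_range_succ]; rfl
    rw [hfun]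
    refine ((ih (by omega)).add (hterm (h + 1))).congr_deriv ?_
    have hch : (N.choose (h + 1) : ℝ) * ((N - (h + 1) : ℕ) : ℝ) =
        (N.choose (h + 1 + 1) : ℝ) * ((h + 1 : ℕ) + 1 : ℝ) := by
      exact_mod_cast (Nat.choose_succ_right_eq N (h + 1)).symm
    simp only [Nat.add_sub_cancel]
    have e1 : N - (h + 1) - 1 = N - (h + 1 + 1) := by omega
    rw [e1]
    push_cast at hch ⊢
    linear_combination ((1 - y) ^ (h + 1) * y ^ (N - (h + 1 + 1))) * hch

end OrderStatistics

/-! ### Expansion of the binomial tail in powers, with coefficients B / U -/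

section ClosedForm

variable (p : Params)

theorem Params.U_eq {h : ℕ} (hN : h ≤ p.N) (j : ℕ) : p.U h j = ((p.N - h + j + 1 : ℕ) : ℝ) := by
  rw [Params.U]; push_cast [Nat.cast_sub hN]; ring

theorem Params.U_pos {h : ℕ} (hN : h ≤ p.N) (j : ℕ) : 0 < p.U h j := by
  rw [p.U_eq hN]; positivity

theorem Params.sum_B_mul_pow {h : ℕ} (y : ℝ) :
    ∑ j ∈ Finset.range (h + 1), p.B (h + 1) j * y ^ (p.N - (h + 1) + j) =
      (h + 1 : ℝ) * (p.N.choose (h + 1) : ℝ) * (1 - y) ^ h * y ^ (p.N - (h + 1)) := by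
  have : (1 - y) ^ h = ∑ j ∈ Finset.range (h + 1), (-y) ^ j * 1 ^ (h - j) * (h.choose j : ℝ) := by
    rw [← add_pow]; ring
  rw [this, Finset.mul_sum, Finset.sum_mul]
  refine Finset.sum_congr rfl fun j _ => ?_
  rw [Params.B, pow_add, neg_pow]
  rw [Nat.add_sub_cancel]
  push_cast
  ring

/-- Both sides are functions of y with the same derivative, by `hasDerivAt_binomialTail` and
`Params.sum_B_mul_pow`, and both vanish at 0. This replaces a rearrangement of binomial sums. -/
theorem binomialTail_eq {h : ℕ} (h1 : 1 ≤ h) (hN : h ≤ p.N) (y : ℝ) :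
    binomialTail p.N h y =
      ∑ j ∈ Finset.range h, p.B h j / p.U h j * y ^ (p.N - h + j + 1) := by
  obtain ⟨h, rfl⟩ : ∃ k, h = k + 1 := ⟨h - 1, by omega⟩
  set g : ℝ → ℝ := fun y =>
    ∑ j ∈ Finset.range (h + 1), p.B (h + 1) j / p.U (h + 1) j * y ^ (p.N - (h + 1) + j + 1) with hg
  have hgd : ∀ y, HasDerivAt g
      ((h + 1 : ℝ) * (p.N.choose (h + 1) : ℝ) * (1 - y) ^ h * y ^ (p.N - (h + 1))) y := by
    intro y
    rw [← p.sum_B_mul_pow]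
    refine HasDerivAt.fun_sum fun j _ => ?_
    refine ((hasDerivAt_pow _ y).const_mul _).congr_deriv ?_
    have := (p.U_pos hN j).ne'
    rw [← p.U_eq hN]
    simp only [Nat.add_sub_cancel]
    field_simp
  have hd : ∀ y, HasDerivAt (fun y => binomialTail p.N (h + 1) y - g y) 0 y := fun y => by
    exact ((hasDerivAt_binomialTail hN y).sub (hgd y)).congr_deriv (sub_self _)
  have hconst := is_const_of_deriv_eq_zero (fun y => (hd y).differentiableAt)
    (fun y => (hd y).deriv) y 0
  have h0 : binomialTail p.N (h + 1) 0 - g 0 = 0 := by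
    have hg0 : g 0 = 0 := Finset.sum_eq_zero fun j _ => by simp
    rw [hg0, sub_zero]
    refine Finset.sum_eq_zero fun i hi => ?_
    -- Here h ≤ N matters: every i < h leaves a positive power of y, which vanishes at 0.
    have : p.N - i ≠ 0 := by have := Finset.mem_range.1 hi; omega
    simp [this]
  rw [h0] at hconst
  exact sub_eq_zero.1 hconst

end ClosedForm

end MulticastAoI

namespace MulticastAoI

open Set Real

/-! ### The law of one update -/

/-- The standing assumptions on the parameters. -/
structure Params.Valid (p : Params) : Prop where
  one_le_K : 1 ≤ p.K
  K_le_N : p.K ≤ p.N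
  lamS_pos : 0 < p.lamS
  lamD_pos : 0 < p.lamD
  c_pos : 0 < p.c

/-- Service times and deadline of one update. -/
abbrev Params.Update (p : Params) := (Fin p.N → ℝ) × ℝ

/-- Joint law of the service times of one update. -/
noncomputable def Params.serviceLaw (p : Params) : Measure (Fin p.N → ℝ) :=
  Measure.pi fun _ => shiftedExp p.c p.lamS

/-- Joint law of the service times and the deadline of one update. -/
noncomputable def Params.updateLaw (p : Params) : Measure p.Update :=
  p.serviceLaw.prod (shiftedExp p.c p.lamD)

/-- Tail function of the `h`-th order statistic of the service times. -/
noncomputable def Params.orderTail (p : Params) (h : ℕ) (t : ℝ) : ℝ :=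
  ∑ j ∈ Finset.range h, p.B h j / p.U h j * exp (-(p.lamS * p.U h j * (t - p.c)))

/-- Density of the `h`-th order statistic of the service times. -/
noncomputable def Params.orderDensity (p : Params) (h : ℕ) (t : ℝ) : ℝ :=
  ∑ j ∈ Finset.range h, p.B h j * p.lamS * exp (-(p.lamS * p.U h j * (t - p.c)))

/-- The exponents in `binomialTail_eq` are exactly the U_{h,j}, so substituting y = exp(-λ_s(t - c))
turns the powers into exponentials of rate λ_s U_{h,j}. -/
theorem Params.orderTail_eq_binomialTail (p : Params) {h : ℕ} (h1 : 1 ≤ h) (hN : h ≤ p.N) (t : ℝ) :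
    p.orderTail h t = binomialTail p.N h (exp (-(p.lamS * (t - p.c)))) := by
  rw [binomialTail_eq p h1 hN, Params.orderTail]
  refine Finset.sum_congr rfl fun j _ => ?_
  rw [← exp_nat_mul, ← p.U_eq hN]
  congr 2; ring

theorem Params.hasDerivAt_orderTail (p : Params) {h : ℕ} (hN : h ≤ p.N) (t : ℝ) :
    HasDerivAt (p.orderTail h) (-(p.orderDensity h t)) t := by
  rw [Params.orderDensity, ← Finset.sum_neg_distrib]
  refine HasDerivAt.fun_sum fun j _ => ?_
  refine ((hasDerivAt_exp_shift (p.lamS * p.U h j) p.c t).const_mul _).congr_deriv ?_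
  have := (p.U_pos hN j).ne'
  field_simp

/-- At t = c one has y = 1, and in the binomial form only the term i = 0 survives, which is present
since h ≥ 1. -/
theorem Params.orderTail_shift (p : Params) {h : ℕ} (h1 : 1 ≤ h) (hN : h ≤ p.N) :
    p.orderTail h p.c = 1 := by
  rw [p.orderTail_eq_binomialTail h1 hN, binomialTail, Finset.sum_eq_single 0]
  · simp
  · intro b _ hb; simp [hb]
  · intro h0; simp at h0; omega

section OneUpdate

variable {p : Params} (hp : p.Valid)

include hp

theorem Params.Valid.isProbabilityMeasure_serviceLaw : IsProbabilityMeasure p.serviceLaw := by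
  have := shiftedExp_isProbabilityMeasure (c := p.c) hp.lamS_pos
  exact inferInstanceAs (IsProbabilityMeasure (Measure.pi fun _ => shiftedExp p.c p.lamS))

theorem Params.Valid.isProbabilityMeasure_updateLaw : IsProbabilityMeasure p.updateLaw := by
  have := shiftedExp_isProbabilityMeasure (c := p.c) hp.lamD_pos
  have := hp.isProbabilityMeasure_serviceLaw
  exact inferInstanceAs (IsProbabilityMeasure (p.serviceLaw.prod (shiftedExp p.c p.lamD)))

theorem Params.Valid.real_lt_kthSmallest {h : ℕ} (h1 : 1 ≤ h) (hN : h ≤ p.N) {t : ℝ}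
    (ht : p.c ≤ t) : p.serviceLaw.real {x | t < kthSmallest x h} = p.orderTail h t := by
  have := shiftedExp_isProbabilityMeasure (c := p.c) hp.lamS_pos
  rw [Params.serviceLaw, pi_real_lt_kthSmallest _ h1 hN, p.orderTail_eq_binomialTail h1 hN,
    measureReal_def, shiftedExp_Iic hp.lamS_pos ht, ENNReal.toReal_ofReal, sub_sub_cancel]
  rw [sub_nonneg, exp_le_one_iff]
  have := hp.lamS_pos
  have := sub_nonneg.2 ht
  simp only [Left.neg_nonpos_iff]; positivity

theorem Params.Valid.orderLaw_Iic {h : ℕ} (h1 : 1 ≤ h) (hN : h ≤ p.N) {t : ℝ}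
    (ht : p.c ≤ t) : (p.serviceLaw.map fun x => kthSmallest x h) (Iic t) =
      ENNReal.ofReal (1 - p.orderTail h t) := by
  have := hp.isProbabilityMeasure_serviceLaw
  rw [Measure.map_apply (measurable_kthSmallest h1 hN) measurableSet_Iic,
    ← hp.real_lt_kthSmallest h1 hN ht, ← probReal_compl_eq_one_sub
      (measurableSet_lt measurable_const (measurable_kthSmallest h1 hN)), measureReal_def,
      ENNReal.ofReal_toReal (measure_ne_top _ _)]
  congr 1
  ext x; simp

/-- The defining sum alternates in sign, so nonnegativity is invisible term by term. Read backwards,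
`Params.sum_B_mul_pow` collapses it to a product of nonnegative factors. -/
theorem Params.Valid.orderDensity_nonneg {h : ℕ} (h1 : 1 ≤ h) (hN : h ≤ p.N) {t : ℝ}
    (ht : p.c ≤ t) : 0 ≤ p.orderDensity h t := by
  obtain ⟨h, rfl⟩ : ∃ k, h = k + 1 := ⟨h - 1, by omega⟩
  set y := exp (-(p.lamS * (t - p.c))) with hy
  have hS := hp.lamS_pos
  have hy1 : y ≤ 1 := by
    rw [hy, exp_le_one_iff]
    have := sub_nonneg.2 ht
    simp only [Left.neg_nonpos_iff]; positivity
  have : p.orderDensity (h + 1) t = p.lamS * y *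
      ((h + 1 : ℝ) * (p.N.choose (h + 1) : ℝ) * (1 - y) ^ h * y ^ (p.N - (h + 1))) := by
    rw [← p.sum_B_mul_pow, Params.orderDensity, Finset.mul_sum]
    refine Finset.sum_congr rfl fun j _ => ?_
    have : exp (-(p.lamS * p.U (h + 1) j * (t - p.c))) = y ^ (p.N - (h + 1) + j + 1) := by
      rw [hy, ← exp_nat_mul, ← p.U_eq hN]
      congr 1; ring
    rw [this]; ring
  rw [this]
  have : 0 ≤ 1 - y := sub_nonneg.2 hy1
  have : 0 < y := exp_pos _
  positivity

theorem Params.Valid.tendsto_orderTail {h : ℕ} (hN : h ≤ p.N) :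
    Tendsto (p.orderTail h) atTop (𝓝 0) := by
  have : Tendsto (p.orderTail h) atTop (𝓝 (∑ j ∈ Finset.range h, p.B h j / p.U h j * 0)) :=
    tendsto_finsetSum _ fun j _ =>
      (tendsto_exp_shift (mul_pos hp.lamS_pos (p.U_pos hN j)) p.c).const_mul _
  simpa using this

theorem Params.Valid.integral_orderLaw {h : ℕ} (h1 : 1 ≤ h) (hN : h ≤ p.N) (φ : ℝ → ℝ) :
    (Integrable φ (p.serviceLaw.map fun x => kthSmallest x h) ↔
      IntegrableOn (fun t => p.orderDensity h t * φ t) (Ioi p.c)) ∧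
    ∫ t, φ t ∂(p.serviceLaw.map fun x => kthSmallest x h) =
      ∫ t in Ioi p.c, p.orderDensity h t * φ t := by
  have := hp.isProbabilityMeasure_serviceLaw
  have : IsProbabilityMeasure (p.serviceLaw.map fun x => kthSmallest x h) :=
    Measure.isProbabilityMeasure_map (measurable_kthSmallest h1 hN).aemeasurable
  refine integral_of_tail _ ?_ (fun t ht => hp.orderLaw_Iic h1 hN ht)
    (fun t => p.hasDerivAt_orderTail hN t) (fun t ht => hp.orderDensity_nonneg h1 hN ht)
    (p.orderTail_shift h1 hN) (hp.tendsto_orderTail hN) φ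
  unfold Params.orderDensity
  fun_prop

theorem Params.Valid.H_pos {h : ℕ} (hN : h ≤ p.N) (j : ℕ) : 0 < p.H h j :=
  add_pos (mul_pos hp.lamS_pos (p.U_pos hN j)) hp.lamD_pos

variable {α β γ : ℝ} (hα : 0 ≤ α) (hβ : 0 ≤ β) (hγ : 0 ≤ γ)

include hα hβ hγ

theorem Params.Valid.integrable_quadratic_deadline :
    Integrable (fun e : p.Update => α + β * e.2 + γ * e.2 ^ 2) p.updateLaw := by
  have := shiftedExp_isProbabilityMeasure (c := p.c) hp.lamD_pos
  have := hp.isProbabilityMeasure_serviceLaw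
  exact (integrable_quadratic_shiftedExp hp.c_pos.le hp.lamD_pos hα hβ hγ).comp_snd p.serviceLaw

theorem Params.Valid.integrable_quadratic_service (m : Fin p.N) :
    Integrable (fun e : p.Update => α + β * e.1 m + γ * e.1 m ^ 2) p.updateLaw := by
  have := shiftedExp_isProbabilityMeasure (c := p.c) hp.lamD_pos
  have := shiftedExp_isProbabilityMeasure (c := p.c) hp.lamS_pos
  have := hp.isProbabilityMeasure_serviceLaw
  have h1 : Integrable (fun x : Fin p.N → ℝ => α + β * x m + γ * x m ^ 2) p.serviceLaw :=
    (measurePreserving_eval (fun _ => shiftedExp p.c p.lamS) m).integrable_comp_of_integrable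
      (integrable_quadratic_shiftedExp hp.c_pos.le hp.lamS_pos hα hβ hγ)
  exact h1.comp_fst _

theorem Params.Valid.integrable_quadratic_kthSmallest {h : ℕ} (h1 : 1 ≤ h) (hN : h ≤ p.N) :
    Integrable (fun x : Fin p.N → ℝ => α + β * kthSmallest x h + γ * kthSmallest x h ^ 2)
      p.serviceLaw := by
  have hi : Integrable (fun t : ℝ => α + β * t + γ * t ^ 2)
      (p.serviceLaw.map fun x => kthSmallest x h) := by
    rw [(hp.integral_orderLaw h1 hN _).1]
    simp only [Params.orderDensity, Finset.sum_mul]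
    refine integrable_finsetSum _ fun j _ => ?_
    refine IntegrableOn.congr_fun ((integrableOn_and_integral_exp hp.c_pos.le
      (mul_pos hp.lamS_pos (p.U_pos hN j)) hα hβ hγ).1.const_mul (p.B h j * p.lamS))
      (fun t _ => by ring) measurableSet_Ioi
  exact hi.comp_measurable (measurable_kthSmallest h1 hN)

theorem Params.Valid.integrable_quadratic_kthSmallest' {h : ℕ} (h1 : 1 ≤ h) (hN : h ≤ p.N) :
    Integrable (fun e : p.Update => α + β * kthSmallest e.1 h + γ * kthSmallest e.1 h ^ 2)
      p.updateLaw := by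
  have := shiftedExp_isProbabilityMeasure (c := p.c) hp.lamD_pos
  exact (hp.integrable_quadratic_kthSmallest hα hβ hγ h1 hN).comp_fst _

/-- Moments of the deadline on the event that it expires before the `h`-th reception. -/
theorem Params.Valid.integral_deadline {h : ℕ} (h1 : 1 ≤ h) (hN : h ≤ p.N) :
    ∫ e, (if e.2 < kthSmallest e.1 h then α + β * e.2 + γ * e.2 ^ 2 else 0) ∂p.updateLaw =
      ∑ j ∈ Finset.range h, p.B h j * p.lamD / p.U h j * expMoment p.c (p.H h j) α β γ := by
  have := shiftedExp_isProbabilityMeasure (c := p.c) hp.lamD_pos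
  have := hp.isProbabilityMeasure_serviceLaw
  have hms : MeasurableSet {e : p.Update | e.2 < kthSmallest e.1 h} :=
    measurableSet_lt measurable_snd ((measurable_kthSmallest h1 hN).comp measurable_fst)
  have hint : Integrable (fun e : p.Update =>
      if e.2 < kthSmallest e.1 h then α + β * e.2 + γ * e.2 ^ 2 else 0) p.updateLaw :=
    (hp.integrable_quadratic_deadline hα hβ hγ).indicator hms
  have hin : ∀ d : ℝ, p.c < d → ∫ x, (if d < kthSmallest x h then α + β * d + γ * d ^ 2 else 0)
      ∂p.serviceLaw = p.orderTail h d * (α + β * d + γ * d ^ 2) := by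
    intro d hd
    rw [← hp.real_lt_kthSmallest h1 hN hd.le]
    have := integral_indicator_const (μ := p.serviceLaw) (α + β * d + γ * d ^ 2)
      (measurableSet_lt measurable_const (measurable_kthSmallest (N := p.N) h1 hN)
        : MeasurableSet {x : Fin p.N → ℝ | d < kthSmallest x h})
    simpa [indicator_apply] using this
  have hterm : ∀ j, IntegrableOn (fun t => p.B h j * p.lamD / p.U h j *
      ((α + β * t + γ * t ^ 2) * exp (-(p.H h j * (t - p.c))))) (Ioi p.c) := fun j =>
    (integrableOn_and_integral_exp hp.c_pos.le (hp.H_pos hN j) hα hβ hγ).1.const_mul _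
  rw [Params.updateLaw] at hint ⊢
  -- The service times are integrated first, with the deadline frozen: the inner integral is the
  -- tail of the order statistic at the deadline.
  rw [integral_prod_symm _ hint, (integral_shiftedExp hp.lamD_pos _).2]
  rw [setIntegral_congr_fun measurableSet_Ioi (g := fun t => ∑ j ∈ Finset.range h,
    p.B h j * p.lamD / p.U h j * ((α + β * t + γ * t ^ 2) * exp (-(p.H h j * (t - p.c)))))]
  · rw [integral_finsetSum _ fun j _ => hterm j]
    refine Finset.sum_congr rfl fun j _ => ?_
    rw [integral_const_mul,
      (integrableOn_and_integral_exp hp.c_pos.le (hp.H_pos hN j) hα hβ hγ).2]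
  · intro d hd
    simp only
    rw [hin d hd, Params.orderTail, Finset.sum_mul, Finset.mul_sum]
    refine Finset.sum_congr rfl fun j _ => ?_
    -- Rates add: H = λ_d + λ_s U.
    have : exp (-(p.H h j * (d - p.c))) =
        exp (-(p.lamD * (d - p.c))) * exp (-(p.lamS * p.U h j * (d - p.c))) := by
      rw [← exp_add, Params.H]; congr 1; ring
    rw [this]; ring

/-- Moments of the `h`-th reception time on the event that it precedes the deadline. -/
theorem Params.Valid.integral_kthSmallest {h : ℕ} (h1 : 1 ≤ h) (hN : h ≤ p.N) :
    ∫ e, (if kthSmallest e.1 h < e.2 then α + β * kthSmallest e.1 h + γ * kthSmallest e.1 h ^ 2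
      else 0) ∂p.updateLaw =
      ∑ j ∈ Finset.range h, p.B h j * p.lamS * expMoment p.c (p.H h j) α β γ := by
  have := shiftedExp_isProbabilityMeasure (c := p.c) hp.lamD_pos
  have := hp.isProbabilityMeasure_serviceLaw
  have hms : MeasurableSet {e : p.Update | kthSmallest e.1 h < e.2} :=
    measurableSet_lt ((measurable_kthSmallest h1 hN).comp measurable_fst) measurable_snd
  have hint : Integrable (fun e : p.Update => if kthSmallest e.1 h < e.2 then
      α + β * kthSmallest e.1 h + γ * kthSmallest e.1 h ^ 2 else 0) p.updateLaw :=
    (hp.integrable_quadratic_kthSmallest' hα hβ hγ h1 hN).indicator hms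
  set δ := shiftedExp p.c p.lamD with hδ
  set φ : ℝ → ℝ := fun t => δ.real (Ioi t) * (α + β * t + γ * t ^ 2) with hφ
  have hin : ∀ t : ℝ, ∫ d, (if t < d then α + β * t + γ * t ^ 2 else 0) ∂δ = φ t := by
    intro t
    have := integral_indicator_const (μ := δ) (α + β * t + γ * t ^ 2)
      (measurableSet_Ioi : MeasurableSet (Ioi t))
    simpa [indicator_apply] using this
  have htail : ∀ t, p.c ≤ t → δ.real (Ioi t) = exp (-(p.lamD * (t - p.c))) := by
    intro t ht
    rw [← compl_Iic, probReal_compl_eq_one_sub measurableSet_Iic, measureReal_def,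
      shiftedExp_Iic hp.lamD_pos ht, ENNReal.toReal_ofReal, sub_sub_cancel]
    rw [sub_nonneg, exp_le_one_iff]
    have := hp.lamD_pos
    have := sub_nonneg.2 ht
    simp only [Left.neg_nonpos_iff]; positivity
  -- The deadline tail is known in closed form only beyond c; monotonicity gives its measurability
  -- on the whole line.
  have hφm : Measurable φ := by
    have : Antitone fun t => δ.real (Ioi t) := fun s t hst =>
      measureReal_mono (Ioi_subset_Ioi hst)
    exact this.measurable.mul (by fun_prop)
  have hterm : ∀ j, IntegrableOn (fun t => p.B h j * p.lamS *
      ((α + β * t + γ * t ^ 2) * exp (-(p.H h j * (t - p.c))))) (Ioi p.c) := fun j =>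
    (integrableOn_and_integral_exp hp.c_pos.le (hp.H_pos hN j) hα hβ hγ).1.const_mul _
  rw [Params.updateLaw] at hint ⊢
  rw [integral_prod _ hint, ← hδ]
  simp only [hin]
  -- With the deadline integrated out, only the order statistic remains, and its law has the density
  -- `orderDensity`.
  rw [← integral_map (measurable_kthSmallest h1 hN).aemeasurable hφm.aestronglyMeasurable,
    (hp.integral_orderLaw h1 hN _).2]
  rw [setIntegral_congr_fun measurableSet_Ioi (g := fun t => ∑ j ∈ Finset.range h,
    p.B h j * p.lamS * ((α + β * t + γ * t ^ 2) * exp (-(p.H h j * (t - p.c)))))]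
  · rw [integral_finsetSum _ fun j _ => hterm j]
    refine Finset.sum_congr rfl fun j _ => ?_
    rw [integral_const_mul,
      (integrableOn_and_integral_exp hp.c_pos.le (hp.H_pos hN j) hα hβ hγ).2]
  · intro d hd
    simp only [hφ]
    rw [htail d (le_of_lt hd), Params.orderDensity, Finset.sum_mul]
    refine Finset.sum_congr rfl fun j _ => ?_
    have : exp (-(p.H h j * (d - p.c))) =
        exp (-(p.lamD * (d - p.c))) * exp (-(p.lamS * p.U h j * (d - p.c))) := by
      rw [← exp_add, Params.H]; congr 1; ring
    rw [this]; ring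

end OneUpdate

end MulticastAoI

namespace MulticastAoI

open Set Real

/-! ### Symmetrization over the devices -/

section Symmetry

variable {p : Params} (hp : p.Valid)

include hp

/-- Two coordinates are independent with an atomless law, so by Fubini the diagonal is null: each of
its sections is a point. There are finitely many pairs. -/
theorem Params.Valid.ae_service_injective :
    ∀ᵐ x ∂p.serviceLaw, Function.Injective x := by
  have := shiftedExp_isProbabilityMeasure (c := p.c) hp.lamS_pos
  have := shiftedExp_noAtoms (c := p.c) hp.lamS_pos
  have hpair : ∀ i j : Fin p.N, i ≠ j → ∀ᵐ x ∂p.serviceLaw, x i ≠ x j := by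
    intro i j hij
    have hind : IndepFun (fun x : Fin p.N → ℝ => x i) (fun x => x j) p.serviceLaw :=
      (iIndepFun_pi (μ := fun _ : Fin p.N => shiftedExp p.c p.lamS) (X := fun _ t => t)
        (fun _ => aemeasurable_id)).indepFun hij
    have hi : p.serviceLaw.map (fun x => x i) = shiftedExp p.c p.lamS :=
      (measurePreserving_eval (fun _ => shiftedExp p.c p.lamS) i).map_eq
    have hj : p.serviceLaw.map (fun x => x j) = shiftedExp p.c p.lamS :=
      (measurePreserving_eval (fun _ => shiftedExp p.c p.lamS) j).map_eq
    have hm := (indepFun_iff_map_prod_eq_prod_map_map' (measurable_pi_apply i).aemeasurable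
      (measurable_pi_apply j).aemeasurable
      (by rw [hi]; infer_instance) (by rw [hj]; infer_instance)).1 hind
    rw [hi, hj] at hm
    have hd : MeasurableSet {y : ℝ × ℝ | y.1 = y.2} :=
      measurableSet_eq_fun measurable_fst measurable_snd
    have h0 : ((shiftedExp p.c p.lamS).prod (shiftedExp p.c p.lamS)) {y : ℝ × ℝ | y.1 = y.2} = 0 := by
      rw [Measure.measure_prod_null hd]
      refine Eventually.of_forall fun t => ?_
      have : Prod.mk t ⁻¹' {y : ℝ × ℝ | y.1 = y.2} = {t} := by
        ext s; simp [eq_comm]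
      exact (congrArg _ this).trans (measure_singleton t)
    rw [← hm, Measure.map_apply (by fun_prop) hd] at h0
    rw [ae_iff]; simpa using h0
  have hall : ∀ᵐ x ∂p.serviceLaw, ∀ i j : Fin p.N, i ≠ j → x i ≠ x j := by
    rw [ae_all_iff]; intro i
    rw [ae_all_iff]; intro j
    by_cases hij : i = j
    · simp [hij]
    · filter_upwards [hpair i j hij] with x hx _ using hx
  filter_upwards [hall] with x hx i j hij
  by_contra h
  exact hx i j h hij

/-- Almost surely an update has no ties, and all its times exceed the shift. -/
theorem Params.Valid.ae_generic :
    ∀ᵐ e ∂p.updateLaw, Function.Injective e.1 ∧ (∀ m, e.1 m ≠ e.2) ∧ (∀ m, p.c < e.1 m) ∧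
      p.c < e.2 := by
  have := shiftedExp_isProbabilityMeasure (c := p.c) hp.lamS_pos
  have := shiftedExp_isProbabilityMeasure (c := p.c) hp.lamD_pos
  have := shiftedExp_noAtoms (c := p.c) hp.lamD_pos
  have := hp.isProbabilityMeasure_serviceLaw
  have h1 : ∀ᵐ e ∂p.updateLaw, Function.Injective e.1 :=
    (Measure.quasiMeasurePreserving_fst (μ := p.serviceLaw)
      (ν := shiftedExp p.c p.lamD)).ae hp.ae_service_injective
  have h2 : ∀ᵐ e ∂p.updateLaw, ∀ m, e.1 m ≠ e.2 := by
    rw [ae_all_iff]; intro m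
    rw [ae_iff]
    simp only [ne_eq, not_not]
    have hd : MeasurableSet {e : p.Update | e.1 m = e.2} :=
      measurableSet_eq_fun (by fun_prop) measurable_snd
    rw [Params.updateLaw, Measure.measure_prod_null hd]
    refine Eventually.of_forall fun x => ?_
    have : Prod.mk x ⁻¹' {e : p.Update | e.1 m = e.2} = {x m} := by
      ext s; simp [eq_comm]
    exact (congrArg _ this).trans (measure_singleton _)
  have h3 : ∀ᵐ e ∂p.updateLaw, ∀ m, p.c < e.1 m := by
    have : ∀ᵐ x ∂p.serviceLaw, ∀ m, p.c < x m := by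
      rw [ae_all_iff]; intro m
      exact (measurePreserving_eval (fun _ => shiftedExp p.c p.lamS)
        m).quasiMeasurePreserving.ae (shiftedExp_ae_gt hp.lamS_pos)
    exact (Measure.quasiMeasurePreserving_fst (μ := p.serviceLaw)
      (ν := shiftedExp p.c p.lamD)).ae this
  have h4 : ∀ᵐ e ∂p.updateLaw, p.c < e.2 :=
    (Measure.quasiMeasurePreserving_snd (μ := p.serviceLaw)
      (ν := shiftedExp p.c p.lamD)).ae (shiftedExp_ae_gt hp.lamD_pos)
  filter_upwards [h1, h2, h3, h4] with e a b c d using ⟨a, b, c, d⟩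

/-- The service times are i.i.d., hence exchangeable; the deadline is untouched. -/
theorem Params.Valid.measurePreserving_swap (n m : Fin p.N) :
    MeasurePreserving (fun e : p.Update => (e.1 ∘ Equiv.swap n m, e.2)) p.updateLaw
      p.updateLaw := by
  have := shiftedExp_isProbabilityMeasure (c := p.c) hp.lamS_pos
  have := shiftedExp_isProbabilityMeasure (c := p.c) hp.lamD_pos
  have := hp.isProbabilityMeasure_serviceLaw
  have h := measurePreserving_arrowCongr' (fun _ => shiftedExp p.c p.lamS)
    (fun _ => shiftedExp p.c p.lamS) (Equiv.swap n m) (MeasurableEquiv.refl ℝ)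
    (fun _ => MeasurePreserving.id (shiftedExp p.c p.lamS))
  have h' : MeasurePreserving (fun x : Fin p.N → ℝ => x ∘ Equiv.swap n m) p.serviceLaw
      p.serviceLaw := by
    convert h using 1
    · ext x i
      change x (Equiv.swap n m i) = x ((Equiv.swap n m).symm i)
      rw [Equiv.symm_swap]
    · rfl
    · rfl
  exact h'.prod (MeasurePreserving.id _)

/-- Averaging over the devices turns the service time of one device into the sum over all order
statistics. -/
theorem Params.Valid.mul_integral_eq_integral_sum (n : Fin p.N) (ψ : ℝ → ℝ → ℝ → ℝ)
    (hψ : Integrable (fun e : p.Update => ψ (e.1 n) (kthSmallest e.1 p.K) e.2) p.updateLaw) :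
    (p.N : ℝ) * ∫ e, ψ (e.1 n) (kthSmallest e.1 p.K) e.2 ∂p.updateLaw =
      ∫ e, ∑ h ∈ Finset.Icc 1 p.N, ψ (kthSmallest e.1 h) (kthSmallest e.1 p.K) e.2
        ∂p.updateLaw := by
  -- The transposition puts the time of device m in position n and changes neither the order
  -- statistic nor the deadline, so all devices contribute equally.
  have hme : ∀ m, (fun e : p.Update => ψ (e.1 m) (kthSmallest e.1 p.K) e.2) =
      (fun e : p.Update => ψ (e.1 n) (kthSmallest e.1 p.K) e.2) ∘
        (fun e : p.Update => (e.1 ∘ Equiv.swap n m, e.2)) := by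
    intro m; ext e
    simp [kthSmallest_comp_perm]
  have hi : ∀ m, Integrable (fun e : p.Update => ψ (e.1 m) (kthSmallest e.1 p.K) e.2)
      p.updateLaw := fun m => by
    rw [hme m]; exact (hp.measurePreserving_swap n m).integrable_comp_of_integrable hψ
  have hv : ∀ m, ∫ e, ψ (e.1 m) (kthSmallest e.1 p.K) e.2 ∂p.updateLaw =
      ∫ e, ψ (e.1 n) (kthSmallest e.1 p.K) e.2 ∂p.updateLaw := fun m => by
    have := integral_map (hp.measurePreserving_swap n m).measurable.aemeasurable
      (by rw [(hp.measurePreserving_swap n m).map_eq]; exact hψ.aestronglyMeasurable)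
    rw [(hp.measurePreserving_swap n m).map_eq] at this
    rw [this]
    exact integral_congr_ae (Eventually.of_forall fun e => congrFun (hme m) e)
  calc (p.N : ℝ) * ∫ e, ψ (e.1 n) (kthSmallest e.1 p.K) e.2 ∂p.updateLaw
      = ∑ m : Fin p.N, ∫ e, ψ (e.1 m) (kthSmallest e.1 p.K) e.2 ∂p.updateLaw := by
        rw [Finset.sum_congr rfl fun m _ => hv m]; simp
    _ = ∫ e, ∑ m : Fin p.N, ψ (e.1 m) (kthSmallest e.1 p.K) e.2 ∂p.updateLaw :=
        (integral_finsetSum _ fun m _ => hi m).symm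
    _ = _ := by
        congr 1; ext e
        exact sum_comp_eq_sum_kthSmallest e.1 fun t => ψ t (kthSmallest e.1 p.K) e.2

end Symmetry

theorem sum_Icc_ite_le {K N : ℕ} (hKN : K ≤ N) (a b : ℕ → ℝ) :
    ∑ h ∈ Finset.Icc 1 N, (if h ≤ K then a h else b h) =
      ∑ h ∈ Finset.Icc 1 K, a h + ∑ h ∈ Finset.Icc (K + 1) N, b h := by
  rw [Finset.sum_ite]
  congr 1
  · refine Finset.sum_congr ?_ fun _ _ => rfl
    ext h; simp only [Finset.mem_filter, Finset.mem_Icc]; omega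
  · refine Finset.sum_congr ?_ fun _ _ => rfl
    ext h; simp only [Finset.mem_filter, Finset.mem_Icc]; omega

end MulticastAoI

namespace MulticastAoI

open Set Real

/-! ### Integrals over the events of one update -/

/-- `∑ B λ_s ∫ t > c, (α + β t + γ t²) e^{-H (t - c)}`: a moment of the `h`-th reception time on the
event that it precedes the deadline. -/
noncomputable def Params.serveMoment (p : Params) (h : ℕ) (α β γ : ℝ) : ℝ :=
  ∑ j ∈ Finset.range h, p.B h j * p.lamS * expMoment p.c (p.H h j) α β γ

/-- A moment of the deadline on the event that it precedes the `h`-th reception time. -/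
noncomputable def Params.deadlineMoment (p : Params) (h : ℕ) (α β γ : ℝ) : ℝ :=
  ∑ j ∈ Finset.range h, p.B h j * p.lamD / p.U h j * expMoment p.c (p.H h j) α β γ

/-- Service times of the update, as a constant process. -/
def Params.svc (p : Params) : p.Update → ℕ → Fin p.N → ℝ := fun e _ => e.1

/-- Deadline of the update, as a constant process. -/
def Params.dl (p : Params) : p.Update → ℕ → ℝ := fun e _ => e.2

theorem kthSmallest_ne {N : ℕ} {x : Fin N → ℝ} {d : ℝ} (he : ∀ m, x m ≠ d) {h : ℕ}
    (h1 : 1 ≤ h) (hN : h ≤ N) : kthSmallest x h ≠ d := by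
  obtain ⟨i, -, hi⟩ := exists_kthSmallest_eq x h1 hN
  rw [hi]; exact he _

section Events

variable {p : Params} (hp : p.Valid) (n : Fin p.N) (j : ℕ)

section Measurability

variable {Ω : Type*} [MeasurableSpace Ω] {T : Ω → ℕ → Fin p.N → ℝ} {D : Ω → ℕ → ℝ}

include hp

theorem Params.Valid.measurable_kth : Measurable fun x : Fin p.N → ℝ => kthSmallest x p.K :=
  measurable_kthSmallest hp.one_le_K hp.K_le_N

theorem Params.Valid.measurable_kth_fst :
    Measurable fun e : p.Update => kthSmallest e.1 p.K :=
  hp.measurable_kth.comp measurable_fst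

theorem Params.Valid.measurableSet_evS : MeasurableSet (evS p.K p.svc p.dl n j) :=
  measurableSet_le ((measurable_pi_apply n).comp measurable_fst)
    (measurable_snd.min hp.measurable_kth_fst)

theorem Params.Valid.measurableSet_evF : MeasurableSet (evF p.K p.svc p.dl n j) :=
  measurableSet_lt (measurable_snd.min hp.measurable_kth_fst)
    ((measurable_pi_apply n).comp measurable_fst)

theorem Params.Valid.measurableSet_evS1 : MeasurableSet (evS1 p.K p.svc p.dl n j) :=
  (hp.measurableSet_evS n j).inter (measurableSet_lt hp.measurable_kth_fst measurable_snd)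

theorem Params.Valid.measurableSet_evS2 : MeasurableSet (evS2 p.K p.svc p.dl n j) :=
  (hp.measurableSet_evS n j).inter (measurableSet_lt measurable_snd hp.measurable_kth_fst)

theorem Params.Valid.measurableSet_evF1 : MeasurableSet (evF1 p.K p.svc p.dl n j) :=
  (hp.measurableSet_evF n j).inter (measurableSet_lt hp.measurable_kth_fst measurable_snd)

theorem Params.Valid.measurableSet_evF2 : MeasurableSet (evF2 p.K p.svc p.dl n j) :=
  (hp.measurableSet_evF n j).inter (measurableSet_lt measurable_snd hp.measurable_kth_fst)

end Measurability

variable {α β γ : ℝ} (hα : 0 ≤ α) (hβ : 0 ≤ β) (hγ : 0 ≤ γ)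

include hp

/-- Ranks up to K finish no later than the K-th reception; without ties, higher ranks finish
strictly later. This decides, rank by rank, the indicators below. -/
theorem Params.Valid.kth_le_iff {x : Fin p.N → ℝ} (hx : Function.Injective x) {h : ℕ}
    (hh : h ∈ Finset.Icc 1 p.N) : kthSmallest x h ≤ kthSmallest x p.K ↔ h ≤ p.K := by
  rw [Finset.mem_Icc] at hh
  refine ⟨fun hle => ?_, fun hle => kthSmallest_le x hh.1 hle hp.K_le_N⟩
  by_contra hlt
  exact absurd hle (not_le.2 (kthSmallest_lt x hx hp.one_le_K (not_le.1 hlt) hh.2))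

include hα hβ hγ

/-- After symmetrization, if T_N(K) < D then precisely the ranks h ≤ K succeed, and each contributes
the same integrand; hence the factor K. -/
theorem Params.Valid.setIntegral_evS1 :
    (p.N : ℝ) * ∫ e in evS1 p.K p.svc p.dl n j,
      (α + β * kthSmallest e.1 p.K + γ * kthSmallest e.1 p.K ^ 2) ∂p.updateLaw =
      p.K * p.serveMoment p.K α β γ := by
  rw [← integral_indicator (hp.measurableSet_evS1 n j)]
  set ψ : ℝ → ℝ → ℝ → ℝ := fun x k d =>
    if x ≤ min d k ∧ k < d then α + β * k + γ * k ^ 2 else 0 with hψ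
  have he : (evS1 p.K p.svc p.dl n j).indicator
      (fun e => α + β * kthSmallest e.1 p.K + γ * kthSmallest e.1 p.K ^ 2) =
      fun e => ψ (e.1 n) (kthSmallest e.1 p.K) e.2 := by
    ext e; simp [indicator_apply, evS1, evS, Params.svc, Params.dl, hψ]
  have hi : Integrable (fun e : p.Update => ψ (e.1 n) (kthSmallest e.1 p.K) e.2)
      p.updateLaw := by
    rw [← he]
    exact (hp.integrable_quadratic_kthSmallest' hα hβ hγ hp.one_le_K hp.K_le_N).indicator
      (hp.measurableSet_evS1 n j)
  rw [he, hp.mul_integral_eq_integral_sum n ψ hi, Params.serveMoment,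
    ← hp.integral_kthSmallest hα hβ hγ hp.one_le_K hp.K_le_N, ← integral_const_mul]
  refine integral_congr_ae ?_
  filter_upwards [hp.ae_generic] with e ⟨hinj, _, _, _⟩
  calc _ = ∑ h ∈ Finset.Icc 1 p.N, (if h ≤ p.K then (if kthSmallest e.1 p.K < e.2 then
        α + β * kthSmallest e.1 p.K + γ * kthSmallest e.1 p.K ^ 2 else 0) else 0) := by
        refine Finset.sum_congr rfl fun h hh => ?_
        have hle := hp.kth_le_iff hinj hh
        simp only [hψ, le_min_iff]
        split_ifs <;> first | rfl | (exfalso; grind)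
    _ = _ := by
        rw [sum_Icc_ite_le hp.K_le_N]
        simp only [Finset.sum_const, Nat.card_Icc, Nat.add_sub_cancel, nsmul_eq_mul, mul_zero,
          add_zero]

/-- The complementary count: if T_N(K) < D, the failing ranks are the N - K ranks above K. -/
theorem Params.Valid.setIntegral_evF1 :
    (p.N : ℝ) * ∫ e in evF1 p.K p.svc p.dl n j,
      (α + β * kthSmallest e.1 p.K + γ * kthSmallest e.1 p.K ^ 2) ∂p.updateLaw =
      (p.N - p.K) * p.serveMoment p.K α β γ := by
  rw [← integral_indicator (hp.measurableSet_evF1 n j)]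
  set ψ : ℝ → ℝ → ℝ → ℝ := fun x k d =>
    if min d k < x ∧ k < d then α + β * k + γ * k ^ 2 else 0 with hψ
  have he : (evF1 p.K p.svc p.dl n j).indicator
      (fun e => α + β * kthSmallest e.1 p.K + γ * kthSmallest e.1 p.K ^ 2) =
      fun e => ψ (e.1 n) (kthSmallest e.1 p.K) e.2 := by
    ext e; simp [indicator_apply, evF1, evF, Params.svc, Params.dl, hψ]
  have hi : Integrable (fun e : p.Update => ψ (e.1 n) (kthSmallest e.1 p.K) e.2)
      p.updateLaw := by
    rw [← he]
    exact (hp.integrable_quadratic_kthSmallest' hα hβ hγ hp.one_le_K hp.K_le_N).indicator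
      (hp.measurableSet_evF1 n j)
  rw [he, hp.mul_integral_eq_integral_sum n ψ hi, Params.serveMoment,
    ← hp.integral_kthSmallest hα hβ hγ hp.one_le_K hp.K_le_N, ← integral_const_mul]
  refine integral_congr_ae ?_
  filter_upwards [hp.ae_generic] with e ⟨hinj, _, _, _⟩
  calc _ = ∑ h ∈ Finset.Icc 1 p.N, (if h ≤ p.K then 0 else (if kthSmallest e.1 p.K < e.2 then
        α + β * kthSmallest e.1 p.K + γ * kthSmallest e.1 p.K ^ 2 else 0)) := by
        refine Finset.sum_congr rfl fun h hh => ?_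
        have hle := hp.kth_le_iff hinj hh
        simp only [hψ, min_lt_iff]
        split_ifs <;> first | rfl | (exfalso; grind)
    _ = _ := by
        rw [sum_Icc_ite_le hp.K_le_N]
        simp only [Finset.sum_const, Nat.card_Icc, Nat.add_sub_add_right, nsmul_eq_mul,
          Nat.cast_sub hp.K_le_N, mul_zero, zero_add]

theorem Params.Valid.integrable_ite_deadline {h : ℕ} (h1 : 1 ≤ h) (hN : h ≤ p.N) :
    Integrable (fun e : p.Update =>
      if e.2 < kthSmallest e.1 h then α + β * e.2 + γ * e.2 ^ 2 else 0) p.updateLaw :=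
  (hp.integrable_quadratic_deadline hα hβ hγ).indicator
    (measurableSet_lt measurable_snd ((measurable_kthSmallest h1 hN).comp measurable_fst))

/-- If D < T_N(K), every rank above K fails, while a rank h ≤ K fails iff D < T_N(h). The latter
already implies D < T_N(K), so the condition on the K-th rank is absorbed. -/
theorem Params.Valid.setIntegral_evF2 :
    (p.N : ℝ) * ∫ e in evF2 p.K p.svc p.dl n j, (α + β * e.2 + γ * e.2 ^ 2) ∂p.updateLaw =
      ∑ h ∈ Finset.Icc 1 p.K, p.deadlineMoment h α β γ +
        (p.N - p.K) * p.deadlineMoment p.K α β γ := by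
  rw [← integral_indicator (hp.measurableSet_evF2 n j)]
  set ψ : ℝ → ℝ → ℝ → ℝ := fun x k d =>
    if min d k < x ∧ d < k then α + β * d + γ * d ^ 2 else 0 with hψ
  have he : (evF2 p.K p.svc p.dl n j).indicator
      (fun e => α + β * e.2 + γ * e.2 ^ 2) =
      fun e => ψ (e.1 n) (kthSmallest e.1 p.K) e.2 := by
    ext e; simp [indicator_apply, evF2, evF, Params.svc, Params.dl, hψ]
  have hi : Integrable (fun e : p.Update => ψ (e.1 n) (kthSmallest e.1 p.K) e.2)
      p.updateLaw := by
    rw [← he]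
    exact (hp.integrable_quadratic_deadline hα hβ hγ).indicator (hp.measurableSet_evF2 n j)
  have hiK := hp.integrable_ite_deadline hα hβ hγ hp.one_le_K hp.K_le_N
  have hih : ∀ h ∈ Finset.Icc 1 p.K, Integrable (fun e : p.Update =>
      if e.2 < kthSmallest e.1 h then α + β * e.2 + γ * e.2 ^ 2 else 0) p.updateLaw := fun h hh =>
    hp.integrable_ite_deadline hα hβ hγ (Finset.mem_Icc.1 hh).1
      ((Finset.mem_Icc.1 hh).2.trans hp.K_le_N)
  rw [he, hp.mul_integral_eq_integral_sum n ψ hi, show p.deadlineMoment p.K α β γ = _ from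
      (hp.integral_deadline hα hβ hγ hp.one_le_K hp.K_le_N).symm, ← integral_const_mul,
    Finset.sum_congr rfl fun h hh => show p.deadlineMoment h α β γ = _ from
      (hp.integral_deadline hα hβ hγ (Finset.mem_Icc.1 hh).1
      ((Finset.mem_Icc.1 hh).2.trans hp.K_le_N)).symm, ← integral_finsetSum _ hih,
    ← integral_add (integrable_finsetSum _ hih) (hiK.const_mul _)]
  refine integral_congr_ae ?_
  filter_upwards [hp.ae_generic] with e ⟨hinj, _, _, _⟩
  calc _ = ∑ h ∈ Finset.Icc 1 p.N, (if h ≤ p.K then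
          (if e.2 < kthSmallest e.1 h then α + β * e.2 + γ * e.2 ^ 2 else 0) else
          (if e.2 < kthSmallest e.1 p.K then α + β * e.2 + γ * e.2 ^ 2 else 0)) := by
        refine Finset.sum_congr rfl fun h hh => ?_
        have hle := hp.kth_le_iff hinj hh
        simp only [hψ, min_lt_iff]
        split_ifs <;> first | rfl | (exfalso; grind)
    _ = _ := by
        rw [sum_Icc_ite_le hp.K_le_N]
        simp only [Finset.sum_const, Nat.card_Icc, Nat.add_sub_add_right, nsmul_eq_mul,
          Nat.cast_sub hp.K_le_N]

/-- A rank succeeds before an expiring deadline iff T_N(h) ≤ D < T_N(K), which forces h ≤ K. For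
such h the indicator is the difference of those of {D < T_N(K)} and {D < T_N(h)}. -/
theorem Params.Valid.setIntegral_evS2 :
    (p.N : ℝ) * ∫ e in evS2 p.K p.svc p.dl n j, (α + β * e.2 + γ * e.2 ^ 2) ∂p.updateLaw =
      p.K * p.deadlineMoment p.K α β γ - ∑ h ∈ Finset.Icc 1 p.K, p.deadlineMoment h α β γ := by
  rw [← integral_indicator (hp.measurableSet_evS2 n j)]
  set ψ : ℝ → ℝ → ℝ → ℝ := fun x k d =>
    if x ≤ min d k ∧ d < k then α + β * d + γ * d ^ 2 else 0 with hψ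
  have he : (evS2 p.K p.svc p.dl n j).indicator
      (fun e => α + β * e.2 + γ * e.2 ^ 2) =
      fun e => ψ (e.1 n) (kthSmallest e.1 p.K) e.2 := by
    ext e; simp [indicator_apply, evS2, evS, Params.svc, Params.dl, hψ]
  have hi : Integrable (fun e : p.Update => ψ (e.1 n) (kthSmallest e.1 p.K) e.2)
      p.updateLaw := by
    rw [← he]
    exact (hp.integrable_quadratic_deadline hα hβ hγ).indicator (hp.measurableSet_evS2 n j)
  have hiK := hp.integrable_ite_deadline hα hβ hγ hp.one_le_K hp.K_le_N
  have hih : ∀ h ∈ Finset.Icc 1 p.K, Integrable (fun e : p.Update =>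
      if e.2 < kthSmallest e.1 h then α + β * e.2 + γ * e.2 ^ 2 else 0) p.updateLaw := fun h hh =>
    hp.integrable_ite_deadline hα hβ hγ (Finset.mem_Icc.1 hh).1
      ((Finset.mem_Icc.1 hh).2.trans hp.K_le_N)
  rw [he, hp.mul_integral_eq_integral_sum n ψ hi, show p.deadlineMoment p.K α β γ = _ from
      (hp.integral_deadline hα hβ hγ hp.one_le_K hp.K_le_N).symm, ← integral_const_mul,
    Finset.sum_congr rfl fun h hh => show p.deadlineMoment h α β γ = _ from
      (hp.integral_deadline hα hβ hγ (Finset.mem_Icc.1 hh).1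
      ((Finset.mem_Icc.1 hh).2.trans hp.K_le_N)).symm, ← integral_finsetSum _ hih,
    ← integral_sub (hiK.const_mul _) (integrable_finsetSum _ hih)]
  refine integral_congr_ae ?_
  filter_upwards [hp.ae_generic] with e ⟨hinj, hne, _, _⟩
  calc _ = ∑ h ∈ Finset.Icc 1 p.N, (if h ≤ p.K then
          ((if e.2 < kthSmallest e.1 p.K then α + β * e.2 + γ * e.2 ^ 2 else 0) -
          (if e.2 < kthSmallest e.1 h then α + β * e.2 + γ * e.2 ^ 2 else 0)) else 0) := by
        refine Finset.sum_congr rfl fun h hh => ?_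
        have hle := hp.kth_le_iff hinj hh
        simp only [hψ, le_min_iff]
        split_ifs <;> first | simp; done | (exfalso; grind)
    _ = _ := by
        rw [sum_Icc_ite_le hp.K_le_N, Finset.sum_sub_distrib]
        simp only [Finset.sum_const, Nat.card_Icc, Nat.add_sub_cancel, nsmul_eq_mul, mul_zero,
          add_zero]

/-- Rank h succeeds iff h ≤ K and T_N(h) ≤ D, and ties with the deadline are negligible. Here the
integrand is the service time itself, so each rank contributes its own order statistic. -/
theorem Params.Valid.setIntegral_evS :
    (p.N : ℝ) * ∫ e in evS p.K p.svc p.dl n j, (α + β * e.1 n + γ * e.1 n ^ 2) ∂p.updateLaw =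
      ∑ h ∈ Finset.Icc 1 p.K, p.serveMoment h α β γ := by
  rw [← integral_indicator (hp.measurableSet_evS n j)]
  set ψ : ℝ → ℝ → ℝ → ℝ := fun x k d =>
    if x ≤ min d k then α + β * x + γ * x ^ 2 else 0 with hψ
  have he : (evS p.K p.svc p.dl n j).indicator
      (fun e => α + β * e.1 n + γ * e.1 n ^ 2) =
      fun e => ψ (e.1 n) (kthSmallest e.1 p.K) e.2 := by
    ext e; simp [indicator_apply, evS, Params.svc, Params.dl, hψ]
  have hi : Integrable (fun e : p.Update => ψ (e.1 n) (kthSmallest e.1 p.K) e.2)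
      p.updateLaw := by
    rw [← he]
    exact (hp.integrable_quadratic_service hα hβ hγ n).indicator (hp.measurableSet_evS n j)
  have hih : ∀ h ∈ Finset.Icc 1 p.K, Integrable (fun e : p.Update =>
      if kthSmallest e.1 h < e.2 then α + β * kthSmallest e.1 h + γ * kthSmallest e.1 h ^ 2 else 0)
      p.updateLaw := fun h hh => by
    have h1 := (Finset.mem_Icc.1 hh).1
    have hN := (Finset.mem_Icc.1 hh).2.trans hp.K_le_N
    exact (hp.integrable_quadratic_kthSmallest' hα hβ hγ h1 hN).indicator
      (measurableSet_lt ((measurable_kthSmallest h1 hN).comp measurable_fst) measurable_snd)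
  simp only [Params.serveMoment]
  rw [he, hp.mul_integral_eq_integral_sum n ψ hi,
    Finset.sum_congr rfl fun h hh => (hp.integral_kthSmallest hα hβ hγ (Finset.mem_Icc.1 hh).1
      ((Finset.mem_Icc.1 hh).2.trans hp.K_le_N)).symm, ← integral_finsetSum _ hih]
  refine integral_congr_ae ?_
  filter_upwards [hp.ae_generic] with e ⟨hinj, hne, _, _⟩
  calc _ = ∑ h ∈ Finset.Icc 1 p.N, (if h ≤ p.K then
          (if kthSmallest e.1 h < e.2 then
            α + β * kthSmallest e.1 h + γ * kthSmallest e.1 h ^ 2 else 0) else 0) := by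
        refine Finset.sum_congr rfl fun h hh => ?_
        have := kthSmallest_ne hne (Finset.mem_Icc.1 hh).1 (Finset.mem_Icc.1 hh).2
        have hle := hp.kth_le_iff hinj hh
        simp only [hψ, le_min_iff]
        split_ifs <;> first | rfl | (exfalso; grind)
    _ = _ := by
        rw [sum_Icc_ite_le hp.K_le_N]
        simp only [Finset.sum_const_zero, add_zero]

end Events

/-! ### Agreement of the computed moments with R, S₁, S₂, D₁, D₂ -/

section Identification

variable {p : Params} {h : ℕ}

/-- Partial fractions: λ_d / (U H) = 1/U - λ_s/H, since H = λ_s U + λ_d. -/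
theorem Params.deadlineMoment_one (p : Params) (hp : p.Valid) (hN : h ≤ p.N) :
    p.deadlineMoment h 1 0 0 = p.R h := by
  refine Finset.sum_congr rfl fun j _ => ?_
  have h1 := (p.U_pos hN j).ne'
  have h2 := (hp.H_pos hN j).ne'
  rw [expMoment]
  simp only [zero_mul, mul_zero, add_zero, zero_div]
  field_simp
  rw [Params.H]; ring

theorem Params.Valid.serveMoment_eq_S₁ (hp : p.Valid) (hN : h ≤ p.N) :
    p.serveMoment h 0 1 0 = p.S₁ h := by
  refine Finset.sum_congr rfl fun j _ => ?_
  have h2 := (hp.H_pos hN j).ne'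
  rw [expMoment]
  field_simp
  ring

theorem Params.Valid.serveMoment_eq_S₂ (hp : p.Valid) (hN : h ≤ p.N) :
    p.serveMoment h 0 0 1 = p.S₂ h := by
  refine Finset.sum_congr rfl fun j _ => ?_
  have h2 := (hp.H_pos hN j).ne'
  rw [expMoment]
  field_simp
  ring

theorem Params.Valid.deadlineMoment_eq_D₁ (hp : p.Valid) (hN : h ≤ p.N) :
    p.deadlineMoment h 0 1 0 = p.D₁ h := by
  refine Finset.sum_congr rfl fun j _ => ?_
  have h1 := (p.U_pos hN j).ne'
  have h2 := (hp.H_pos hN j).ne'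
  rw [expMoment]
  field_simp
  ring

theorem Params.Valid.deadlineMoment_eq_D₂ (hp : p.Valid) (hN : h ≤ p.N) :
    p.deadlineMoment h 0 0 1 = p.D₂ h := by
  refine Finset.sum_congr rfl fun j _ => ?_
  have h1 := (p.U_pos hN j).ne'
  have h2 := (hp.H_pos hN j).ne'
  rw [expMoment]
  field_simp
  ring

theorem Params.Valid.real_deadline_lt (hp : p.Valid) (h1 : 1 ≤ h) (hN : h ≤ p.N) :
    p.updateLaw.real {e | e.2 < kthSmallest e.1 h} = p.R h := by
  rw [← p.deadlineMoment_one hp hN, Params.deadlineMoment,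
    ← hp.integral_deadline zero_le_one le_rfl le_rfl h1 hN]
  have := integral_indicator_const (μ := p.updateLaw) (1 : ℝ)
    (measurableSet_lt measurable_snd ((measurable_kthSmallest h1 hN).comp measurable_fst)
      : MeasurableSet {e : p.Update | e.2 < kthSmallest e.1 h})
  simpa [indicator_apply] using this.symm

/-- Obtained from probability rather than algebra: up to ties, {T_N(h) < D} is the complement of {D
< T_N(h)}. -/
theorem Params.Valid.serveMoment_one (hp : p.Valid) (h1 : 1 ≤ h) (hN : h ≤ p.N) :
    p.serveMoment h 1 0 0 = 1 - p.R h := by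
  have := hp.isProbabilityMeasure_updateLaw
  have hm : MeasurableSet {e : p.Update | e.2 < kthSmallest e.1 h} :=
    measurableSet_lt measurable_snd ((measurable_kthSmallest h1 hN).comp measurable_fst)
  rw [← hp.real_deadline_lt h1 hN, ← probReal_compl_eq_one_sub hm, Params.serveMoment,
    ← hp.integral_kthSmallest zero_le_one le_rfl le_rfl h1 hN]
  have := integral_indicator_const (μ := p.updateLaw) (1 : ℝ) hm.compl
  rw [smul_eq_mul, mul_one] at this
  rw [← this]
  refine integral_congr_ae ?_
  filter_upwards [hp.ae_generic] with e ⟨_, hne, _, _⟩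
  have := kthSmallest_ne hne h1 hN
  simp only [indicator_apply, mem_compl_iff, mem_ofPred_eq, not_lt]
  rcases this.lt_or_gt with h | h
  · simp [h, h.le]
  · simp [h.not_gt, h]

end Identification

end MulticastAoI

namespace MulticastAoI

open Set Real

/-! ### Conditional moments of one update -/

section Conditioning

variable {Ω : Type*} [MeasurableSpace Ω] {P : Measure Ω}

/-- No positivity of P A is needed: for a null event the conditional measure is zero and the
quotient is zero by convention. This covers the degenerate case K = 1 of `evS2`. -/
theorem HasMean.of_cond [IsFiniteMeasure P] {A : Set Ω} {Y : Ω → ℝ} (hY : Integrable Y P) :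
    HasMean (cond P A) Y ((∫ ω in A, Y ω ∂P) / P.real A) := by
  unfold ProbabilityTheory.cond
  constructor
  · rcases eq_or_ne (P A) 0 with h | h
    · rw [Measure.restrict_eq_zero.2 h, smul_zero]; exact integrable_zero_measure
    · exact hY.restrict.smul_measure (ENNReal.inv_ne_top.2 h)
  · rw [integral_smul_measure, ENNReal.toReal_inv, smul_eq_mul, measureReal_def]
    exact inv_mul_eq_div _ _

theorem HasMean.of_cond' [IsFiniteMeasure P] {A : Set Ω} {Y : Ω → ℝ} {m : ℝ}
    (hY : Integrable Y P) (hm : (∫ ω in A, Y ω ∂P) / P.real A = m) : HasMean (cond P A) Y m :=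
  hm ▸ HasMean.of_cond hY

theorem cond_real_of_subset {A B : Set Ω} (hA : MeasurableSet A) (hBA : B ⊆ A) :
    (cond P A).real B = P.real B / P.real A := by
  rw [measureReal_def, cond_apply hA, inter_eq_self_of_subset_right hBA, ENNReal.toReal_mul,
    ENNReal.toReal_inv]
  exact inv_mul_eq_div _ _

theorem HasMean.map {E : Type*} [MeasurableSpace E] {Q : Measure E} {Z : Ω → E}
    (hZ : MeasurePreserving Z P Q) {Y : E → ℝ} {m : ℝ} (h : HasMean Q Y m) :
    HasMean P (Y ∘ Z) m := by
  refine ⟨hZ.integrable_comp_of_integrable h.1, ?_⟩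
  rw [← h.2, ← hZ.map_eq, integral_map hZ.measurable.aemeasurable
    (by rw [hZ.map_eq]; exact h.1.aestronglyMeasurable)]
  rfl

theorem measurePreserving_cond {E : Type*} [MeasurableSpace E] {Q : Measure E} {Z : Ω → E}
    (hZ : MeasurePreserving Z P Q) {A : Set E} (hA : MeasurableSet A) :
    MeasurePreserving Z (cond P (Z ⁻¹' A)) (cond Q A) := by
  refine ⟨hZ.measurable, ?_⟩
  unfold ProbabilityTheory.cond
  rw [Measure.map_smul, ← Measure.restrict_map hZ.measurable hA, hZ.map_eq,
    hZ.measure_preimage hA.nullMeasurableSet]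

end Conditioning

/-! ### Nondegeneracy of the probabilities and the sum of all R h -/

section Positivity

variable {p : Params} (hp : p.Valid)

include hp

theorem Params.Valid.one_le_N : 1 ≤ p.N := hp.one_le_K.trans hp.K_le_N

/-- The minimum of N service times has rate N λ_s. This explicit value lies strictly between 0 and
1, and supplies the one strict term in the positivity of `probS` and of the failure weight. -/
theorem Params.Valid.R_one : p.R 1 = p.lamD / (p.lamS * p.N + p.lamD) := by
  have hN : (0 : ℝ) < p.N := by exact_mod_cast hp.one_le_N
  have h1 := hp.lamS_pos
  have h2 := hp.lamD_pos
  simp only [Params.R, Finset.range_one, Finset.sum_singleton, Params.B, Params.H, Params.U]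
  simp
  field_simp
  ring

theorem Params.Valid.R_nonneg {h : ℕ} (h1 : 1 ≤ h) (hN : h ≤ p.N) : 0 ≤ p.R h := by
  rw [← hp.real_deadline_lt h1 hN]; exact measureReal_nonneg

theorem Params.Valid.R_le_one {h : ℕ} (h1 : 1 ≤ h) (hN : h ≤ p.N) : p.R h ≤ 1 := by
  have := hp.isProbabilityMeasure_updateLaw
  rw [← hp.real_deadline_lt h1 hN]; exact measureReal_le_one

theorem Params.Valid.sum_one_sub_R_pos : 0 < ∑ h ∈ Finset.Icc 1 p.K, (1 - p.R h) := by
  refine Finset.sum_pos' (fun h hh => ?_) ⟨1, Finset.mem_Icc.2 ⟨le_rfl, hp.one_le_K⟩, ?_⟩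
  · have := hp.R_le_one (Finset.mem_Icc.1 hh).1 ((Finset.mem_Icc.1 hh).2.trans hp.K_le_N)
    linarith
  · have hN : (0 : ℝ) < p.N := by exact_mod_cast hp.one_le_N
    have h1 := hp.lamS_pos
    have h2 := hp.lamD_pos
    rw [hp.R_one, sub_pos, div_lt_one (by positivity)]
    have := mul_pos h1 hN
    linarith

theorem Params.Valid.probS_pos : 0 < p.probS := by
  have hN : (0 : ℝ) < p.N := by exact_mod_cast hp.one_le_N
  exact mul_pos (by positivity) hp.sum_one_sub_R_pos

theorem Params.Valid.sumR_add_pos : 0 < p.sumR + ((p.N : ℝ) - p.K) * p.R p.K := by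
  refine add_pos_of_pos_of_nonneg ?_ (mul_nonneg ?_ (hp.R_nonneg hp.one_le_K hp.K_le_N))
  · refine Finset.sum_pos' (fun h hh => hp.R_nonneg (Finset.mem_Icc.1 hh).1
      ((Finset.mem_Icc.1 hh).2.trans hp.K_le_N)) ⟨1, Finset.mem_Icc.2 ⟨le_rfl, hp.one_le_K⟩, ?_⟩
    have h1 := hp.lamS_pos
    have h2 := hp.lamD_pos
    rw [hp.R_one]; positivity
  · rw [sub_nonneg]; exact_mod_cast hp.K_le_N

/-- Two independent exponentials with the common shift c compete; the shift plays no role. -/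
theorem Params.Valid.integral_deadline_lt_service (n : Fin p.N) :
    ∫ e, (if e.2 < e.1 n then (1 : ℝ) else 0) ∂p.updateLaw = p.lamD / (p.lamS + p.lamD) := by
  have := shiftedExp_isProbabilityMeasure (c := p.c) hp.lamD_pos
  have := shiftedExp_isProbabilityMeasure (c := p.c) hp.lamS_pos
  have := hp.isProbabilityMeasure_serviceLaw
  have hS := hp.lamS_pos
  have hD := hp.lamD_pos
  have hms : MeasurableSet {e : p.Update | e.2 < e.1 n} :=
    measurableSet_lt measurable_snd ((measurable_pi_apply n).comp measurable_fst)
  have := hp.isProbabilityMeasure_updateLaw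
  have hint : Integrable (fun e : p.Update => if e.2 < e.1 n then (1 : ℝ) else 0) p.updateLaw :=
    (integrable_const (1 : ℝ)).indicator hms
  have hin : ∀ d : ℝ, p.c < d → ∫ x, (if d < x n then (1 : ℝ) else 0) ∂p.serviceLaw =
      exp (-(p.lamS * (d - p.c))) := by
    intro d hd
    have h1 := integral_indicator_const (μ := p.serviceLaw) (1 : ℝ)
      (measurableSet_lt measurable_const (measurable_pi_apply n)
        : MeasurableSet {x : Fin p.N → ℝ | d < x n})
    have h2 : p.serviceLaw.real {x | d < x n} = (shiftedExp p.c p.lamS).real (Ioi d) := by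
      rw [measureReal_def, measureReal_def, ← (measurePreserving_eval
        (fun _ : Fin p.N => shiftedExp p.c p.lamS) n).measure_preimage
          measurableSet_Ioi.nullMeasurableSet]
      rfl
    rw [h2, ← compl_Iic, probReal_compl_eq_one_sub measurableSet_Iic, measureReal_def,
      shiftedExp_Iic hp.lamS_pos hd.le, ENNReal.toReal_ofReal, sub_sub_cancel] at h1
    · simpa [indicator_apply] using h1
    · rw [sub_nonneg, exp_le_one_iff]
      have := sub_pos.2 hd
      simp only [Left.neg_nonpos_iff]; positivity
  rw [Params.updateLaw] at hint ⊢
  rw [integral_prod_symm _ hint, (integral_shiftedExp hp.lamD_pos _).2,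
    setIntegral_congr_fun measurableSet_Ioi (g := fun t => p.lamD *
      ((1 + 0 * t + 0 * t ^ 2) * exp (-((p.lamS + p.lamD) * (t - p.c)))))]
  · rw [integral_const_mul, (integrableOn_and_integral_exp hp.c_pos.le (add_pos hS hD)
      zero_le_one le_rfl le_rfl).2, expMoment]
    field_simp
    ring
  · intro d hd
    simp only
    rw [hin d hd]
    have : exp (-((p.lamS + p.lamD) * (d - p.c))) =
        exp (-(p.lamD * (d - p.c))) * exp (-(p.lamS * (d - p.c))) := by
      rw [← exp_add]; congr 1; ring
    rw [this]; ring

/-- Symmetrization applied to the indicator of {D < T_n}: summing over ranks or over devices gives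
the same total. -/
theorem Params.Valid.sum_R_eq :
    ∑ h ∈ Finset.Icc 1 p.N, p.R h = p.N * (p.lamD / (p.lamS + p.lamD)) := by
  have := hp.isProbabilityMeasure_updateLaw
  have n : Fin p.N := ⟨0, hp.one_le_N⟩
  have hms : MeasurableSet {e : p.Update | e.2 < e.1 n} :=
    measurableSet_lt measurable_snd ((measurable_pi_apply n).comp measurable_fst)
  rw [← hp.integral_deadline_lt_service n, hp.mul_integral_eq_integral_sum n
    (fun x _ d => if d < x then (1 : ℝ) else 0) ((integrable_const (1 : ℝ)).indicator hms),
    integral_finsetSum]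
  · refine Finset.sum_congr rfl fun h hh => ?_
    rw [Finset.mem_Icc] at hh
    rw [← p.deadlineMoment_one hp hh.2, Params.deadlineMoment,
      ← hp.integral_deadline zero_le_one le_rfl le_rfl hh.1 hh.2]
    simp
  · intro h hh
    rw [Finset.mem_Icc] at hh
    exact (integrable_const (1 : ℝ)).indicator (measurableSet_lt measurable_snd
      ((measurable_kthSmallest hh.1 hh.2).comp measurable_fst))

end Positivity

end MulticastAoI

namespace MulticastAoI

open Set Real

/-! ### The closed forms for one update -/

theorem Params.sum_one_sub_R (p : Params) :
    ∑ h ∈ Finset.Icc 1 p.K, (1 - p.R h) = p.K - p.sumR := by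
  simp [Params.sumR]

/-- Conditioning in two stages. Allowing r = 0 is what makes a null branch contribute 0 without a
separate case. -/
theorem div_eq_div_mul_div {a r s : ℝ} (h : r = 0 → a = 0) : a / s = r / s * (a / r) := by
  rcases eq_or_ne r 0 with h0 | h0
  · simp [h0, h h0]
  · field_simp

theorem Params.evF_eq_compl (p : Params) (n : Fin p.N) (j : ℕ) :
    evF p.K p.svc p.dl n j = (evS p.K p.svc p.dl n j)ᶜ := by
  ext e; simp only [evF, evS, mem_ofPred_eq, mem_compl_iff, not_le]

theorem Params.disjoint_evS (p : Params) (n : Fin p.N) (j : ℕ) : Disjoint (evS1 p.K p.svc p.dl n j)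
    (evS2 p.K p.svc p.dl n j) :=
  Set.disjoint_left.2 fun e h h' =>
    absurd (show kthSmallest e.1 p.K < e.2 from h.2) (lt_asymm (show e.2 < _ from h'.2))

theorem Params.disjoint_evF (p : Params) (n : Fin p.N) (j : ℕ) : Disjoint (evF1 p.K p.svc p.dl n j)
    (evF2 p.K p.svc p.dl n j) :=
  Set.disjoint_left.2 fun e h h' =>
    absurd (show kthSmallest e.1 p.K < e.2 from h.2) (lt_asymm (show e.2 < _ from h'.2))

section ClosedForms

variable {p : Params} (hp : p.Valid) (n : Fin p.N) (j : ℕ)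

include hp

theorem Params.Valid.N_pos : (0 : ℝ) < p.N := by exact_mod_cast hp.one_le_N

theorem Params.Valid.eq_div_N {x y : ℝ} (h : (p.N : ℝ) * x = y) : x = y / p.N := by
  rw [← h, mul_div_cancel_left₀ _ hp.N_pos.ne']

theorem Params.Valid.sum_Icc_congr {f g : ℕ → ℝ} (hfg : ∀ h ≤ p.N, f h = g h) :
    ∑ h ∈ Finset.Icc 1 p.K, f h = ∑ h ∈ Finset.Icc 1 p.K, g h :=
  Finset.sum_congr rfl fun h hh => hfg h ((Finset.mem_Icc.1 hh).2.trans hp.K_le_N)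

theorem Params.Valid.real_evS1 :
    p.updateLaw.real (evS1 p.K p.svc p.dl n j) = p.K * (1 - p.R p.K) / p.N := by
  have h := hp.setIntegral_evS1 n j zero_le_one le_rfl le_rfl
  rw [hp.serveMoment_one hp.one_le_K hp.K_le_N] at h
  rw [← hp.eq_div_N h]
  simp

theorem Params.Valid.real_evF1 :
    p.updateLaw.real (evF1 p.K p.svc p.dl n j) = (p.N - p.K) * (1 - p.R p.K) / p.N := by
  have h := hp.setIntegral_evF1 n j zero_le_one le_rfl le_rfl
  rw [hp.serveMoment_one hp.one_le_K hp.K_le_N] at h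
  rw [← hp.eq_div_N h]
  simp

theorem Params.Valid.real_evF2 :
    p.updateLaw.real (evF2 p.K p.svc p.dl n j) = (p.sumR + (p.N - p.K) * p.R p.K) / p.N := by
  have h := hp.setIntegral_evF2 n j zero_le_one le_rfl le_rfl
  rw [p.deadlineMoment_one hp hp.K_le_N,
    hp.sum_Icc_congr fun h hN => p.deadlineMoment_one hp hN] at h
  rw [Params.sumR, ← hp.eq_div_N h]
  simp

theorem Params.Valid.real_evS2 :
    p.updateLaw.real (evS2 p.K p.svc p.dl n j) = (p.K * p.R p.K - p.sumR) / p.N := by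
  have h := hp.setIntegral_evS2 n j zero_le_one le_rfl le_rfl
  rw [p.deadlineMoment_one hp hp.K_le_N,
    hp.sum_Icc_congr fun h hN => p.deadlineMoment_one hp hN] at h
  rw [Params.sumR, ← hp.eq_div_N h]
  simp

theorem Params.Valid.real_evS :
    p.updateLaw.real (evS p.K p.svc p.dl n j) = p.probS := by
  have h := hp.setIntegral_evS n j zero_le_one le_rfl le_rfl
  rw [Finset.sum_congr rfl fun h hh => hp.serveMoment_one (Finset.mem_Icc.1 hh).1
    ((Finset.mem_Icc.1 hh).2.trans hp.K_le_N)] at h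
  rw [Params.probS, one_div_mul_eq_div, ← hp.eq_div_N h]
  simp

theorem Params.Valid.real_evF :
    p.updateLaw.real (evF p.K p.svc p.dl n j) = 1 - p.probS := by
  have := hp.isProbabilityMeasure_updateLaw
  rw [p.evF_eq_compl, probReal_compl_eq_one_sub (hp.measurableSet_evS n j), hp.real_evS]

/-- By `sum_R_eq`, the sum of R over ranks above K is a known total minus `sumR`; the stated
denominator then becomes N (1 - P(C_S)) (λ_s + λ_d), and the factor λ_s + λ_d cancels. -/
theorem Params.Valid.probF2_eq :
    p.probF2 = ((p.sumR + (p.N - p.K) * p.R p.K) / p.N) / (1 - p.probS) := by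
  have hS := hp.lamS_pos
  have hD := hp.lamD_pos
  have hN := hp.N_pos
  have hsum := hp.sum_R_eq
  have hsplit := sum_Icc_ite_le hp.K_le_N p.R p.R
  simp only [ite_self] at hsplit
  have hR : ∑ h ∈ Finset.Icc (p.K + 1) p.N, p.R h =
      p.N * (p.lamD / (p.lamS + p.lamD)) - p.sumR := by
    rw [← hsum, hsplit, Params.sumR]; ring
  have hden : (p.N : ℝ) * p.lamD + ((p.N : ℝ) - p.K -
      ∑ h ∈ Finset.Icc (p.K + 1) p.N, p.R h) * (p.lamS + p.lamD) =
      (p.N * (1 - p.probS)) * (p.lamS + p.lamD) := by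
    rw [hR, Params.probS, p.sum_one_sub_R]
    field_simp
    ring
  rw [Params.probF2, hden, mul_div_mul_right _ _ (add_pos hS hD).ne', div_div]

theorem Params.Valid.ae_eq_union_evS :
    evS p.K p.svc p.dl n j =ᵐ[p.updateLaw]
      (evS1 p.K p.svc p.dl n j ∪ evS2 p.K p.svc p.dl n j : Set p.Update) := by
  refine eventuallyEq_set.2 ?_
  filter_upwards [hp.ae_generic] with e ⟨_, hne, _, _⟩
  have := kthSmallest_ne hne hp.one_le_K hp.K_le_N
  rw [evS1, evS2, ← inter_union_distrib_left, mem_inter_iff]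
  exact ⟨fun h => ⟨h, this.lt_or_gt⟩, fun h => h.1⟩

theorem Params.Valid.ae_eq_union_evF :
    evF p.K p.svc p.dl n j =ᵐ[p.updateLaw]
      (evF1 p.K p.svc p.dl n j ∪ evF2 p.K p.svc p.dl n j : Set p.Update) := by
  refine eventuallyEq_set.2 ?_
  filter_upwards [hp.ae_generic] with e ⟨_, hne, _, _⟩
  have := kthSmallest_ne hne hp.one_le_K hp.K_le_N
  rw [evF1, evF2, ← inter_union_distrib_left, mem_inter_iff]
  exact ⟨fun h => ⟨h, this.lt_or_gt⟩, fun h => h.1⟩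

theorem Params.Valid.probS_add : p.updateLaw.real (evS1 p.K p.svc p.dl n j) +
    p.updateLaw.real (evS2 p.K p.svc p.dl n j) = p.probS := by
  have := hp.isProbabilityMeasure_updateLaw
  rw [← measureReal_union (p.disjoint_evS n j) (hp.measurableSet_evS2 n j), ← hp.real_evS n j,
    measureReal_congr (hp.ae_eq_union_evS n j)]

theorem Params.Valid.probF_add : p.updateLaw.real (evF1 p.K p.svc p.dl n j) +
    p.updateLaw.real (evF2 p.K p.svc p.dl n j) = 1 - p.probS := by
  have := hp.isProbabilityMeasure_updateLaw
  rw [← measureReal_union (p.disjoint_evF n j) (hp.measurableSet_evF2 n j), ← hp.real_evF n j,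
    measureReal_congr (hp.ae_eq_union_evF n j)]

theorem Params.Valid.one_sub_probS_pos : 0 < 1 - p.probS := by
  have n : Fin p.N := ⟨0, hp.one_le_N⟩
  rw [← hp.probF_add n 0, hp.real_evF2]
  exact add_pos_of_nonneg_of_pos measureReal_nonneg (div_pos hp.sumR_add_pos hp.N_pos)

theorem Params.Valid.probF2_eq' :
    p.probF2 = p.updateLaw.real (evF2 p.K p.svc p.dl n j) / (1 - p.probS) := by
  rw [hp.probF2_eq, hp.real_evF2]

theorem Params.Valid.one_sub_probF2_eq :
    1 - p.probF2 = p.updateLaw.real (evF1 p.K p.svc p.dl n j) / (1 - p.probS) := by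
  rw [hp.probF2_eq' n j, eq_div_iff hp.one_sub_probS_pos.ne', sub_mul,
    div_mul_cancel₀ _ hp.one_sub_probS_pos.ne', ← hp.probF_add n j]
  ring

theorem Params.Valid.probS1_eq :
    p.probS1 = p.updateLaw.real (evS1 p.K p.svc p.dl n j) / p.probS := by
  have h := hp.sum_one_sub_R_pos.ne'
  have hN := hp.N_pos.ne'
  rw [hp.real_evS1, Params.probS1, Params.probS]
  field_simp

theorem Params.Valid.one_sub_probS1_eq :
    1 - p.probS1 = p.updateLaw.real (evS2 p.K p.svc p.dl n j) / p.probS := by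
  rw [hp.probS1_eq n j, eq_div_iff hp.probS_pos.ne', sub_mul,
    div_mul_cancel₀ _ hp.probS_pos.ne', ← hp.probS_add n j]
  ring

theorem Params.Valid.measurable_duration :
    Measurable fun e : p.Update => duration p.K e.1 e.2 :=
  measurable_snd.min hp.measurable_kth_fst

section Moments

variable {α β γ : ℝ} (hα : 0 ≤ α) (hβ : 0 ≤ β) (hγ : 0 ≤ γ)

include hα hβ hγ

theorem Params.Valid.hasMean_evS1 :
    HasMean (cond p.updateLaw (evS1 p.K p.svc p.dl n j))
      (fun e => α + β * kthSmallest e.1 p.K + γ * kthSmallest e.1 p.K ^ 2)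
      (p.serveMoment p.K α β γ / (1 - p.R p.K)) := by
  have := hp.isProbabilityMeasure_updateLaw
  have hN := hp.N_pos.ne'
  have hK : (p.K : ℝ) ≠ 0 := by exact_mod_cast (Nat.one_le_iff_ne_zero.1 hp.one_le_K)
  refine HasMean.of_cond' (hp.integrable_quadratic_kthSmallest' hα hβ hγ hp.one_le_K hp.K_le_N) ?_
  rw [hp.eq_div_N (hp.setIntegral_evS1 n j hα hβ hγ), hp.real_evS1, div_div_div_cancel_right₀ hN,
    mul_div_mul_left _ _ hK]

theorem Params.Valid.hasMean_evF1 (hlt : p.K < p.N) :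
    HasMean (cond p.updateLaw (evF1 p.K p.svc p.dl n j))
      (fun e => α + β * kthSmallest e.1 p.K + γ * kthSmallest e.1 p.K ^ 2)
      (p.serveMoment p.K α β γ / (1 - p.R p.K)) := by
  have := hp.isProbabilityMeasure_updateLaw
  have hN := hp.N_pos.ne'
  have hK : (p.N - p.K : ℝ) ≠ 0 := (sub_pos.2 (by exact_mod_cast hlt)).ne'
  refine HasMean.of_cond' (hp.integrable_quadratic_kthSmallest' hα hβ hγ hp.one_le_K hp.K_le_N) ?_
  rw [hp.eq_div_N (hp.setIntegral_evF1 n j hα hβ hγ), hp.real_evF1, div_div_div_cancel_right₀ hN,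
    mul_div_mul_left _ _ hK]

theorem Params.Valid.hasMean_evF2 :
    HasMean (cond p.updateLaw (evF2 p.K p.svc p.dl n j))
      (fun e => α + β * e.2 + γ * e.2 ^ 2)
      ((∑ h ∈ Finset.Icc 1 p.K, p.deadlineMoment h α β γ +
        (p.N - p.K) * p.deadlineMoment p.K α β γ) / (p.sumR + (p.N - p.K) * p.R p.K)) := by
  have := hp.isProbabilityMeasure_updateLaw
  refine HasMean.of_cond' (hp.integrable_quadratic_deadline hα hβ hγ) ?_
  rw [hp.eq_div_N (hp.setIntegral_evF2 n j hα hβ hγ), hp.real_evF2,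
    div_div_div_cancel_right₀ hp.N_pos.ne']

theorem Params.Valid.hasMean_evS2 :
    HasMean (cond p.updateLaw (evS2 p.K p.svc p.dl n j))
      (fun e => α + β * e.2 + γ * e.2 ^ 2)
      ((p.K * p.deadlineMoment p.K α β γ - ∑ h ∈ Finset.Icc 1 p.K, p.deadlineMoment h α β γ) /
        (p.K * p.R p.K - p.sumR)) := by
  have := hp.isProbabilityMeasure_updateLaw
  refine HasMean.of_cond' (hp.integrable_quadratic_deadline hα hβ hγ) ?_
  rw [hp.eq_div_N (hp.setIntegral_evS2 n j hα hβ hγ), hp.real_evS2,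
    div_div_div_cancel_right₀ hp.N_pos.ne']

theorem Params.Valid.hasMean_evS :
    HasMean (cond p.updateLaw (evS p.K p.svc p.dl n j))
      (fun e => α + β * e.1 n + γ * e.1 n ^ 2)
      ((1 / (p.N * p.probS)) * ∑ h ∈ Finset.Icc 1 p.K, p.serveMoment h α β γ) := by
  have := hp.isProbabilityMeasure_updateLaw
  refine HasMean.of_cond' (hp.integrable_quadratic_service hα hβ hγ n) ?_
  rw [hp.eq_div_N (hp.setIntegral_evS n j hα hβ hγ), hp.real_evS, div_div, one_div_mul_eq_div]

/-- Almost surely 0 < duration ≤ deadline, so the quadratic in the deadline dominates. -/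
theorem Params.Valid.integrable_quadratic_duration :
    Integrable (fun e : p.Update => α + β * duration p.K e.1 e.2 + γ * duration p.K e.1 e.2 ^ 2)
      p.updateLaw := by
  refine (hp.integrable_quadratic_deadline hα hβ hγ).mono' ?_ ?_
  · have := hp.measurable_duration
    exact Measurable.aestronglyMeasurable (by fun_prop)
  · filter_upwards [hp.ae_generic] with e ⟨_, _, h3, h4⟩
    have h5 := kthSmallest_pos e.1 hp.one_le_K hp.K_le_N h3
    have hc := hp.c_pos
    have h6 : 0 < duration p.K e.1 e.2 := lt_min (hc.trans h4) (hc.trans h5)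
    have h7 : duration p.K e.1 e.2 ≤ e.2 := min_le_left _ _
    rw [Real.norm_of_nonneg (by positivity)]
    gcongr

/-- The success event splits, up to ties, according to which of T_N(K) and D ends the update; the
duration equals that one on each piece. The two conditional means are then weighted by the
conditional probabilities of the pieces. -/
theorem Params.Valid.hasMean_duration_evS :
    HasMean (cond p.updateLaw (evS p.K p.svc p.dl n j))
      (fun e => α + β * duration p.K e.1 e.2 + γ * duration p.K e.1 e.2 ^ 2)
      (p.probS1 * (p.serveMoment p.K α β γ / (1 - p.R p.K)) + (1 - p.probS1) *
        ((p.K * p.deadlineMoment p.K α β γ - ∑ h ∈ Finset.Icc 1 p.K, p.deadlineMoment h α β γ) /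
        (p.K * p.R p.K - p.sumR))) := by
  have := hp.isProbabilityMeasure_updateLaw
  have hi := hp.integrable_quadratic_duration hα hβ hγ
  refine HasMean.of_cond' hi ?_
  have e1 : ∫ e in evS1 p.K p.svc p.dl n j, (α + β * duration p.K e.1 e.2 +
      γ * duration p.K e.1 e.2 ^ 2) ∂p.updateLaw = ∫ e in evS1 p.K p.svc p.dl n j,
      (α + β * kthSmallest e.1 p.K + γ * kthSmallest e.1 p.K ^ 2) ∂p.updateLaw :=
    setIntegral_congr_fun (hp.measurableSet_evS1 n j) fun e he => by
      have : duration p.K e.1 e.2 = kthSmallest e.1 p.K := min_eq_right he.2.le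
      simp only [this]
  have e2 : ∫ e in evS2 p.K p.svc p.dl n j, (α + β * duration p.K e.1 e.2 +
      γ * duration p.K e.1 e.2 ^ 2) ∂p.updateLaw = ∫ e in evS2 p.K p.svc p.dl n j,
      (α + β * e.2 + γ * e.2 ^ 2) ∂p.updateLaw :=
    setIntegral_congr_fun (hp.measurableSet_evS2 n j) fun e he => by
      have : duration p.K e.1 e.2 = e.2 := min_eq_left he.2.le
      simp only [this]
  have c1 := (hp.hasMean_evS1 n j hα hβ hγ).2
  have c2 := (hp.hasMean_evS2 n j hα hβ hγ).2
  rw [(HasMean.of_cond (hp.integrable_quadratic_kthSmallest' hα hβ hγ hp.one_le_K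
    hp.K_le_N)).2] at c1
  rw [(HasMean.of_cond (hp.integrable_quadratic_deadline hα hβ hγ)).2] at c2
  rw [setIntegral_congr_set (hp.ae_eq_union_evS n j), setIntegral_union (p.disjoint_evS n j)
    (hp.measurableSet_evS2 n j) hi.integrableOn hi.integrableOn, e1, e2, ← c1, ← c2, hp.real_evS,
    hp.one_sub_probS1_eq n j, hp.probS1_eq n j, add_div]
  congr 1
  · exact div_eq_div_mul_div fun h0 =>
      setIntegral_measure_zero _ ((measureReal_eq_zero_iff).1 h0)
  · exact div_eq_div_mul_div fun h0 =>
      setIntegral_measure_zero _ ((measureReal_eq_zero_iff).1 h0)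

theorem Params.Valid.hasMean_duration_evF :
    HasMean (cond p.updateLaw (evF p.K p.svc p.dl n j))
      (fun e => α + β * duration p.K e.1 e.2 + γ * duration p.K e.1 e.2 ^ 2)
      ((1 - p.probF2) * (p.serveMoment p.K α β γ / (1 - p.R p.K)) + p.probF2 *
        ((∑ h ∈ Finset.Icc 1 p.K, p.deadlineMoment h α β γ +
        (p.N - p.K) * p.deadlineMoment p.K α β γ) / (p.sumR + (p.N - p.K) * p.R p.K))) := by
  have := hp.isProbabilityMeasure_updateLaw
  have hi := hp.integrable_quadratic_duration hα hβ hγ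
  refine HasMean.of_cond' hi ?_
  have e1 : ∫ e in evF1 p.K p.svc p.dl n j, (α + β * duration p.K e.1 e.2 +
      γ * duration p.K e.1 e.2 ^ 2) ∂p.updateLaw = ∫ e in evF1 p.K p.svc p.dl n j,
      (α + β * kthSmallest e.1 p.K + γ * kthSmallest e.1 p.K ^ 2) ∂p.updateLaw :=
    setIntegral_congr_fun (hp.measurableSet_evF1 n j) fun e he => by
      have : duration p.K e.1 e.2 = kthSmallest e.1 p.K := min_eq_right he.2.le
      simp only [this]
  have e2 : ∫ e in evF2 p.K p.svc p.dl n j, (α + β * duration p.K e.1 e.2 +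
      γ * duration p.K e.1 e.2 ^ 2) ∂p.updateLaw = ∫ e in evF2 p.K p.svc p.dl n j,
      (α + β * e.2 + γ * e.2 ^ 2) ∂p.updateLaw :=
    setIntegral_congr_fun (hp.measurableSet_evF2 n j) fun e he => by
      have : duration p.K e.1 e.2 = e.2 := min_eq_left he.2.le
      simp only [this]
  have c2 := (hp.hasMean_evF2 n j hα hβ hγ).2
  rw [(HasMean.of_cond (hp.integrable_quadratic_deadline hα hβ hγ)).2] at c2
  have hpos := hp.one_sub_probS_pos.ne'
  rw [setIntegral_congr_set (hp.ae_eq_union_evF n j), setIntegral_union (p.disjoint_evF n j)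
    (hp.measurableSet_evF2 n j) hi.integrableOn hi.integrableOn, e1, e2, ← c2, hp.real_evF,
    hp.one_sub_probF2_eq n j, hp.probF2_eq' n j, add_div]
  congr 1
  -- The closed form for the mean given `evF1` is available only for K < N. If K = N the event is
  -- null, and its weight removes the term.
  · rcases eq_or_ne (p.updateLaw.real (evF1 p.K p.svc p.dl n j)) 0 with h0 | h0
    · rw [setIntegral_measure_zero _ ((measureReal_eq_zero_iff).1 h0), h0]; simp
    · have hlt : p.K < p.N := by
        refine lt_of_le_of_ne hp.K_le_N fun h => h0 ?_
        rw [hp.real_evF1, h]; simp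
      have c1 := (hp.hasMean_evF1 n j hα hβ hγ hlt).2
      rw [(HasMean.of_cond (hp.integrable_quadratic_kthSmallest' hα hβ hγ hp.one_le_K
        hp.K_le_N)).2] at c1
      rw [← c1]
      exact div_eq_div_mul_div fun h => absurd h h0
  · exact div_eq_div_mul_div fun h0 =>
      setIntegral_measure_zero _ ((measureReal_eq_zero_iff).1 h0)

end Moments

end ClosedForms

end MulticastAoI

namespace MulticastAoI

open Set Real

/-! ### The law of the sequence of updates -/

/-- Law of the sequence of updates. -/
noncomputable def Params.pathLaw (p : Params) : Measure (ℕ → p.Update) :=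
  Measure.infinitePi fun _ => p.updateLaw

section PathLaw

variable {p : Params} (hp : p.Valid)

include hp

/-- Treats the N service times and the deadline as one independent family; independence of the two
disjoint groups of indices then splits the law as a product. -/
theorem Params.Valid.map_sum_eq_updateLaw :
    (Measure.infinitePi fun o : Fin p.N ⊕ Unit =>
      Sum.elim (fun _ => shiftedExp p.c p.lamS) (fun _ => shiftedExp p.c p.lamD) o).map
      (fun u => ((fun m => u (Sum.inl m), u (Sum.inr ())) : p.Update)) = p.updateLaw := by
  have := shiftedExp_isProbabilityMeasure (c := p.c) hp.lamS_pos
  have := shiftedExp_isProbabilityMeasure (c := p.c) hp.lamD_pos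
  set ρ : Fin p.N ⊕ Unit → Measure ℝ :=
    Sum.elim (fun _ => shiftedExp p.c p.lamS) (fun _ => shiftedExp p.c p.lamD) with hρ
  have hρp : ∀ o, IsProbabilityMeasure (ρ o) := by
    rintro (m | u)
    · exact inferInstanceAs (IsProbabilityMeasure (shiftedExp p.c p.lamS))
    · exact inferInstanceAs (IsProbabilityMeasure (shiftedExp p.c p.lamD))
  change (Measure.infinitePi ρ).map _ = _
  have hind : iIndepFun (fun (o : Fin p.N ⊕ Unit) (u : Fin p.N ⊕ Unit → ℝ) => u o)
      (Measure.infinitePi ρ) := iIndepFun_infinitePi (X := fun _ x => x) (by fun_prop)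
  have hpair : IndepFun (fun (u : Fin p.N ⊕ Unit → ℝ) (m : Fin p.N) => u (Sum.inl m))
      (fun u => u (Sum.inr ())) (Measure.infinitePi ρ) := by
    have h := hind.indepFun_finset (Finset.univ.map Function.Embedding.inl)
      {Sum.inr ()} (by simp) (by fun_prop)
    have hψ : Measurable fun v : ({Sum.inr ()} : Finset (Fin p.N ⊕ Unit)) → ℝ =>
        v ⟨Sum.inr (), by simp⟩ := measurable_pi_apply _
    exact h.comp
      (φ := fun v (m : Fin p.N) => v ⟨Sum.inl m, by simp⟩)
      (measurable_pi_lambda _ fun _ => measurable_pi_apply _) hψ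
  rw [(indepFun_iff_map_prod_eq_prod_map_map
    (measurable_pi_lambda _ fun _ => measurable_pi_apply _).aemeasurable
    (measurable_pi_apply _).aemeasurable).1 hpair,
    Params.updateLaw, Params.serviceLaw]
  congr 1
  · rw [Measure.map_infinitePi_infinitePi_of_inj (P := ρ) (f := Sum.inl) Sum.inl_injective,
      ← Measure.infinitePi_eq_pi]
    rfl
  · rw [Measure.infinitePi_map_eval]; rfl

/-- Under the assumptions of the model, the updates are independent with the law of one update. -/
theorem Params.Valid.measurePreserving_path {Ω : Type*} [MeasurableSpace Ω] (μ : Measure Ω)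
    [IsProbabilityMeasure μ] (T : Ω → ℕ → Fin p.N → ℝ) (D : Ω → ℕ → ℝ)
    (hTmeas : ∀ j m, Measurable (fun ω => T ω j m)) (hDmeas : ∀ j, Measurable (fun ω => D ω j))
    (hTlaw : ∀ j m, HasLaw (fun ω => T ω j m) (shiftedExp p.c p.lamS) μ)
    (hDlaw : ∀ j, HasLaw (fun ω => D ω j) (shiftedExp p.c p.lamD) μ)
    (hindep : iIndepFun (fun (i : (ℕ × Fin p.N) ⊕ ℕ) (ω : Ω) =>
      Sum.elim (fun a : ℕ × Fin p.N => T ω a.1 a.2) (fun j : ℕ => D ω j) i) μ) :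
    MeasurePreserving (fun ω j => ((T ω j, D ω j) : p.Update)) μ p.pathLaw := by
  have := shiftedExp_isProbabilityMeasure (c := p.c) hp.lamS_pos
  have := shiftedExp_isProbabilityMeasure (c := p.c) hp.lamD_pos
  have hmeas : Measurable (fun ω j => ((T ω j, D ω j) : p.Update)) := by
    refine measurable_pi_iff.2 fun j => Measurable.prodMk ?_ (hDmeas j)
    exact measurable_pi_iff.2 fun m => hTmeas j m
  refine ⟨hmeas, ?_⟩
  set ρ : Fin p.N ⊕ Unit → Measure ℝ :=
    Sum.elim (fun _ => shiftedExp p.c p.lamS) (fun _ => shiftedExp p.c p.lamD) with hρ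
  have hρp : ∀ o, IsProbabilityMeasure (ρ o) := by
    rintro (m | u)
    · exact inferInstanceAs (IsProbabilityMeasure (shiftedExp p.c p.lamS))
    · exact inferInstanceAs (IsProbabilityMeasure (shiftedExp p.c p.lamD))
  -- Regroups the variables by update: the first index is the update, the second a device or the
  -- deadline.
  set g : ℕ × (Fin p.N ⊕ Unit) → (ℕ × Fin p.N) ⊕ ℕ :=
    fun q => Sum.elim (fun m => Sum.inl (q.1, m)) (fun _ => Sum.inr q.1) q.2 with hg
  have hginj : Function.Injective g := by
    rintro ⟨i, m | u⟩ ⟨j, m' | u'⟩ h <;> simp_all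
  set Y : ℕ × (Fin p.N ⊕ Unit) → Ω → ℝ := fun q ω =>
    Sum.elim (fun a : ℕ × Fin p.N => T ω a.1 a.2) (fun j : ℕ => D ω j) (g q) with hY
  have hYind : iIndepFun Y μ := hindep.precomp hginj
  have hYm : ∀ q, Measurable (Y q) := by
    rintro ⟨j, m | u⟩
    · exact hTmeas j m
    · exact hDmeas j
  have hYlaw : ∀ q, HasLaw (Y q) (ρ q.2) μ := by
    rintro ⟨j, m | u⟩
    · exact hTlaw j m
    · exact hDlaw j
  have hlaw := (hYind.hasLaw_infinitePi hYlaw (measurable_pi_iff.2 hYm).aemeasurable).map_eq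
  -- Currying turns the product over all pairs into a sequence of independent families, one per
  -- update.
  have hcurry := Measure.infinitePi_map_curry (ι := ℕ) (fun _ : ℕ => ρ)
  rw [← hlaw, Measure.map_map (by fun_prop) (measurable_pi_iff.2 hYm)] at hcurry
  set f : (Fin p.N ⊕ Unit → ℝ) → p.Update :=
    fun u => (fun m => u (Sum.inl m), u (Sum.inr ())) with hf
  have hfm : Measurable f := by fun_prop
  have hpi := Measure.infinitePi_map_pi (fun _ : ℕ => Measure.infinitePi ρ)
    (f := fun _ => f) (fun _ => hfm)
  rw [← hcurry, Measure.map_map (by fun_prop)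
    ((MeasurableEquiv.measurable _).comp (measurable_pi_iff.2 hYm)),
    hp.map_sum_eq_updateLaw] at hpi
  exact hpi

end PathLaw

/-! ### Transfer of the one-update formulas to the given probability space -/

section Transfer

variable {p : Params} (hp : p.Valid) {Ω : Type*} [MeasurableSpace Ω] {μ : Measure Ω}
  {T : Ω → ℕ → Fin p.N → ℝ} {D : Ω → ℕ → ℝ}

include hp

/-- All the closed forms for a single update. -/
theorem Params.Valid.oneUpdate (n : Fin p.N) (j : ℕ)
    (hZ : MeasurePreserving (fun ω => ((T ω j, D ω j) : p.Update)) μ p.updateLaw) :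
    (∀ h, 1 ≤ h → h ≤ p.N → μ.real {ω | D ω j < kthSmallest (T ω j) h} = p.R h) ∧
      μ.real (evS p.K T D n j) = p.probS ∧
      (cond μ (evF p.K T D n j)).real (evF2 p.K T D n j) = p.probF2 ∧
      (cond μ (evF p.K T D n j)).real (evF1 p.K T D n j) = 1 - p.probF2 ∧
      (cond μ (evS p.K T D n j)).real (evS1 p.K T D n j) = p.probS1 ∧
      (cond μ (evS p.K T D n j)).real (evS2 p.K T D n j) = 1 - p.probS1 ∧
      (p.K < p.N →
          HasMean (cond μ (evF1 p.K T D n j))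
            (fun ω => kthSmallest (T ω j) p.K) p.meanServe ∧
          HasMean (cond μ (evF1 p.K T D n j))
            (fun ω => kthSmallest (T ω j) p.K ^ 2) p.sqServe) ∧
      (HasMean (cond μ (evS1 p.K T D n j))
            (fun ω => kthSmallest (T ω j) p.K) p.meanServe ∧
          HasMean (cond μ (evS1 p.K T D n j))
            (fun ω => kthSmallest (T ω j) p.K ^ 2) p.sqServe) ∧
      (HasMean (cond μ (evF2 p.K T D n j))
            (fun ω => D ω j) p.meanDeadlineF ∧
          HasMean (cond μ (evF2 p.K T D n j))
            (fun ω => D ω j ^ 2) p.sqDeadlineF) ∧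
      (HasMean (cond μ (evS2 p.K T D n j))
            (fun ω => D ω j) p.meanDeadlineS ∧
          HasMean (cond μ (evS2 p.K T D n j))
            (fun ω => D ω j ^ 2) p.sqDeadlineS) ∧
      (HasMean (cond μ (evF p.K T D n j))
            (fun ω => duration p.K (T ω j) (D ω j)) p.meanXF ∧
          HasMean (cond μ (evF p.K T D n j))
            (fun ω => duration p.K (T ω j) (D ω j) ^ 2) p.sqXF) ∧
      (HasMean (cond μ (evS p.K T D n j))
            (fun ω => duration p.K (T ω j) (D ω j)) p.meanXS ∧
          HasMean (cond μ (evS p.K T D n j))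
            (fun ω => duration p.K (T ω j) (D ω j) ^ 2) p.sqXS) ∧
      HasMean (cond μ (evS p.K T D n j)) (fun ω => T ω j n) p.meanT := by
  have hprob := hp.isProbabilityMeasure_updateLaw
  set Z : Ω → p.Update := fun ω => (T ω j, D ω j) with hZdef
  -- The events depend on the pair (service times, deadline) of update j alone, so each is
  -- definitionally a preimage under Z.
  have hS : evS p.K T D n j = Z ⁻¹' evS p.K p.svc p.dl n j := rfl
  have hF : evF p.K T D n j = Z ⁻¹' evF p.K p.svc p.dl n j := rfl
  have hS1 : evS1 p.K T D n j = Z ⁻¹' evS1 p.K p.svc p.dl n j := rfl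
  have hS2 : evS2 p.K T D n j = Z ⁻¹' evS2 p.K p.svc p.dl n j := rfl
  have hF1 : evF1 p.K T D n j = Z ⁻¹' evF1 p.K p.svc p.dl n j := rfl
  have hF2 : evF2 p.K T D n j = Z ⁻¹' evF2 p.K p.svc p.dl n j := rfl
  have mS := hp.measurableSet_evS n j
  have mF := hp.measurableSet_evF n j
  have mS1 := hp.measurableSet_evS1 n j
  have mS2 := hp.measurableSet_evS2 n j
  have mF1 := hp.measurableSet_evF1 n j
  have mF2 := hp.measurableSet_evF2 n j
  have hreal : ∀ {A : Set p.Update}, MeasurableSet A → μ.real (Z ⁻¹' A) = p.updateLaw.real A :=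
    fun hA => by rw [measureReal_def, measureReal_def, hZ.measure_preimage hA.nullMeasurableSet]
  have hcond : ∀ {A B : Set p.Update}, MeasurableSet A → MeasurableSet B → B ⊆ A →
      (cond μ (Z ⁻¹' A)).real (Z ⁻¹' B) = p.updateLaw.real B / p.updateLaw.real A := by
    intro A B hA hB hBA
    rw [cond_real_of_subset (hZ.measurable hA) (preimage_mono hBA), hreal hA, hreal hB]
  have hmean : ∀ {A : Set p.Update} {f : p.Update → ℝ} {m m' : ℝ} (g : Ω → ℝ), MeasurableSet A →
      HasMean (cond p.updateLaw A) f m → f ∘ Z = g → m = m' →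
      HasMean (cond μ (Z ⁻¹' A)) g m' := by
    intro A f m m' g hA hf hg hm
    rw [← hg, ← hm]
    exact hf.map (measurePreserving_cond hZ hA)
  have s1 := hp.serveMoment_eq_S₁ hp.K_le_N
  have s2 := hp.serveMoment_eq_S₂ hp.K_le_N
  have d1 := hp.deadlineMoment_eq_D₁ hp.K_le_N
  have d2 := hp.deadlineMoment_eq_D₂ hp.K_le_N
  have sd1 := hp.sum_Icc_congr fun h hN => hp.deadlineMoment_eq_D₁ hN
  have sd2 := hp.sum_Icc_congr fun h hN => hp.deadlineMoment_eq_D₂ hN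
  have ss1 := hp.sum_Icc_congr fun h hN => hp.serveMoment_eq_S₁ hN
  have h01 : (0 : ℝ) ≤ 1 := zero_le_one
  rw [hS, hF, hS1, hS2, hF1, hF2]
  refine ⟨fun h h1 hN => ?_, ?_, ?_, ?_, ?_, ?_, fun hlt => ⟨?_, ?_⟩, ⟨?_, ?_⟩, ⟨?_, ?_⟩,
    ⟨?_, ?_⟩, ⟨?_, ?_⟩, ⟨?_, ?_⟩, ?_⟩
  · rw [← hp.real_deadline_lt h1 hN]
    exact hreal (measurableSet_lt measurable_snd
      ((measurable_kthSmallest h1 hN).comp measurable_fst))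
  · rw [hreal mS, hp.real_evS]
  · rw [hcond mF mF2 inter_subset_left, hp.real_evF, ← hp.probF2_eq' n j]
  · rw [hcond mF mF1 inter_subset_left, hp.real_evF, ← hp.one_sub_probF2_eq n j]
  · rw [hcond mS mS1 inter_subset_left, hp.real_evS, ← hp.probS1_eq n j]
  · rw [hcond mS mS2 inter_subset_left, hp.real_evS, ← hp.one_sub_probS1_eq n j]
  · exact hmean _ mF1 (hp.hasMean_evF1 n j le_rfl h01 le_rfl hlt) (by ext ω; simp [Z])
      (by rw [s1, Params.meanServe])
  · exact hmean _ mF1 (hp.hasMean_evF1 n j le_rfl le_rfl h01 hlt) (by ext ω; simp [Z])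
      (by rw [s2, Params.sqServe])
  · exact hmean _ mS1 (hp.hasMean_evS1 n j le_rfl h01 le_rfl) (by ext ω; simp [Z])
      (by rw [s1, Params.meanServe])
  · exact hmean _ mS1 (hp.hasMean_evS1 n j le_rfl le_rfl h01) (by ext ω; simp [Z])
      (by rw [s2, Params.sqServe])
  · exact hmean _ mF2 (hp.hasMean_evF2 n j le_rfl h01 le_rfl) (by ext ω; simp [Z])
      (by rw [sd1, d1, Params.meanDeadlineF])
  · exact hmean _ mF2 (hp.hasMean_evF2 n j le_rfl le_rfl h01) (by ext ω; simp [Z])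
      (by rw [sd2, d2, Params.sqDeadlineF])
  · exact hmean _ mS2 (hp.hasMean_evS2 n j le_rfl h01 le_rfl) (by ext ω; simp [Z])
      (by rw [sd1, d1, Params.meanDeadlineS])
  · exact hmean _ mS2 (hp.hasMean_evS2 n j le_rfl le_rfl h01) (by ext ω; simp [Z])
      (by rw [sd2, d2, Params.sqDeadlineS])
  · exact hmean _ mF (hp.hasMean_duration_evF n j le_rfl h01 le_rfl) (by ext ω; simp [Z])
      (by rw [sd1, d1, s1, Params.meanXF, Params.meanServe, Params.meanDeadlineF])
  · exact hmean _ mF (hp.hasMean_duration_evF n j le_rfl le_rfl h01) (by ext ω; simp [Z])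
      (by rw [sd2, d2, s2, Params.sqXF, Params.sqServe, Params.sqDeadlineF])
  · exact hmean _ mS (hp.hasMean_duration_evS n j le_rfl h01 le_rfl) (by ext ω; simp [Z])
      (by rw [sd1, d1, s1, Params.meanXS, Params.meanServe, Params.meanDeadlineS])
  · exact hmean _ mS (hp.hasMean_duration_evS n j le_rfl le_rfl h01) (by ext ω; simp [Z])
      (by rw [sd2, d2, s2, Params.sqXS, Params.sqServe, Params.sqDeadlineS])
  · exact hmean _ mS (hp.hasMean_evS n j le_rfl h01 le_rfl) (by ext ω; simp [Z])
      (by rw [ss1, Params.meanT])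

end Transfer

end MulticastAoI

namespace MulticastAoI

open Set

/-! ### Renewals of an independent sequence at the visits to a set -/

section Renewal

variable {E : Type*} {S : Set E}

/-- The first visit of the path `z` to `S`. -/
noncomputable def firstHit (S : Set E) (z : ℕ → E) : ℕ := sInf {j | z j ∈ S}

/-- The path with its first `k` terms removed. -/
def shiftPath (k : ℕ) (z : ℕ → E) : ℕ → E := fun i => z (i + k)

/-- The path after its first visit to `S`. -/
noncomputable def afterHit (S : Set E) (z : ℕ → E) : ℕ → E := shiftPath (firstHit S z + 1) z

/-- The path is in `S` for the first time at time `a`. -/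
def hitAt (S : Set E) (a : ℕ) : Set (ℕ → E) := {z | z a ∈ S ∧ ∀ i < a, z i ∉ S}

/-- The term of the path at its first visit to `S`. -/
noncomputable def hitTerm (S : Set E) (z : ℕ → E) : E := z (firstHit S z)

/-- The sum of `f` over the terms before the first visit to `S`. -/
noncomputable def preHitSum (S : Set E) (f : E → ℝ) (z : ℕ → E) : ℝ :=
  ∑ i ∈ Finset.range (firstHit S z), f (z i)

theorem firstHit_of_mem_hitAt {a : ℕ} {z : ℕ → E} (hz : z ∈ hitAt S a) : firstHit S z = a := by
  refine le_antisymm (Nat.sInf_le hz.1) (le_csInf ⟨a, hz.1⟩ fun j hj => ?_)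
  by_contra h
  exact hz.2 j (not_le.1 h) hj

theorem mem_hitAt_firstHit {z : ℕ → E} (hz : ∃ j, z j ∈ S) : z ∈ hitAt S (firstHit S z) :=
  ⟨Nat.sInf_mem (s := {j | z j ∈ S}) hz, fun _ hi h => Nat.notMem_of_lt_sInf hi h⟩

theorem firstHit_of_mem {z : ℕ → E} (h : z 0 ∈ S) : firstHit S z = 0 :=
  firstHit_of_mem_hitAt ⟨h, by simp⟩

/-- A visit must be assumed: on a path that never meets S, `firstHit` takes the default value 0 and
the recursion fails. -/
theorem firstHit_of_notMem {z : ℕ → E} (hz : ∃ j, z j ∈ S) (h : z 0 ∉ S) :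
    firstHit S z = firstHit S (shiftPath 1 z) + 1 := by
  have hex : ∃ j, shiftPath 1 z j ∈ S := by
    obtain ⟨j, hj⟩ := hz
    rcases j with _ | j
    · exact absurd hj h
    · exact ⟨j, hj⟩
  have hm := mem_hitAt_firstHit hex
  refine firstHit_of_mem_hitAt ⟨hm.1, fun i hi => ?_⟩
  rcases i with _ | i
  · exact h
  · exact hm.2 i (by omega)

theorem exists_shiftPath_mem {z : ℕ → E} (hz : ∃ j, z j ∈ S) (h : z 0 ∉ S) :
    ∃ j, shiftPath 1 z j ∈ S := by
  obtain ⟨j, hj⟩ := hz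
  rcases j with _ | j
  · exact absurd hj h
  · exact ⟨j, hj⟩

theorem hitTerm_of_mem {z : ℕ → E} (h : z 0 ∈ S) : hitTerm S z = z 0 := by
  rw [hitTerm, firstHit_of_mem h]

theorem hitTerm_of_notMem {z : ℕ → E} (hz : ∃ j, z j ∈ S) (h : z 0 ∉ S) :
    hitTerm S z = hitTerm S (shiftPath 1 z) := by
  rw [hitTerm, firstHit_of_notMem hz h]; rfl

theorem preHitSum_of_mem {f : E → ℝ} {z : ℕ → E} (h : z 0 ∈ S) : preHitSum S f z = 0 := by
  rw [preHitSum, firstHit_of_mem h]; simp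

theorem preHitSum_of_notMem {f : E → ℝ} {z : ℕ → E} (hz : ∃ j, z j ∈ S) (h : z 0 ∉ S) :
    preHitSum S f z = f (z 0) + preHitSum S f (shiftPath 1 z) := by
  rw [preHitSum, firstHit_of_notMem hz h, Finset.sum_range_succ', add_comm]; rfl

variable [MeasurableSpace E]

theorem measurable_shiftPath (k : ℕ) : Measurable (shiftPath k : (ℕ → E) → ℕ → E) :=
  measurable_pi_lambda _ fun _ => measurable_pi_apply _

theorem measurableSet_hitAt (hS : MeasurableSet S) (a : ℕ) : MeasurableSet (hitAt S a) := by
  have : hitAt S a = (fun z => z a) ⁻¹' S ∩ ⋂ i, ⋂ _ : i < a, (fun z => z i) ⁻¹' Sᶜ := by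
    ext z; simp [hitAt]
  rw [this]
  exact (measurable_pi_apply a hS).inter (MeasurableSet.iInter fun i => MeasurableSet.iInter
    fun _ => measurable_pi_apply i hS.compl)

theorem measurable_firstHit (hS : MeasurableSet S) : Measurable (firstHit S) := by
  have hno : MeasurableSet {z : ℕ → E | ¬ ∃ j, z j ∈ S} := by
    have : {z : ℕ → E | ¬ ∃ j, z j ∈ S} = ⋂ j, (fun z => z j) ⁻¹' Sᶜ := by ext z; simp
    rw [this]
    exact MeasurableSet.iInter fun i => measurable_pi_apply i hS.compl
  refine measurable_to_countable' fun a => ?_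
  -- Paths without a visit fall into the fibre over 0, since `sInf ∅ = 0`.
  have : firstHit S ⁻¹' {a} = hitAt S a ∪ ({z | ¬ ∃ j, z j ∈ S} ∩ {_z | a = 0}) := by
    ext z
    constructor
    · rintro (rfl : firstHit S z = a)
      by_cases hz : ∃ j, z j ∈ S
      · exact Or.inl (mem_hitAt_firstHit hz)
      · refine Or.inr ⟨hz, ?_⟩
        have : {j | z j ∈ S} = ∅ := by ext j; simpa using fun h => hz ⟨j, h⟩
        change sInf {j | z j ∈ S} = 0
        rw [this, Nat.sInf_empty]
    · rintro (h | ⟨h, h0⟩)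
      · exact firstHit_of_mem_hitAt h
      · have : {j | z j ∈ S} = ∅ := by ext j; simpa using fun h' => h ⟨j, h'⟩
        change sInf {j | z j ∈ S} = a
        rw [this, Nat.sInf_empty]; exact h0.symm
  rw [this]
  exact (measurableSet_hitAt hS a).union (hno.inter (MeasurableSet.const _))

theorem measurable_hitTerm (hS : MeasurableSet S) : Measurable (hitTerm S) := by
  have : Measurable fun q : ℕ × (ℕ → E) => q.2 q.1 :=
    measurable_from_prod_countable_right fun a => measurable_pi_apply a
  exact this.comp ((measurable_firstHit hS).prodMk measurable_id)

theorem measurable_afterHit (hS : MeasurableSet S) : Measurable (afterHit S) := by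
  have : Measurable fun q : ℕ × (ℕ → E) => shiftPath (q.1 + 1) q.2 :=
    measurable_from_prod_countable_right fun a => measurable_shiftPath (a + 1)
  exact this.comp ((measurable_firstHit hS).prodMk measurable_id)

theorem measurable_preHitSum (hS : MeasurableSet S) {f : E → ℝ} (hf : Measurable f) :
    Measurable (preHitSum S f) := by
  have : Measurable fun q : ℕ × (ℕ → E) => ∑ i ∈ Finset.range q.1, f (q.2 i) :=
    measurable_from_prod_countable_right fun a =>
      Finset.measurable_sum (f := fun i (z : ℕ → E) => f (z i)) (Finset.range a)
        fun i _ => hf.comp (measurable_pi_apply i)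
  exact this.comp ((measurable_firstHit hS).prodMk measurable_id)

variable (π : Measure E) [IsProbabilityMeasure π]

local notation "ℙ∞" => Measure.infinitePi (fun _ : ℕ => π)

theorem measurePreserving_shiftPath (k : ℕ) : MeasurePreserving (shiftPath k) ℙ∞ ℙ∞ :=
  ⟨measurable_shiftPath k, Measure.map_infinitePi_infinitePi_of_inj (P := fun _ : ℕ => π)
    (f := fun i => i + k) (add_left_injective k)⟩

/-- Coordinates before k and from k on generate independent σ-algebras, as suprema over disjoint
index sets. -/
theorem indepFun_restrict_shiftPath (k : ℕ) :
    IndepFun (fun (z : ℕ → E) (i : Fin k) => z i) (shiftPath k) ℙ∞ := by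
  have hind : iIndepFun (fun (i : ℕ) (z : ℕ → E) => z i) ℙ∞ :=
    iIndepFun_infinitePi (X := fun _ x => x) (by fun_prop)
  have hdis : Disjoint {i : ℕ | i < k} {i : ℕ | k ≤ i} :=
    Set.disjoint_left.2 fun i h h' => absurd (show i < k from h) (not_lt.2 h')
  have h := indep_iSup_of_disjoint (m := fun i : ℕ => MeasurableSpace.comap
    (fun z : ℕ → E => z i) inferInstance) (fun i => (measurable_pi_apply i).comap_le)
    hind.iIndep hdis
  refine indep_of_indep_of_le_left (indep_of_indep_of_le_right h ?_) ?_
  · rw [← measurable_iff_comap_le]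
    refine @measurable_pi_lambda _ _ _ (_) _ _ fun i => ?_
    rw [measurable_iff_comap_le]
    exact le_iSup₂_of_le (i + k) (Nat.le_add_left k i) le_rfl
  · rw [← measurable_iff_comap_le]
    refine @measurable_pi_lambda _ _ _ (_) _ _ fun i => ?_
    rw [measurable_iff_comap_le]
    exact le_iSup₂_of_le (i : ℕ) i.2 le_rfl

theorem indepFun_eval_zero_shiftPath :
    IndepFun (fun z : ℕ → E => z 0) (shiftPath 1) ℙ∞ := by
  have hφ : Measurable fun u : Fin 1 → E => u 0 := measurable_pi_apply 0
  exact (indepFun_restrict_shiftPath π 1).comp hφ measurable_id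

variable {π}

/-- A path avoids S iff its first term does and its shift does. So the probability a of avoidance
satisfies a = π(Sᶜ) a with π(Sᶜ) < 1, and a = 0. -/
theorem ae_exists_mem (hS : MeasurableSet S) (hpos : π S ≠ 0) :
    ∀ᵐ z ∂ℙ∞, ∃ j, z j ∈ S := by
  rw [ae_iff]
  set A : Set (ℕ → E) := {z | ¬ ∃ j, z j ∈ S} with hA
  have hAm : MeasurableSet A := by
    have : A = ⋂ j, (fun z => z j) ⁻¹' Sᶜ := by ext z; simp [hA]
    rw [this]
    exact MeasurableSet.iInter fun i => measurable_pi_apply i hS.compl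
  have hrec : A = (fun z : ℕ → E => z 0) ⁻¹' Sᶜ ∩ shiftPath 1 ⁻¹' A := by
    ext z
    simp only [hA, not_exists, mem_ofPred_eq, mem_inter_iff, mem_preimage, mem_compl_iff]
    refine ⟨fun h => ⟨h 0, fun j => h (j + 1)⟩, fun h j => ?_⟩
    rcases j with _ | j
    · exact h.1
    · exact h.2 j
  have h1 : ℙ∞ A = π Sᶜ * ℙ∞ A := by
    conv_lhs => rw [hrec, (indepFun_eval_zero_shiftPath π).measure_inter_preimage_eq_mul _ _
      hS.compl hAm]
    rw [(measurePreserving_shiftPath π 1).measure_preimage hAm.nullMeasurableSet,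
      (measurePreserving_eval_infinitePi (fun _ : ℕ => π) 0).measure_preimage
        hS.compl.nullMeasurableSet]
  by_contra h0
  have hlt : π Sᶜ < 1 := by
    rw [prob_compl_eq_one_sub hS]
    exact ENNReal.sub_lt_self ENNReal.one_ne_top one_ne_zero hpos
  have := ENNReal.mul_lt_mul_left h0 (measure_ne_top _ _) hlt
  rw [one_mul, ← h1] at this
  exact lt_irrefl _ this

theorem measure_eq_tsum_hitAt (hS : MeasurableSet S) (hpos : π S ≠ 0) {B : Set (ℕ → E)}
    (hB : MeasurableSet B) : ℙ∞ B = ∑' a, ℙ∞ (B ∩ hitAt S a) := by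
  rw [← measure_iUnion, ← inter_iUnion]
  · refine measure_congr (eventuallyEq_set.2 ?_)
    filter_upwards [ae_exists_mem hS hpos] with z hz
    exact ⟨fun h => ⟨h, mem_iUnion.2 ⟨_, mem_hitAt_firstHit hz⟩⟩, fun h => h.1⟩
  · intro a b hab
    refine Set.disjoint_left.2 fun z hz hz' => hab ?_
    rw [← firstHit_of_mem_hitAt hz.2, ← firstHit_of_mem_hitAt hz'.2]
  · exact fun a => hB.inter (measurableSet_hitAt hS a)

/-- A strong Markov property by hand: where the first visit is at time a, the block is a function of
the first a + 1 terms and the future is the shift by a + 1. These are independent; sum over a. -/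
theorem measure_block_inter_afterHit (hS : MeasurableSet S) (hpos : π S ≠ 0) {f : E → ℝ}
    (hf : Measurable f) {C : Set (E × ℝ)} (hC : MeasurableSet C) {A : Set (ℕ → E)}
    (hA : MeasurableSet A) :
    ℙ∞ ((fun z => (hitTerm S z, preHitSum S f z)) ⁻¹' C ∩ afterHit S ⁻¹' A) =
      ℙ∞ ((fun z => (hitTerm S z, preHitSum S f z)) ⁻¹' C) * ℙ∞ A := by
  have hCm := ((measurable_hitTerm hS).prodMk (measurable_preHitSum hS hf)) hC
  rw [measure_eq_tsum_hitAt hS hpos (hCm.inter (measurable_afterHit hS hA)),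
    measure_eq_tsum_hitAt hS hpos hCm, ← ENNReal.tsum_mul_right]
  refine tsum_congr fun a => ?_
  set Ca : Set (Fin (a + 1) → E) := {u | u (Fin.last a) ∈ S ∧
    (∀ i : Fin a, u i.castSucc ∉ S) ∧ (u (Fin.last a), ∑ i : Fin a, f (u i.castSucc)) ∈ C} with hCa
  have hCam : MeasurableSet Ca := by
    have : Ca = (fun u => u (Fin.last a)) ⁻¹' S ∩ ((⋂ i : Fin a, (fun u => u i.castSucc) ⁻¹' Sᶜ) ∩
      (fun u => (u (Fin.last a), ∑ i : Fin a, f (u i.castSucc))) ⁻¹' C) := by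
      ext u; simp [hCa]
    rw [this]
    refine (measurable_pi_apply _ hS).inter ((MeasurableSet.iInter fun i =>
      measurable_pi_apply _ hS.compl).inter (?_))
    refine Measurable.prodMk (measurable_pi_apply _) ?_ hC
    exact Finset.measurable_sum _ fun i _ => hf.comp (measurable_pi_apply _)
  have h1 : (fun z => (hitTerm S z, preHitSum S f z)) ⁻¹' C ∩ hitAt S a =
      (fun (z : ℕ → E) (i : Fin (a + 1)) => z i) ⁻¹' Ca := by
    ext z
    constructor
    · rintro ⟨hz, ha⟩
      have hh := firstHit_of_mem_hitAt ha
      rw [mem_preimage, hitTerm, preHitSum, hh] at hz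
      refine ⟨ha.1, fun i => ha.2 i i.2, ?_⟩
      rwa [Finset.sum_range] at hz
    · rintro ⟨h1, h2, h3⟩
      have ha : z ∈ hitAt S a := ⟨h1, fun i hi => h2 ⟨i, hi⟩⟩
      have hh := firstHit_of_mem_hitAt ha
      refine ⟨?_, ha⟩
      rw [mem_preimage, hitTerm, preHitSum, hh, Finset.sum_range]
      exact h3
  have h2 : (fun z => (hitTerm S z, preHitSum S f z)) ⁻¹' C ∩ afterHit S ⁻¹' A ∩ hitAt S a =
      (fun (z : ℕ → E) (i : Fin (a + 1)) => z i) ⁻¹' Ca ∩ shiftPath (a + 1) ⁻¹' A := by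
    rw [← h1]
    ext z
    constructor
    · rintro ⟨⟨h1, h2⟩, h3⟩
      refine ⟨⟨h1, h3⟩, ?_⟩
      rw [mem_preimage, afterHit, firstHit_of_mem_hitAt h3] at h2
      exact h2
    · rintro ⟨⟨h1, h3⟩, h2⟩
      refine ⟨⟨h1, ?_⟩, h3⟩
      rw [mem_preimage, afterHit, firstHit_of_mem_hitAt h3]
      exact h2
  rw [h1, h2, (indepFun_restrict_shiftPath π (a + 1)).measure_inter_preimage_eq_mul _ _ hCam hA,
    (measurePreserving_shiftPath π (a + 1)).measure_preimage hA.nullMeasurableSet]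

/-- The path after its first visit to `S` has the law of the whole path. -/
theorem measurePreserving_afterHit (hS : MeasurableSet S) (hpos : π S ≠ 0) :
    MeasurePreserving (afterHit S) ℙ∞ ℙ∞ := by
  refine ⟨measurable_afterHit hS, Measure.ext fun A hA => ?_⟩
  have := measure_block_inter_afterHit hS hpos (f := fun _ => 0) measurable_const
    MeasurableSet.univ hA
  rw [preimage_univ, univ_inter, measure_univ, one_mul] at this
  rw [Measure.map_apply (measurable_afterHit hS) hA, this]

/-- The path up to its first visit to `S` is independent of what comes after. -/
theorem indepFun_block_afterHit (hS : MeasurableSet S) (hpos : π S ≠ 0) {f : E → ℝ}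
    (hf : Measurable f) :
    IndepFun (fun z => (hitTerm S z, preHitSum S f z)) (afterHit S) ℙ∞ := by
  rw [indepFun_iff_measure_inter_preimage_eq_mul]
  intro C A hC hA
  rw [measure_block_inter_afterHit hS hpos hf hC hA,
    (measurePreserving_afterHit hS hpos).measure_preimage hA.nullMeasurableSet]

end Renewal

end MulticastAoI

namespace MulticastAoI

open Set

/-! ### Moments of the terms attached to one renewal -/

section Moments

variable {E : Type*} [MeasurableSpace E] {S : Set E} {π : Measure E} [IsProbabilityMeasure π]

local notation "ℙ∞" => Measure.infinitePi (fun _ : ℕ => π)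

theorem measurePreserving_eval_zero : MeasurePreserving (fun z : ℕ → E => z 0) ℙ∞ π :=
  measurePreserving_eval_infinitePi (fun _ : ℕ => π) 0

theorem integral_comp_eval_zero {a : E → ℝ} (ha : Measurable a) :
    ∫ z, a (z 0) ∂ℙ∞ = ∫ x, a x ∂π := by
  have h := integral_map (μ := ℙ∞) (φ := fun z : ℕ → E => z 0) (f := a)
    (measurable_pi_apply 0).aemeasurable ha.aestronglyMeasurable
  rw [measurePreserving_eval_zero.map_eq] at h
  exact h.symm

theorem integral_comp_shiftPath (k : ℕ) {b : (ℕ → E) → ℝ} (hb : Measurable b) :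
    ∫ z, b (shiftPath k z) ∂ℙ∞ = ∫ z, b z ∂ℙ∞ := by
  have h := integral_map (μ := ℙ∞) (f := b)
    (measurable_shiftPath k).aemeasurable hb.aestronglyMeasurable
  rw [(measurePreserving_shiftPath π k).map_eq] at h
  exact h.symm

theorem integral_eval_mul_shiftPath {a : E → ℝ} {b : (ℕ → E) → ℝ} (ha : Measurable a)
    (hb : Measurable b) :
    ∫ z, a (z 0) * b (shiftPath 1 z) ∂ℙ∞ = (∫ x, a x ∂π) * ∫ z, b z ∂ℙ∞ := by
  rw [← integral_comp_eval_zero ha, ← integral_comp_shiftPath 1 hb]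
  exact ((indepFun_eval_zero_shiftPath π).comp ha hb).integral_fun_mul_eq_mul_integral
    (ha.comp (measurable_pi_apply 0)).aestronglyMeasurable
    (hb.comp (measurable_shiftPath 1)).aestronglyMeasurable

/-- The first term of the sequence in `S` has the conditional law given `S`. -/
theorem map_hitTerm (hS : MeasurableSet S) (hpos : π S ≠ 0) :
    MeasurePreserving (hitTerm S) ℙ∞ (cond π S) := by
  refine ⟨measurable_hitTerm hS, Measure.ext fun B hB => ?_⟩
  have hm := measurable_hitTerm hS hB
  rw [Measure.map_apply (measurable_hitTerm hS) hB, cond_apply hS]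
  -- First-step analysis: either the first term is already the visit, or the path starts afresh.
  -- Solving for the probability gives π(S ∩ B) / π(S).
  have hsplit : ℙ∞ (hitTerm S ⁻¹' B) = π (S ∩ B) + π Sᶜ * ℙ∞ (hitTerm S ⁻¹' B) := by
    have h0 : MeasurableSet ((fun z : ℕ → E => z 0) ⁻¹' S) := measurable_pi_apply 0 hS
    have e1 : hitTerm S ⁻¹' B ∩ (fun z : ℕ → E => z 0) ⁻¹' S =
        (fun z : ℕ → E => z 0) ⁻¹' (S ∩ B) := by
      ext z
      have key : z 0 ∈ S → (hitTerm S z ∈ B ↔ z 0 ∈ B) := fun h => by rw [hitTerm_of_mem h]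
      exact ⟨fun ⟨h, h'⟩ => ⟨h', (key h').1 h⟩, fun ⟨h, h'⟩ => ⟨(key h).2 h', h⟩⟩
    have e2 : (hitTerm S ⁻¹' B \ (fun z : ℕ → E => z 0) ⁻¹' S : Set (ℕ → E)) =ᵐ[ℙ∞]
        ((fun z : ℕ → E => z 0) ⁻¹' Sᶜ ∩ shiftPath 1 ⁻¹' (hitTerm S ⁻¹' B) : Set (ℕ → E)) := by
      refine eventuallyEq_set.2 ?_
      filter_upwards [ae_exists_mem hS hpos] with z hz
      have key : z 0 ∉ S → (hitTerm S z ∈ B ↔ hitTerm S (shiftPath 1 z) ∈ B) := fun h => by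
        rw [hitTerm_of_notMem hz h]
      exact ⟨fun ⟨h, h'⟩ => ⟨h', (key h').1 h⟩, fun ⟨h, h'⟩ => ⟨(key h).2 h', h⟩⟩
    have h := measure_inter_add_sdiff (μ := ℙ∞) (hitTerm S ⁻¹' B) h0
    rw [e1, measure_congr e2,
      (indepFun_eval_zero_shiftPath π).measure_inter_preimage_eq_mul _ _ hS.compl hm,
      (measurePreserving_shiftPath π 1).measure_preimage hm.nullMeasurableSet,
      (measurePreserving_eval_zero (π := π)).measure_preimage hS.compl.nullMeasurableSet,
      (measurePreserving_eval_zero (π := π)).measure_preimage (hS.inter hB).nullMeasurableSet] at h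
    exact h.symm
  have hfin : π Sᶜ * ℙ∞ (hitTerm S ⁻¹' B) ≠ ⊤ :=
    ENNReal.mul_ne_top (measure_ne_top _ _) (measure_ne_top _ _)
  have hone : ℙ∞ (hitTerm S ⁻¹' B) = π S * ℙ∞ (hitTerm S ⁻¹' B) +
      π Sᶜ * ℙ∞ (hitTerm S ⁻¹' B) := by
    rw [← add_mul, measure_add_measure_compl hS, measure_univ, one_mul]
  have hmul : π S * ℙ∞ (hitTerm S ⁻¹' B) = π (S ∩ B) :=
    (ENNReal.add_left_inj hfin).1 (hone.symm.trans hsplit)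
  rw [← hmul, ← mul_assoc, ENNReal.inv_mul_cancel hpos (measure_ne_top _ _), one_mul]

/-- The indicator of the complement of `S`. -/
noncomputable def offInd (S : Set E) (x : E) : ℝ := Sᶜ.indicator (fun _ => 1) x

omit [MeasurableSpace E] in
theorem offInd_of_mem {x : E} (h : x ∈ S) : offInd S x = 0 := by simp [offInd, h]

omit [MeasurableSpace E] in
theorem offInd_of_notMem {x : E} (h : x ∉ S) : offInd S x = 1 := by simp [offInd, h]

omit [MeasurableSpace E] in
theorem offInd_mul_self (x : E) : offInd S x * offInd S x = offInd S x := by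
  by_cases h : x ∈ S
  · simp [offInd_of_mem h]
  · simp [offInd_of_notMem h]

theorem measurable_offInd (hS : MeasurableSet S) : Measurable (offInd S) :=
  measurable_const.indicator hS.compl

omit [MeasurableSpace E] in
theorem abs_offInd_mul_le (x : E) (y : ℝ) : ‖offInd S x * y‖ ≤ ‖y‖ := by
  by_cases h : x ∈ S
  · simp [offInd_of_mem h]
  · simp [offInd_of_notMem h]

theorem integral_offInd (hS : MeasurableSet S) : ∫ x, offInd S x ∂π = 1 - π.real S := by
  have := integral_indicator_const (μ := π) (1 : ℝ) hS.compl
  rw [smul_eq_mul, mul_one, probReal_compl_eq_one_sub hS] at this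
  exact this

omit [IsProbabilityMeasure π] in
theorem integral_offInd_mul (hS : MeasurableSet S) (f : E → ℝ) :
    ∫ x, offInd S x * f x ∂π = ∫ x in Sᶜ, f x ∂π := by
  rw [← integral_indicator hS.compl]
  congr 1; ext x
  by_cases h : x ∈ S
  · simp [offInd_of_mem h, h]
  · simp [offInd_of_notMem h, h]

/-- The sum of `f` over the terms before the first visit to `S`, cut off after `k` terms. -/
noncomputable def truncSum (S : Set E) (f : E → ℝ) : ℕ → (ℕ → E) → ℝ
  | 0, _ => 0
  | k + 1, z => offInd S (z 0) * (f (z 0) + truncSum S f k (shiftPath 1 z))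

variable {f : E → ℝ}

-- The truncations are eventually constant in k, which gives the pointwise limit used with Fatou's
-- lemma.
omit [MeasurableSpace E] in
theorem truncSum_eq_preHitSum (k : ℕ) : ∀ (z : ℕ → E), (∃ j, z j ∈ S) → firstHit S z < k →
    truncSum S f k z = preHitSum S f z := by
  induction k with
  | zero => intro z _ h; omega
  | succ k ih =>
    intro z hz h
    rw [truncSum]
    by_cases h0 : z 0 ∈ S
    · rw [offInd_of_mem h0, preHitSum_of_mem h0, zero_mul]
    · rw [offInd_of_notMem h0, preHitSum_of_notMem hz h0, one_mul,
        ih _ (exists_shiftPath_mem hz h0)]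
      rw [firstHit_of_notMem hz h0] at h; omega

theorem measurable_truncSum (hS : MeasurableSet S) (hf : Measurable f) (k : ℕ) :
    Measurable (truncSum S f k) := by
  induction k with
  | zero => exact measurable_const
  | succ k ih =>
    exact ((measurable_offInd hS).comp (measurable_pi_apply 0)).mul
      ((hf.comp (measurable_pi_apply 0)).add (ih.comp (measurable_shiftPath 1)))

theorem memLp_off_eval_add_shift (hS : MeasurableSet S) (hf : Measurable f) (hf2 : MemLp f 2 π)
    {w : (ℕ → E) → ℝ} (hw : Measurable w) (hw2 : MemLp w 2 ℙ∞) :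
    MemLp (fun z => offInd S (z 0) * (f (z 0) + w (shiftPath 1 z))) 2 ℙ∞ := by
  have h1 : MemLp (fun z : ℕ → E => f (z 0) + w (shiftPath 1 z)) 2 ℙ∞ :=
    (hf2.comp_measurePreserving measurePreserving_eval_zero).add
      (hw2.comp_measurePreserving (measurePreserving_shiftPath π 1))
  refine h1.mono ?_ (Eventually.of_forall fun z => abs_offInd_mul_le _ _)
  exact (((measurable_offInd hS).comp (measurable_pi_apply 0)).mul
      ((hf.comp (measurable_pi_apply 0)).add (hw.comp (measurable_shiftPath 1)))
      ).aestronglyMeasurable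

/-- First and second moment of a functional that satisfies the one-step recursion. -/
theorem integral_off_eval_add_shift (hS : MeasurableSet S) (hf : Measurable f)
    (hf2 : MemLp f 2 π) {w : (ℕ → E) → ℝ} (hw : Measurable w) (hw2 : MemLp w 2 ℙ∞) :
    ∫ z, offInd S (z 0) * (f (z 0) + w (shiftPath 1 z)) ∂ℙ∞ =
      ∫ x in Sᶜ, f x ∂π + (1 - π.real S) * ∫ z, w z ∂ℙ∞ ∧
    ∫ z, (offInd S (z 0) * (f (z 0) + w (shiftPath 1 z))) ^ 2 ∂ℙ∞ =
      ∫ x in Sᶜ, f x ^ 2 ∂π + 2 * (∫ x in Sᶜ, f x ∂π) * ∫ z, w z ∂ℙ∞ +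
        (1 - π.real S) * ∫ z, w z ^ 2 ∂ℙ∞ := by
  have hoM := measurable_offInd hS
  have hfE : MemLp (fun z : ℕ → E => f (z 0)) 2 ℙ∞ :=
    hf2.comp_measurePreserving measurePreserving_eval_zero
  have hwE : MemLp (fun z : ℕ → E => w (shiftPath 1 z)) 2 ℙ∞ :=
    hw2.comp_measurePreserving (measurePreserving_shiftPath π 1)
  have hoE : Measurable fun z : ℕ → E => offInd S (z 0) := hoM.comp (measurable_pi_apply 0)
  have key : ∀ {g : (ℕ → E) → ℝ}, Integrable g ℙ∞ →
      Integrable (fun z => offInd S (z 0) * g z) ℙ∞ := fun hg =>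
    hg.mono (hoE.aestronglyMeasurable.mul hg.aestronglyMeasurable)
      (Eventually.of_forall fun z => abs_offInd_mul_le _ _)
  have i1 : Integrable (fun z : ℕ → E => offInd S (z 0) * f (z 0)) ℙ∞ :=
    key (hfE.integrable one_le_two)
  have i2 : Integrable (fun z : ℕ → E => offInd S (z 0) * w (shiftPath 1 z)) ℙ∞ :=
    key (hwE.integrable one_le_two)
  have i3 : Integrable (fun z : ℕ → E => offInd S (z 0) * f (z 0) ^ 2) ℙ∞ := key hfE.integrable_sq
  have i4 : Integrable (fun z : ℕ → E => offInd S (z 0) * w (shiftPath 1 z) ^ 2) ℙ∞ :=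
    key hwE.integrable_sq
  have i5 : Integrable (fun z : ℕ → E => 2 * ((offInd S (z 0) * f (z 0)) * w (shiftPath 1 z)))
      ℙ∞ := by
    have := (key (hfE.integrable_mul hwE)).const_mul 2
    refine this.congr (Eventually.of_forall fun z => ?_)
    simp only [Pi.mul_apply]; ring
  have e1 : ∫ z : ℕ → E, offInd S (z 0) * f (z 0) ∂ℙ∞ = ∫ x in Sᶜ, f x ∂π := by
    rw [integral_comp_eval_zero (a := fun x => offInd S x * f x) (hoM.mul hf),
      integral_offInd_mul hS]
  have e3 : ∫ z : ℕ → E, offInd S (z 0) * f (z 0) ^ 2 ∂ℙ∞ = ∫ x in Sᶜ, f x ^ 2 ∂π := by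
    rw [integral_comp_eval_zero (a := fun x => offInd S x * f x ^ 2) (hoM.mul (hf.pow_const 2)),
      integral_offInd_mul hS]
  have e2 : ∫ z : ℕ → E, offInd S (z 0) * w (shiftPath 1 z) ∂ℙ∞ =
      (1 - π.real S) * ∫ z, w z ∂ℙ∞ := by
    rw [integral_eval_mul_shiftPath hoM hw, integral_offInd hS]
  have e4 : ∫ z : ℕ → E, offInd S (z 0) * w (shiftPath 1 z) ^ 2 ∂ℙ∞ =
      (1 - π.real S) * ∫ z, w z ^ 2 ∂ℙ∞ := by
    rw [integral_eval_mul_shiftPath (b := fun z => w z ^ 2) hoM (hw.pow_const 2),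
      integral_offInd hS]
  have e5 : ∫ z : ℕ → E, 2 * ((offInd S (z 0) * f (z 0)) * w (shiftPath 1 z)) ∂ℙ∞ =
      2 * (∫ x in Sᶜ, f x ∂π) * ∫ z, w z ∂ℙ∞ := by
    rw [integral_const_mul, integral_eval_mul_shiftPath (a := fun x => offInd S x * f x)
      (hoM.mul hf) hw, integral_offInd_mul hS, mul_assoc]
  constructor
  · simp only [mul_add]
    rw [integral_add i1 i2, e1, e2]
  · have hsq : ∀ z : ℕ → E, (offInd S (z 0) * (f (z 0) + w (shiftPath 1 z))) ^ 2 =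
        offInd S (z 0) * f (z 0) ^ 2 + 2 * ((offInd S (z 0) * f (z 0)) * w (shiftPath 1 z)) +
          offInd S (z 0) * w (shiftPath 1 z) ^ 2 := fun z => by
      rw [mul_pow, pow_two (offInd S (z 0)), offInd_mul_self]; ring
    have i35 : Integrable (fun z : ℕ → E => offInd S (z 0) * f (z 0) ^ 2 +
        2 * ((offInd S (z 0) * f (z 0)) * w (shiftPath 1 z))) ℙ∞ := i3.add i5
    simp only [hsq]
    rw [integral_add i35 i4, integral_add i3 i5, e3, e4, e5]

theorem memLp_truncSum (hS : MeasurableSet S) (hf : Measurable f) (hf2 : MemLp f 2 π) (k : ℕ) :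
    MemLp (truncSum S f k) 2 ℙ∞ := by
  induction k with
  | zero => exact MemLp.zero
  | succ k ih => exact memLp_off_eval_add_shift hS hf hf2 (measurable_truncSum hS hf k) ih

/-- Both moments of the truncations obey affine recursions with contraction factor 1 - π(S) < 1, so
they stay below the fixed points of the corresponding bounds. -/
theorem integral_truncSum_sq_le (hS : MeasurableSet S) (hpos : π S ≠ 0) (hf : Measurable f)
    (hf2 : MemLp f 2 π) : ∃ C, ∀ k, ∫ z, truncSum S f k z ^ 2 ∂ℙ∞ ≤ C := by
  have hp : 0 < π.real S := ENNReal.toReal_pos hpos (measure_ne_top _ _)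
  have hp1 : π.real S ≤ 1 := measureReal_le_one
  set α := ∫ x in Sᶜ, f x ∂π with hα
  set α₂ := ∫ x in Sᶜ, f x ^ 2 ∂π with hα₂
  set r := π.real S with hr
  -- Fixed point of x ↦ |α| + (1 - r) x.
  set M := |α| / r with hM
  have hM0 : 0 ≤ M := by positivity
  have h1 : ∀ k, |∫ z, truncSum S f k z ∂ℙ∞| ≤ M := by
    intro k
    induction k with
    | zero => simpa [truncSum] using hM0
    | succ k ih =>
      have h := (integral_off_eval_add_shift hS hf hf2 (measurable_truncSum hS hf k)
        (memLp_truncSum hS hf hf2 k)).1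
      simp only [truncSum]
      rw [h]
      have hrM : |α| = r * M := by rw [hM]; field_simp
      calc |α + (1 - r) * ∫ z, truncSum S f k z ∂ℙ∞|
          ≤ |α| + |(1 - r) * ∫ z, truncSum S f k z ∂ℙ∞| := abs_add_le _ _
        _ ≤ |α| + (1 - r) * M := by
          rw [abs_mul, abs_of_nonneg (sub_nonneg.2 hp1)]
          gcongr
        _ = M := by rw [hrM]; ring
  -- Fixed point of x ↦ α₂ + 2|α|M + (1 - r) x.
  set C := (α₂ + 2 * |α| * M) / r with hC
  have hα₂0 : 0 ≤ α₂ := integral_nonneg fun x => sq_nonneg _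
  have hC0 : 0 ≤ C := by positivity
  refine ⟨C, fun k => ?_⟩
  induction k with
  | zero => simpa [truncSum] using hC0
  | succ k ih =>
    have h := (integral_off_eval_add_shift hS hf hf2 (measurable_truncSum hS hf k)
      (memLp_truncSum hS hf hf2 k)).2
    simp only [truncSum]
    rw [h]
    have hrC : α₂ + 2 * |α| * M = r * C := by rw [hC]; field_simp
    have h3 : 2 * α * ∫ z, truncSum S f k z ∂ℙ∞ ≤ 2 * |α| * M := by
      calc 2 * α * ∫ z, truncSum S f k z ∂ℙ∞ ≤ |2 * α * ∫ z, truncSum S f k z ∂ℙ∞| := le_abs_self _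
        _ = 2 * |α| * |∫ z, truncSum S f k z ∂ℙ∞| := by
          rw [abs_mul, abs_mul, abs_two]
        _ ≤ _ := by gcongr; exact h1 k
    have h4 : (1 - r) * ∫ z, truncSum S f k z ^ 2 ∂ℙ∞ ≤ (1 - r) * C :=
      mul_le_mul_of_nonneg_left ih (sub_nonneg.2 hp1)
    linarith

/-- The moment equations can be solved only once the moments are known to be finite. That follows
from the uniform bound on the truncations by Fatou's lemma. -/
theorem memLp_preHitSum (hS : MeasurableSet S) (hpos : π S ≠ 0) (hf : Measurable f)
    (hf2 : MemLp f 2 π) : MemLp (preHitSum S f) 2 ℙ∞ := by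
  rw [memLp_two_iff_integrable_sq (measurable_preHitSum hS hf).aestronglyMeasurable,
    ← memLp_one_iff_integrable]
  refine ⟨((measurable_preHitSum hS hf).pow_const 2).aestronglyMeasurable, ?_⟩
  obtain ⟨C, hC⟩ := integral_truncSum_sq_le hS hpos hf hf2
  have hlim : ∀ᵐ z ∂ℙ∞, Tendsto (fun k => truncSum S f k z ^ 2) atTop
      (𝓝 (preHitSum S f z ^ 2)) := by
    filter_upwards [ae_exists_mem hS hpos] with z hz
    refine tendsto_const_nhds.congr' ?_
    filter_upwards [eventually_gt_atTop (firstHit S z)] with k hk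
    rw [truncSum_eq_preHitSum k z hz hk]
  refine lt_of_le_of_lt (Lp.eLpNorm_lim_le_liminf_eLpNorm (f := fun k z => truncSum S f k z ^ 2)
    (fun k => ((measurable_truncSum hS hf k).pow_const 2).aestronglyMeasurable) _ hlim) ?_
  refine lt_of_le_of_lt (liminf_le_of_frequently_le' (Frequently.of_forall fun k => ?_))
    (ENNReal.ofReal_lt_top (r := C))
  rw [eLpNorm_one_eq_lintegral_enorm, ← ofReal_integral_norm_eq_lintegral_enorm
    (memLp_truncSum hS hf hf2 k).integrable_sq]
  refine ENNReal.ofReal_le_ofReal ?_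
  simpa using hC k

theorem preHitSum_ae_eq (hS : MeasurableSet S) (hpos : π S ≠ 0) :
    preHitSum S f =ᵐ[ℙ∞]
      fun z => offInd S (z 0) * (f (z 0) + preHitSum S f (shiftPath 1 z)) := by
  filter_upwards [ae_exists_mem hS hpos] with z hz
  by_cases h : z 0 ∈ S
  · rw [preHitSum_of_mem h, offInd_of_mem h, zero_mul]
  · rw [preHitSum_of_notMem hz h, offInd_of_notMem h, one_mul]

/-- The functional satisfies its own one-step recursion, so `integral_off_eval_add_shift` becomes a
linear equation for each moment, with coefficient 1 - (1 - π(S)) = π(S). -/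
theorem integral_preHitSum (hS : MeasurableSet S) (hpos : π S ≠ 0) (hf : Measurable f)
    (hf2 : MemLp f 2 π) :
    ∫ z, preHitSum S f z ∂ℙ∞ = (∫ x in Sᶜ, f x ∂π) / π.real S ∧
    ∫ z, preHitSum S f z ^ 2 ∂ℙ∞ = (∫ x in Sᶜ, f x ^ 2 ∂π +
      2 * (∫ x in Sᶜ, f x ∂π) * ∫ z, preHitSum S f z ∂ℙ∞) / π.real S := by
  have hp : π.real S ≠ 0 := (ENNReal.toReal_pos hpos (measure_ne_top _ _)).ne'
  obtain ⟨h1, h2⟩ := integral_off_eval_add_shift hS hf hf2 (measurable_preHitSum hS hf)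
    (memLp_preHitSum hS hpos hf hf2)
  have hae := preHitSum_ae_eq (f := f) hS hpos
  rw [← integral_congr_ae hae] at h1
  have hsq : ∫ z, preHitSum S f z ^ 2 ∂ℙ∞ = _ :=
    integral_congr_ae (hae.fun_comp fun t => t ^ 2)
  replace h2 := hsq.trans h2
  constructor
  · rw [eq_div_iff hp]; linarith
  · rw [eq_div_iff hp]; linarith

/-- The sum before the first visit to `S` and the term at that visit are uncorrelated. -/
theorem integral_preHitSum_mul (hS : MeasurableSet S) (hpos : π S ≠ 0) (hf : Measurable f)
    (hf2 : MemLp f 2 π) {g : E → ℝ} (hg : Measurable g)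
    (hg2 : MemLp g 2 (cond π S)) :
    ∫ z, preHitSum S f z * g (hitTerm S z) ∂ℙ∞ =
      (∫ z, preHitSum S f z ∂ℙ∞) * ∫ z, g (hitTerm S z) ∂ℙ∞ := by
  have hp : π.real S ≠ 0 := (ENNReal.toReal_pos hpos (measure_ne_top _ _)).ne'
  set b : (ℕ → E) → ℝ := fun z => g (hitTerm S z) with hb
  have hbm : Measurable b := hg.comp (measurable_hitTerm hS)
  have hb2 : MemLp b 2 ℙ∞ := hg2.comp_measurePreserving (map_hitTerm hS hpos)
  have hwm := measurable_preHitSum hS hf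
  have hw2 := memLp_preHitSum hS hpos hf hf2
  have hoM := measurable_offInd hS
  -- The visited term is unchanged by removing a failed first term, so the product satisfies the
  -- same kind of recursion; its solution is the product of the means.
  have hae : (fun z => preHitSum S f z * b z) =ᵐ[ℙ∞] fun z =>
      offInd S (z 0) * f (z 0) * b (shiftPath 1 z) +
        offInd S (z 0) * (preHitSum S f (shiftPath 1 z) * b (shiftPath 1 z)) := by
    filter_upwards [ae_exists_mem hS hpos] with z hz
    by_cases h : z 0 ∈ S
    · rw [preHitSum_of_mem h, offInd_of_mem h]; ring
    · rw [preHitSum_of_notMem hz h, offInd_of_notMem h, hb]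
      simp only
      rw [hitTerm_of_notMem hz h]; ring
  have hoE : Measurable fun z : ℕ → E => offInd S (z 0) := hoM.comp (measurable_pi_apply 0)
  have key : ∀ {g : (ℕ → E) → ℝ}, Integrable g ℙ∞ →
      Integrable (fun z => offInd S (z 0) * g z) ℙ∞ := fun hg =>
    hg.mono (hoE.aestronglyMeasurable.mul hg.aestronglyMeasurable)
      (Eventually.of_forall fun z => abs_offInd_mul_le _ _)
  have hfE : MemLp (fun z : ℕ → E => f (z 0)) 2 ℙ∞ :=
    hf2.comp_measurePreserving measurePreserving_eval_zero
  have hbE : MemLp (fun z : ℕ → E => b (shiftPath 1 z)) 2 ℙ∞ :=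
    hb2.comp_measurePreserving (measurePreserving_shiftPath π 1)
  have hwE : MemLp (fun z : ℕ → E => preHitSum S f (shiftPath 1 z)) 2 ℙ∞ :=
    hw2.comp_measurePreserving (measurePreserving_shiftPath π 1)
  have i1 : Integrable (fun z : ℕ → E => offInd S (z 0) * f (z 0) * b (shiftPath 1 z)) ℙ∞ := by
    refine (key (hfE.integrable_mul hbE)).congr (Eventually.of_forall fun z => ?_)
    simp only [Pi.mul_apply]; ring
  have i2 : Integrable (fun z : ℕ → E =>
      offInd S (z 0) * (preHitSum S f (shiftPath 1 z) * b (shiftPath 1 z))) ℙ∞ :=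
    key (hwE.integrable_mul hbE)
  have hrec := integral_congr_ae hae
  rw [integral_add i1 i2, integral_eval_mul_shiftPath (a := fun x => offInd S x * f x)
    (hoM.mul hf) hbm, integral_eval_mul_shiftPath (b := fun z => preHitSum S f z * b z) hoM
    (hwm.mul hbm), integral_offInd_mul hS, integral_offInd hS] at hrec
  rw [(integral_preHitSum hS hpos hf hf2).1, div_mul_eq_mul_div, eq_div_iff hp]
  linarith

end Moments

end MulticastAoI

namespace MulticastAoI

open Set

/-! ### Averages along the iterates of a measure preserving map -/

section Iterate

variable {Z : Type*} [MeasurableSpace Z] {P : Measure Z} {θ : Z → Z}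

theorem indepFun_comp_measurePreserving {Z' F G : Type*} [MeasurableSpace Z'] [MeasurableSpace F]
    [MeasurableSpace G] {Q : Measure Z'} {φ : Z' → Z} {f : Z → F} {g : Z → G}
    (hφ : MeasurePreserving φ Q P) (hf : Measurable f) (hg : Measurable g) (h : IndepFun f g P) :
    IndepFun (fun z => f (φ z)) (fun z => g (φ z)) Q := by
  rw [indepFun_iff_measure_inter_preimage_eq_mul] at h ⊢
  intro s t hs ht
  have e1 := hφ.measure_preimage (hf hs).nullMeasurableSet
  have e2 := hφ.measure_preimage (hg ht).nullMeasurableSet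
  have e3 := hφ.measure_preimage ((hf hs).inter (hg ht)).nullMeasurableSet
  exact e3.trans ((h s t hs ht).trans (by rw [← e1, ← e2]; rfl))

/-- If what is observed now is independent of the future, then its averages converge. -/
theorem tendsto_average_of_indepFun [IsProbabilityMeasure P] (hθ : MeasurePreserving θ P P)
    {V : Z → ℝ} (hV : Measurable V) (hint : Integrable V P) (hind : IndepFun V θ P) :
    ∀ᵐ z ∂P, Tendsto (fun m : ℕ => (∑ i ∈ Finset.range m, V (θ^[i] z)) / m) atTop
      (𝓝 (∫ z, V z ∂P)) := by
  have hit : ∀ i, MeasurePreserving θ^[i] P P := fun i => hθ.iterate i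
  -- Pairwise independence is all that the strong law used here requires. Pulling back along the
  -- measure preserving `θ^[i]` reduces to i = 0.
  have hlt : ∀ i j, i < j → IndepFun (fun z => V (θ^[i] z)) (fun z => V (θ^[j] z)) P := by
    intro i j hij
    obtain ⟨k, rfl⟩ := Nat.exists_eq_add_of_lt hij
    have h1 : IndepFun V (fun z => V (θ^[k] (θ z))) P :=
      hind.comp measurable_id (hV.comp (hit k).measurable)
    have h2 := indepFun_comp_measurePreserving (hit i) hV
      (hV.comp ((hit k).measurable.comp hθ.measurable)) h1
    have e : (fun z => V (θ^[i + k + 1] z)) = fun z => V (θ^[k] (θ (θ^[i] z))) := by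
      ext z
      rw [← Function.iterate_succ_apply, ← Function.iterate_add_apply]
      congr 2; omega
    rw [e]
    exact h2
  refine strong_law_ae_real (fun i z => V (θ^[i] z)) hint ?_ fun i => ?_
  · intro i j hij
    rcases lt_or_gt_of_ne hij with h | h
    · exact hlt i j h
    · exact (hlt j i h).symm
  · exact ⟨(hV.comp (hit i).measurable).aemeasurable, hV.aemeasurable, by
      have := Measure.map_map (μ := P) hV (hit i).measurable
      rw [(hit i).map_eq] at this
      exact this.symm⟩

omit [MeasurableSpace Z] in
theorem sum_range_iterate_two (V : Z → ℝ) (z : Z) (m : ℕ) :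
    ∑ i ∈ Finset.range m, V (θ^[i] z) =
      ∑ i ∈ Finset.range ((m + 1) / 2), V ((θ^[2])^[i] z) +
        ∑ i ∈ Finset.range (m / 2), V ((θ^[2])^[i] (θ z)) := by
  induction m with
  | zero => simp
  | succ m ih =>
    rw [Finset.sum_range_succ, ih]
    rcases Nat.even_or_odd' m with ⟨k, rfl | rfl⟩
    · rw [show (2 * k + 1 + 1) / 2 = k + 1 by omega, show (2 * k + 1) / 2 = k by omega,
        show 2 * k / 2 = k by omega, Finset.sum_range_succ _ k, ← Function.iterate_mul]
      ring
    · rw [show (2 * k + 1 + 1 + 1) / 2 = k + 1 by omega, show (2 * k + 1 + 1) / 2 = k + 1 by omega,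
        show (2 * k + 1) / 2 = k by omega,
        Finset.sum_range_succ (fun i => V ((θ^[2])^[i] (θ z))) k, ← Function.iterate_mul,
        Function.iterate_succ_apply]
      ring

theorem tendsto_div_two_div : Tendsto (fun m : ℕ => ((m / 2 : ℕ) : ℝ) / m) atTop (𝓝 (1 / 2)) := by
  have h := tendsto_nat_floor_mul_div_atTop (R := ℝ) (a := 1 / 2) (by norm_num)
  refine (h.comp tendsto_natCast_atTop_atTop).congr fun m => ?_
  simp only [Function.comp]
  congr 2
  rw [one_div_mul_eq_div, ← Nat.floor_div_eq_div (K := ℝ)]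
  norm_num

theorem tendsto_succ_div_two_div :
    Tendsto (fun m : ℕ => (((m + 1) / 2 : ℕ) : ℝ) / m) atTop (𝓝 (1 / 2)) := by
  have h1 : Tendsto (fun m : ℕ => (((m + 1) / 2 : ℕ) : ℝ) / (m + 1 : ℕ)) atTop (𝓝 (1 / 2)) :=
    tendsto_div_two_div.comp (tendsto_add_atTop_nat 1)
  have h2 : Tendsto (fun m : ℕ => 1 + 1 / (m : ℝ)) atTop (𝓝 (1 + 0)) :=
    tendsto_const_nhds.add tendsto_one_div_atTop_nhds_zero_nat
  have h3 := h1.mul h2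
  rw [add_zero, mul_one] at h3
  refine h3.congr' ?_
  filter_upwards [eventually_gt_atTop 0] with m hm
  have : (m : ℝ) ≠ 0 := by positivity
  have h' : (m : ℝ) + 1 ≠ 0 := by positivity
  push_cast
  field_simp

/-- Consecutive observations may be dependent. The even and the odd ones are orbits of θ² started at
z and at θ z; each average converges, and each carries half of the indices. -/
theorem tendsto_average_of_indepFun_two [IsProbabilityMeasure P] (hθ : MeasurePreserving θ P P)
    {V : Z → ℝ} (hV : Measurable V) (hint : Integrable V P) (hind : IndepFun V θ^[2] P) :
    ∀ᵐ z ∂P, Tendsto (fun m : ℕ => (∑ i ∈ Finset.range m, V (θ^[i] z)) / m) atTop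
      (𝓝 (∫ z, V z ∂P)) := by
  have h := tendsto_average_of_indepFun (hθ.iterate 2) hV hint hind
  filter_upwards [h, hθ.quasiMeasurePreserving.ae h] with z h1 h2
  have d1 : Tendsto (fun m : ℕ => (m + 1) / 2) atTop atTop :=
    tendsto_atTop_mono (fun m => Nat.div_le_div_right (Nat.le_succ m))
      (Nat.tendsto_div_const_atTop two_ne_zero)
  have d2 : Tendsto (fun m : ℕ => m / 2) atTop atTop := Nat.tendsto_div_const_atTop two_ne_zero
  have h3 := ((h1.comp d1).mul tendsto_succ_div_two_div).add
    ((h2.comp d2).mul tendsto_div_two_div)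
  rw [← mul_add, show (1 / 2 + 1 / 2 : ℝ) = 1 by norm_num, mul_one] at h3
  refine h3.congr' ?_
  filter_upwards [eventually_ge_atTop 2] with m hm
  rw [sum_range_iterate_two]
  have a1 : (((m + 1) / 2 : ℕ) : ℝ) ≠ 0 := by
    have : (m + 1) / 2 ≠ 0 := by omega
    exact_mod_cast this
  have a2 : ((m / 2 : ℕ) : ℝ) ≠ 0 := by
    have : m / 2 ≠ 0 := by omega
    exact_mod_cast this
  simp only [Function.comp]
  rw [div_mul_div_cancel₀ a1, div_mul_div_cancel₀ a2, add_div]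

/-- If a block is independent of the future, then so are two successive blocks. -/
theorem indepFun_two_blocks [IsProbabilityMeasure P] {F : Type*} [MeasurableSpace F]
    (hθ : MeasurePreserving θ P P) {b : Z → F} (hb : Measurable b) (hind : IndepFun b θ P) :
    IndepFun (fun z => (b z, b (θ z))) θ^[2] P := by
  have hm := hθ.measurable
  have h2 := (hθ.iterate 2).measurable
  have i1 : IndepFun b (fun z => (b (θ z), θ (θ z))) P :=
    hind.comp measurable_id (hb.prodMk hm)
  have i2 : IndepFun (fun z => b (θ z)) (fun z => θ (θ z)) P :=
    indepFun_comp_measurePreserving hθ hb hm hind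
  have i3 : IndepFun b (fun z => b (θ z)) P := hind.comp measurable_id hb
  have hbθ : Measurable fun z => b (θ z) := hb.comp hm
  have hθθ : Measurable fun z => θ (θ z) := hm.comp hm
  have e1 : P.map (fun z => (b z, (b (θ z), θ (θ z)))) =
      (P.map b).prod (P.map fun z => (b (θ z), θ (θ z))) :=
    (indepFun_iff_map_prod_eq_prod_map_map hb.aemeasurable (hbθ.prodMk hθθ).aemeasurable).1 i1
  have e2 : P.map (fun z => (b (θ z), θ (θ z))) =
      (P.map fun z => b (θ z)).prod (P.map fun z => θ (θ z)) :=
    (indepFun_iff_map_prod_eq_prod_map_map hbθ.aemeasurable hθθ.aemeasurable).1 i2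
  have e3 : P.map (fun z => (b z, b (θ z))) = (P.map b).prod (P.map fun z => b (θ z)) :=
    (indepFun_iff_map_prod_eq_prod_map_map hb.aemeasurable hbθ.aemeasurable).1 i3
  have p1 : IsProbabilityMeasure (P.map b) := Measure.isProbabilityMeasure_map hb.aemeasurable
  have p2 : IsProbabilityMeasure (P.map fun z => b (θ z)) :=
    Measure.isProbabilityMeasure_map hbθ.aemeasurable
  have p3 : IsProbabilityMeasure (P.map fun z => θ (θ z)) :=
    Measure.isProbabilityMeasure_map hθθ.aemeasurable
  refine (indepFun_iff_map_prod_eq_prod_map_map (hb.prodMk hbθ).aemeasurable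
    h2.aemeasurable).2 ?_
  -- The joint law of first block, second block and future is a triple product; only reassociation
  -- remains.
  have e4 : P.map (fun z => ((b z, b (θ z)), θ (θ z))) =
      (P.map (fun z => (b z, (b (θ z), θ (θ z))))).map MeasurableEquiv.prodAssoc.symm :=
    (Measure.map_map MeasurableEquiv.prodAssoc.symm.measurable
      (hb.prodMk (hbθ.prodMk hθθ))).symm
  refine e4.trans ?_
  rw [e1, e2, e3]
  exact ((measurePreserving_prodAssoc (P.map b) (P.map fun z => b (θ z))
    (P.map fun z => θ (θ z))).symm MeasurableEquiv.prodAssoc).map_eq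

end Iterate

end MulticastAoI

namespace MulticastAoI

open Set

/-! ### Successive visits of a path to a set -/

section HitIdx

variable {E : Type*} {S : Set E}

/-- The time of the `q`-th visit of the path `z` to `S`. -/
noncomputable def hitIdx (S : Set E) (z : ℕ → E) (q : ℕ) : ℕ := Nat.nth (fun j => z j ∈ S) q

theorem hitIdx_zero (z : ℕ → E) : hitIdx S z 0 = firstHit S z := Nat.nth_zero

theorem infinite_afterHit {z : ℕ → E} (hz : {j | z j ∈ S}.Infinite) :
    {j | afterHit S z j ∈ S}.Infinite := by
  rw [← Nat.frequently_atTop_iff_infinite, frequently_atTop] at hz ⊢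
  intro a
  obtain ⟨b, hb, h⟩ := hz (a + (firstHit S z + 1))
  refine ⟨b - (firstHit S z + 1), by omega, ?_⟩
  rw [afterHit, shiftPath, Nat.sub_add_cancel (by omega)]
  exact h

theorem count_firstHit_succ {z : ℕ → E} [DecidablePred fun j => z j ∈ S] (hz : ∃ j, z j ∈ S) :
    Nat.count (fun j => z j ∈ S) (firstHit S z + 1) = 1 := by
  have h := mem_hitAt_firstHit hz
  rw [Nat.count_succ, if_pos h.1, Nat.count_iff_forall_not.2 fun i hi => h.2 i hi]

/-- Exactly one visit occurs up to and including the first, so visit q of the remaining path is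
visit q + 1 of the whole. The proof counts visits and inverts with `Nat.nth_count`. -/
theorem hitIdx_succ {z : ℕ → E} (hz : {j | z j ∈ S}.Infinite) (q : ℕ) :
    hitIdx S z (q + 1) = firstHit S z + 1 + hitIdx S (afterHit S z) q := by
  classical
  have hz' := infinite_afterHit hz
  set a := hitIdx S (afterHit S z) q with ha
  have h1 : afterHit S z a ∈ S := Nat.nth_mem_of_infinite hz' q
  have h2 : z (firstHit S z + 1 + a) ∈ S := by rw [add_comm]; exact h1
  have h3 : Nat.count (fun j => z j ∈ S) (firstHit S z + 1 + a) = q + 1 := by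
    rw [Nat.count_add, count_firstHit_succ (S := S) (z := z) hz.nonempty, add_comm]
    congr 1
    have h4 := Nat.count_nth_of_infinite hz' q
    have e : (fun k => z (firstHit S z + 1 + k) ∈ S) = fun k => afterHit S z k ∈ S := by
      ext k; rw [afterHit, shiftPath, add_comm]
    simp only [e]
    exact h4
  rw [hitIdx, ← h3]
  exact Nat.nth_count (p := fun j => z j ∈ S) h2

theorem hitTerm_iterate_afterHit (q : ℕ) : ∀ {z : ℕ → E}, {j | z j ∈ S}.Infinite →
    hitTerm S ((afterHit S)^[q] z) = z (hitIdx S z q) := by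
  induction q with
  | zero => intro z _; rw [hitIdx_zero]; rfl
  | succ q ih =>
    intro z hz
    rw [Function.iterate_succ_apply, ih (infinite_afterHit hz), hitIdx_succ hz, afterHit,
      shiftPath, add_comm]

theorem hitIdx_succ_eq_add (q : ℕ) : ∀ {z : ℕ → E}, {j | z j ∈ S}.Infinite →
    hitIdx S z (q + 1) = hitIdx S z q + 1 + firstHit S ((afterHit S)^[q + 1] z) := by
  induction q with
  | zero => intro z hz; rw [hitIdx_succ hz, hitIdx_zero, hitIdx_zero]; rfl
  | succ q ih =>
    intro z hz
    rw [hitIdx_succ hz, ih (infinite_afterHit hz), hitIdx_succ hz, ← Function.iterate_succ_apply]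
    rw [Nat.succ_eq_add_one]
    omega

theorem iterate_afterHit_apply (q : ℕ) : ∀ {z : ℕ → E}, {j | z j ∈ S}.Infinite →
    ∀ i, (afterHit S)^[q + 1] z i = z (hitIdx S z q + 1 + i) := by
  induction q with
  | zero => intro z hz i; rw [hitIdx_zero, add_comm _ i]; rfl
  | succ q ih =>
    intro z hz i
    rw [Function.iterate_succ_apply, ih (infinite_afterHit hz), hitIdx_succ hz, afterHit,
      shiftPath]
    congr 1; omega

/-- The sum over the terms between two successive visits. -/
theorem sum_Ioo_hitIdx (f : E → ℝ) {z : ℕ → E} (hz : {j | z j ∈ S}.Infinite) (q : ℕ) :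
    ∑ i ∈ Finset.Ioo (hitIdx S z q) (hitIdx S z (q + 1)), f (z i) =
      preHitSum S f ((afterHit S)^[q + 1] z) := by
  rw [hitIdx_succ_eq_add q hz, preHitSum]
  simp only [iterate_afterHit_apply q hz]
  rw [← Order.succ_eq_add_one, ← Finset.Ico_succ_left_eq_Ioo, Finset.sum_Ico_eq_sum_range]
  simp only [Order.succ_eq_add_one, Nat.add_sub_cancel_left]

end HitIdx

section HitIdxMeasure

variable {E : Type*} [MeasurableSpace E] {S : Set E} {π : Measure E} [IsProbabilityMeasure π]

/-- Each shifted path has the original law, so almost surely all countably many shifts meet S. -/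
theorem ae_infinite_mem (hS : MeasurableSet S) (hpos : π S ≠ 0) :
    ∀ᵐ z ∂Measure.infinitePi (fun _ : ℕ => π), {j | z j ∈ S}.Infinite := by
  have h : ∀ k : ℕ, ∀ᵐ z ∂Measure.infinitePi (fun _ : ℕ => π), ∃ j, shiftPath k z j ∈ S :=
    fun k => (measurePreserving_shiftPath π k).quasiMeasurePreserving.ae (ae_exists_mem hS hpos)
  filter_upwards [ae_all_iff.2 h] with z hz
  rw [← Nat.frequently_atTop_iff_infinite, frequently_atTop]
  intro a
  obtain ⟨j, hj⟩ := hz a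
  exact ⟨j + a, Nat.le_add_left a j, hj⟩

end HitIdxMeasure

end MulticastAoI

namespace MulticastAoI

open Set

/-! ### Time averages of functions described on successive intervals -/

section Averages

/-- The terms of a sequence with convergent averages are negligible. -/
theorem tendsto_div_of_tendsto_average {x : ℕ → ℝ} {l : ℝ}
    (h : Tendsto (fun m : ℕ => (∑ i ∈ Finset.range m, x i) / m) atTop (𝓝 l)) :
    Tendsto (fun m : ℕ => x m / m) atTop (𝓝 0) := by
  have h1 : Tendsto (fun m : ℕ => (∑ i ∈ Finset.range (m + 1), x i) / (m + 1 : ℕ)) atTop (𝓝 l) :=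
    h.comp (tendsto_add_atTop_nat 1)
  have h2 : Tendsto (fun m : ℕ => 1 + 1 / (m : ℝ)) atTop (𝓝 (1 + 0)) :=
    tendsto_const_nhds.add tendsto_one_div_atTop_nhds_zero_nat
  have h3 := (h1.mul h2).sub h
  rw [add_zero, mul_one, sub_self] at h3
  refine h3.congr' ?_
  filter_upwards [eventually_gt_atTop 0] with m hm
  have : (m : ℝ) ≠ 0 := by positivity
  have h' : (m : ℝ) + 1 ≠ 0 := by positivity
  rw [Finset.sum_range_succ]
  push_cast
  field_simp
  ring

theorem tendsto_succ_div_self : Tendsto (fun m : ℕ => ((m + 1 : ℕ) : ℝ) / m) atTop (𝓝 1) := by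
  have h2 : Tendsto (fun m : ℕ => 1 + 1 / (m : ℝ)) atTop (𝓝 (1 + 0)) :=
    tendsto_const_nhds.add tendsto_one_div_atTop_nhds_zero_nat
  rw [add_zero] at h2
  refine h2.congr' ?_
  filter_upwards [eventually_gt_atTop 0] with m hm
  have : (m : ℝ) ≠ 0 := by positivity
  push_cast
  field_simp

/-- The long-run average of a nonnegative function from its integrals up to the times `r q`. -/
theorem tendsto_timeAverage {f : ℝ → ℝ} {r : ℕ → ℝ} {a b : ℝ} (hr : StrictMono r)
    (hr0 : 0 ≤ r 0) (hf : ∀ t, 0 ≤ t → 0 ≤ f t)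
    (hint : ∀ q, IntervalIntegrable f volume 0 (r q)) (hb : 0 < b)
    (hrb : Tendsto (fun q : ℕ => r q / q) atTop (𝓝 b))
    (hIa : Tendsto (fun q : ℕ => (∫ t in (0 : ℝ)..r q, f t) / q) atTop (𝓝 a)) :
    Tendsto (fun τ : ℝ => (1 / τ) * ∫ t in (0 : ℝ)..τ, f t) atTop (𝓝 (a / b)) := by
  have hrtop : Tendsto r atTop atTop := by
    refine (hrb.pos_mul_atTop hb tendsto_natCast_atTop_atTop).congr' ?_
    filter_upwards [eventually_gt_atTop 0] with m hm
    have : (m : ℝ) ≠ 0 := by positivity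
    field_simp
  have hex : ∀ τ, r 0 ≤ τ → ∃ q, r q ≤ τ ∧ τ < r (q + 1) := by
    classical
    intro τ hτ
    have hh : ∃ q, τ < r q := (hrtop.eventually_gt_atTop τ).exists
    have h0 : Nat.find hh ≠ 0 := fun h => absurd (h ▸ Nat.find_spec hh) (not_lt.2 hτ)
    obtain ⟨q, hq⟩ := Nat.exists_eq_succ_of_ne_zero h0
    refine ⟨q, not_lt.1 (Nat.find_min hh (by omega)), ?_⟩
    have := Nat.find_spec hh
    rwa [hq] at this
  choose! Q hQ using hex
  have hQtop : Tendsto Q atTop atTop := by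
    refine tendsto_atTop.2 fun m => ?_
    filter_upwards [eventually_ge_atTop (r m), eventually_ge_atTop (r 0)] with τ h1 h2
    exact Nat.lt_succ_iff.1 (hr.lt_iff_lt.1 (h1.trans_lt (hQ τ h2).2))
  have hpos : ∀ q, 0 < r (q + 1) := fun q => hr0.trans_lt (hr (Nat.succ_pos q))
  have hnn : ∀ q, 0 ≤ r q := fun q => hr0.trans (hr.monotone (Nat.zero_le q))
  -- For r q ≤ τ < r (q + 1), nonnegativity of f traps the average between this quotient and the one
  -- in `hhigh`; both have the limit a / b.
  have hlow : Tendsto (fun q : ℕ => (∫ t in (0 : ℝ)..r q, f t) / r (q + 1)) atTop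
      (𝓝 (a / b)) := by
    have h1 : Tendsto (fun q : ℕ => r (q + 1) / (q + 1 : ℕ)) atTop (𝓝 b) :=
      hrb.comp (tendsto_add_atTop_nat 1)
    have h2 := hIa.div (h1.mul tendsto_succ_div_self) (by simpa using hb.ne')
    rw [mul_one] at h2
    refine h2.congr' ?_
    filter_upwards [eventually_gt_atTop 0] with m hm
    have h3 : (m : ℝ) ≠ 0 := by positivity
    have h4 : ((m + 1 : ℕ) : ℝ) ≠ 0 := by positivity
    simp only [Pi.div_apply]
    rw [div_mul_div_cancel₀ h4, div_div_div_cancel_right₀ h3]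
  have hhigh : Tendsto (fun q : ℕ => (∫ t in (0 : ℝ)..r (q + 1), f t) / r q) atTop
      (𝓝 (a / b)) := by
    have h1 : Tendsto (fun q : ℕ => (∫ t in (0 : ℝ)..r (q + 1), f t) / (q + 1 : ℕ)) atTop (𝓝 a) :=
      hIa.comp (tendsto_add_atTop_nat 1)
    have h2 := (h1.mul tendsto_succ_div_self).div hrb hb.ne'
    rw [mul_one] at h2
    refine h2.congr' ?_
    filter_upwards [eventually_gt_atTop 0] with m hm
    have h3 : (m : ℝ) ≠ 0 := by positivity
    have h4 : ((m + 1 : ℕ) : ℝ) ≠ 0 := by positivity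
    simp only [Pi.div_apply]
    rw [div_mul_div_cancel₀ h4, div_div_div_cancel_right₀ h3]
  have hle : ∀ {x y : ℝ} {q : ℕ}, 0 ≤ x → x ≤ y → y ≤ r q →
      ∫ t in (0 : ℝ)..x, f t ≤ ∫ t in (0 : ℝ)..y, f t := by
    intro x y q hx hxy hy
    have hsub : IntervalIntegrable f volume 0 y := (hint q).mono_set (by
      rw [uIcc_of_le (hx.trans hxy), uIcc_of_le (hnn q)]
      exact Icc_subset_Icc le_rfl hy)
    refine intervalIntegral.integral_mono_interval le_rfl hx hxy ?_ hsub
    filter_upwards [ae_restrict_mem measurableSet_Ioc] with t ht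
    exact hf t ht.1.le
  have hI0 : ∀ {x : ℝ}, 0 ≤ x → 0 ≤ ∫ t in (0 : ℝ)..x, f t := fun hx =>
    intervalIntegral.integral_nonneg hx fun t ht => hf t ht.1
  refine tendsto_of_tendsto_of_tendsto_of_le_of_le' (hlow.comp hQtop) (hhigh.comp hQtop) ?_ ?_
  · filter_upwards [eventually_ge_atTop (r 0), eventually_gt_atTop 0] with τ h1 h2
    simp only [Function.comp, one_div_mul_eq_div]
    obtain ⟨h3, h4⟩ := hQ τ h1
    exact div_le_div₀ (hI0 h2.le) (hle (hnn _) h3 h4.le) h2 h4.le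
  -- The upper bound divides by r (Q τ), and r 0 may be 0; hence the restriction to Q τ ≥ 1.
  · filter_upwards [eventually_ge_atTop (r 0), eventually_gt_atTop 0,
      hQtop.eventually_ge_atTop 1] with τ h1 h2 h5
    simp only [Function.comp, one_div_mul_eq_div]
    obtain ⟨h3, h4⟩ := hQ τ h1
    obtain ⟨m, hm⟩ := Nat.exists_eq_add_of_le' h5
    refine div_le_div₀ (hI0 (hnn _)) (hle h2.le h4.le le_rfl) ?_ h3
    rw [hm]; exact hpos m

end Averages

/-! ### The age of information along one path -/

section Path

variable {N : ℕ} {K : ℕ} {T : ℕ → Fin N → ℝ} {D : ℕ → ℝ} {n : Fin N} {u₀ : ℝ}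

/-- Time at which device `n` receives its `q`-th update. -/
noncomputable def recTime (K : ℕ) (T : ℕ → Fin N → ℝ) (D : ℕ → ℝ) (n : Fin N) (q : ℕ) : ℝ :=
  genTime K T D (succIdx K T D n q) + succService K T D n q

/-- Generation time of the `q`-th update that device `n` receives. -/
noncomputable def succGen (K : ℕ) (T : ℕ → Fin N → ℝ) (D : ℕ → ℝ) (n : Fin N) (q : ℕ) : ℝ :=
  genTime K T D (succIdx K T D n q)

/-- Time between the generations of two successive updates that device `n` receives. -/
noncomputable def succGap (K : ℕ) (T : ℕ → Fin N → ℝ) (D : ℕ → ℝ) (n : Fin N) (q : ℕ) : ℝ :=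
  duration K (T (succIdx K T D n q)) (D (succIdx K T D n q)) + failTime K T D n q

/-- The paths for which the terms attached to the receptions of device `n` make sense. -/
structure RegularPath (K : ℕ) (T : ℕ → Fin N → ℝ) (D : ℕ → ℝ) (n : Fin N) : Prop where
  service_pos : ∀ j, 0 < T j n
  duration_pos : ∀ j, 0 < duration K (T j) (D j)
  infinite : {j | Received K (T j) (D j) n}.Infinite

theorem genTime_succ (j : ℕ) :
    genTime K T D (j + 1) = genTime K T D j + duration K (T j) (D j) :=
  Finset.sum_range_succ _ _

namespace RegularPath

variable (hR : RegularPath K T D n)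
include hR

theorem received_succIdx (q : ℕ) :
    Received K (T (succIdx K T D n q)) (D (succIdx K T D n q)) n :=
  Nat.nth_mem_of_infinite hR.infinite q

theorem exists_succIdx_eq {j : ℕ} (hj : Received K (T j) (D j) n) :
    ∃ q, succIdx K T D n q = j := by
  have h := Nat.range_nth_of_infinite hR.infinite
  exact h.symm.subset hj

theorem strictMono_succIdx : StrictMono (succIdx K T D n) := Nat.nth_strictMono hR.infinite

theorem strictMono_genTime : StrictMono (genTime K T D) :=
  strictMono_nat_of_lt_succ fun j => by
    rw [genTime_succ]; exact lt_add_of_pos_right _ (hR.duration_pos j)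

theorem strictMono_succGen : StrictMono (succGen K T D n) :=
  hR.strictMono_genTime.comp hR.strictMono_succIdx

theorem succGen_nonneg (q : ℕ) : 0 ≤ succGen K T D n q := by
  rw [succGen, genTime]
  exact Finset.sum_nonneg fun i _ => (hR.duration_pos i).le

theorem succService_pos (q : ℕ) : 0 < succService K T D n q := hR.service_pos _

theorem succGen_lt_recTime (q : ℕ) : succGen K T D n q < recTime K T D n q :=
  lt_add_of_pos_right _ (hR.succService_pos q)

/-- A received update arrives before it is terminated, hence before any later one is generated. So
receptions occur in the order of generation. -/
theorem recTime_le_succGen (q : ℕ) : recTime K T D n q ≤ succGen K T D n (q + 1) := by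
  calc recTime K T D n q ≤ genTime K T D (succIdx K T D n q + 1) := by
        rw [genTime_succ]
        exact add_le_add_right (hR.received_succIdx q) _
    _ ≤ _ := hR.strictMono_genTime.monotone (hR.strictMono_succIdx (Nat.lt_succ_self q))

theorem strictMono_recTime : StrictMono (recTime K T D n) :=
  strictMono_nat_of_lt_succ fun q =>
    (hR.recTime_le_succGen q).trans_lt (hR.succGen_lt_recTime (q + 1))

theorem recTime_pos (q : ℕ) : 0 < recTime K T D n q :=
  (hR.succGen_nonneg q).trans_lt (hR.succGen_lt_recTime q)

theorem succGen_succ (q : ℕ) :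
    succGen K T D n (q + 1) = succGen K T D n q + succGap K T D n q := by
  have h := hR.strictMono_succIdx (Nat.lt_succ_self q)
  rw [succGen, genTime, ← Finset.sum_range_add_sum_Ico _ h.le, ← Finset.Ioo_insert_left h,
    Finset.sum_insert (by simp)]
  rfl

theorem failTime_nonneg (q : ℕ) : 0 ≤ failTime K T D n q :=
  Finset.sum_nonneg fun i _ => (hR.duration_pos i).le

theorem succService_le_succGap (q : ℕ) : succService K T D n q ≤ succGap K T D n q :=
  (hR.received_succIdx q).trans (le_add_of_nonneg_right (hR.failTime_nonneg q))

/-- Between receptions q and q + 1 the updates held are those of index at most q, and generation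
times increase with the index. The initial value remains in the set but is dominated, as u₀ ≤ 0. -/
theorem latestGen_eq (hu : u₀ ≤ 0) {q : ℕ} {t : ℝ} (h1 : recTime K T D n q ≤ t)
    (h2 : t < recTime K T D n (q + 1)) : latestGen K T D n u₀ t = succGen K T D n q := by
  refine IsGreatest.csSup_eq ⟨Or.inr ⟨succIdx K T D n q, hR.received_succIdx q, h1, rfl⟩, ?_⟩
  rintro s (rfl | ⟨j, hj, hjt, rfl⟩)
  · exact hu.trans (hR.succGen_nonneg q)
  · obtain ⟨i, rfl⟩ := hR.exists_succIdx_eq hj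
    have h3 : recTime K T D n i < recTime K T D n (q + 1) := lt_of_le_of_lt hjt h2
    exact hR.strictMono_succGen.monotone
      (Nat.lt_succ_iff.1 (hR.strictMono_recTime.lt_iff_lt.1 h3))

theorem latestGen_eq_of_lt {t : ℝ} (h : t < recTime K T D n 0) :
    latestGen K T D n u₀ t = u₀ := by
  refine IsGreatest.csSup_eq ⟨Or.inl rfl, ?_⟩
  rintro s (rfl | ⟨j, hj, hjt, rfl⟩)
  · exact le_rfl
  · obtain ⟨i, rfl⟩ := hR.exists_succIdx_eq hj
    have h3 : recTime K T D n i < recTime K T D n 0 := lt_of_le_of_lt hjt h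
    exact absurd (hR.strictMono_recTime.lt_iff_lt.1 h3) (Nat.not_lt_zero i)

/-- Just before reception q + 1 the age is still measured from update q. Peak 0 is excluded because
it depends on u₀. -/
theorem peakAge_succ (hu : u₀ ≤ 0) (q : ℕ) :
    peakAge K T D n u₀ (q + 1) = succGap K T D n q + succService K T D n (q + 1) := by
  have e : succGap K T D n q + succService K T D n (q + 1) =
      recTime K T D n (q + 1) - succGen K T D n q := by
    have h := hR.succGen_succ q
    rw [recTime, ← succGen, h]; ring
  rw [e]
  refine leftLim_eq_of_tendsto ?_
  have h : Tendsto (fun t : ℝ => t - succGen K T D n q) (𝓝[<] recTime K T D n (q + 1))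
      (𝓝 (recTime K T D n (q + 1) - succGen K T D n q)) :=
    ((continuous_id.sub continuous_const).tendsto _).mono_left nhdsWithin_le_nhds
  refine h.congr' ?_
  filter_upwards [self_mem_nhdsWithin, mem_nhdsWithin_of_mem_nhds
    (Ioi_mem_nhds (hR.strictMono_recTime (Nat.lt_succ_self q)))] with t ht ht'
  rw [age, hR.latestGen_eq hu (le_of_lt ht') ht]

theorem age_nonneg (hu : u₀ ≤ 0) {t : ℝ} (ht : 0 ≤ t) : 0 ≤ age K T D n u₀ t := by
  refine sub_nonneg.2 (Real.sSup_le ?_ ht)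
  rintro s (rfl | ⟨j, hj, hjt, rfl⟩)
  · exact hu.trans ht
  · exact (le_add_of_nonneg_right (hR.service_pos j).le).trans hjt

theorem age_eqOn_zero :
    EqOn (fun t => t - u₀) (age K T D n u₀) (uIoo 0 (recTime K T D n 0)) := fun t ht => by
  rw [uIoo_of_le (hR.recTime_pos 0).le] at ht
  rw [age, hR.latestGen_eq_of_lt ht.2]

theorem age_eqOn (hu : u₀ ≤ 0) (q : ℕ) :
    EqOn (fun t => t - succGen K T D n q) (age K T D n u₀)
      (uIoo (recTime K T D n q) (recTime K T D n (q + 1))) := fun t ht => by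
  rw [uIoo_of_le (hR.strictMono_recTime (Nat.lt_succ_self q)).le] at ht
  rw [age, hR.latestGen_eq hu ht.1.le ht.2]

theorem intervalIntegrable_age_step (hu : u₀ ≤ 0) (q : ℕ) :
    IntervalIntegrable (age K T D n u₀) volume (recTime K T D n q) (recTime K T D n (q + 1)) :=
  (Continuous.intervalIntegrable (by fun_prop) _ _).congr_uIoo (hR.age_eqOn hu q)

theorem intervalIntegrable_age_zero :
    IntervalIntegrable (age K T D n u₀) volume 0 (recTime K T D n 0) :=
  (Continuous.intervalIntegrable (by fun_prop) _ _).congr_uIoo hR.age_eqOn_zero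

theorem intervalIntegrable_age (hu : u₀ ≤ 0) (q : ℕ) :
    IntervalIntegrable (age K T D n u₀) volume 0 (recTime K T D n q) := by
  induction q with
  | zero => exact hR.intervalIntegrable_age_zero
  | succ q ih => exact ih.trans (hR.intervalIntegrable_age_step hu q)

/-- The area of a trapezoid, arranged so that the last term telescopes over successive receptions.
-/
theorem integral_age_step (hu : u₀ ≤ 0) (q : ℕ) :
    ∫ t in recTime K T D n q..recTime K T D n (q + 1), age K T D n u₀ t =
      succGap K T D n q ^ 2 / 2 + succGap K T D n q * succService K T D n (q + 1) +
        (succService K T D n (q + 1) ^ 2 - succService K T D n q ^ 2) / 2 := by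
  rw [← intervalIntegral.integral_congr_uIoo (hR.age_eqOn hu q),
    intervalIntegral.integral_sub (Continuous.intervalIntegrable (by fun_prop) _ _)
      (Continuous.intervalIntegrable (by fun_prop) _ _), integral_id,
    intervalIntegral.integral_const, smul_eq_mul]
  have h := hR.succGen_succ q
  rw [recTime, recTime, ← succGen, ← succGen, h]
  ring

theorem integral_age (hu : u₀ ≤ 0) (q : ℕ) :
    ∫ t in (0 : ℝ)..recTime K T D n q, age K T D n u₀ t =
      (∫ t in (0 : ℝ)..recTime K T D n 0, age K T D n u₀ t) +
      (∑ i ∈ Finset.range q, succGap K T D n i ^ 2) / 2 +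
      (∑ i ∈ Finset.range q, succGap K T D n i * succService K T D n (i + 1)) +
        (succService K T D n q ^ 2 - succService K T D n 0 ^ 2) / 2 := by
  induction q with
  | zero => simp
  | succ q ih =>
    rw [← intervalIntegral.integral_add_adjacent_intervals (hR.intervalIntegrable_age hu q)
      (hR.intervalIntegrable_age_step hu q), ih, hR.integral_age_step hu q,
      Finset.sum_range_succ, Finset.sum_range_succ]
    ring

theorem succGen_eq_sum (q : ℕ) :
    succGen K T D n q = succGen K T D n 0 + ∑ i ∈ Finset.range q, succGap K T D n i := by
  induction q with
  | zero => simp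
  | succ q ih => rw [hR.succGen_succ, ih, Finset.sum_range_succ, add_assoc]

theorem tendsto_age (hu : u₀ ≤ 0) {m₁ m₂ m₃ : ℝ} (hpos : 0 < m₁)
    (h1 : Tendsto (fun q : ℕ => (∑ i ∈ Finset.range q, succGap K T D n i) / q) atTop (𝓝 m₁))
    (h2 : Tendsto (fun q : ℕ => (∑ i ∈ Finset.range q, succGap K T D n i ^ 2) / q) atTop
      (𝓝 m₂))
    (h3 : Tendsto (fun q : ℕ => (∑ i ∈ Finset.range q,
      succGap K T D n i * succService K T D n (i + 1)) / q) atTop (𝓝 m₃)) :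
    Tendsto (fun τ : ℝ => (1 / τ) * ∫ t in (0 : ℝ)..τ, age K T D n u₀ t) atTop
      (𝓝 ((m₂ / 2 + m₃) / m₁)) := by
  have hc : ∀ C : ℝ, Tendsto (fun q : ℕ => C / q) atTop (𝓝 0) :=
    tendsto_const_div_atTop_nhds_zero_nat
  -- The boundary terms vanish without a separate law of large numbers: service times are dominated
  -- by gaps, whose averages converge.
  have hT1 : Tendsto (fun q : ℕ => succService K T D n q / q) atTop (𝓝 0) :=
    squeeze_zero (fun q => div_nonneg (hR.succService_pos q).le (Nat.cast_nonneg q))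
      (fun q => div_le_div_of_nonneg_right (hR.succService_le_succGap q) (Nat.cast_nonneg q))
      (tendsto_div_of_tendsto_average h1)
  have hT2 : Tendsto (fun q : ℕ => succService K T D n q ^ 2 / q) atTop (𝓝 0) :=
    squeeze_zero (fun q => div_nonneg (sq_nonneg _) (Nat.cast_nonneg q))
      (fun q => div_le_div_of_nonneg_right (pow_le_pow_left₀ (hR.succService_pos q).le
        (hR.succService_le_succGap q) 2) (Nat.cast_nonneg q))
      (tendsto_div_of_tendsto_average h2)
  refine tendsto_timeAverage hR.strictMono_recTime (hR.recTime_pos 0).le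
    (fun t ht => hR.age_nonneg hu ht) (fun q => hR.intervalIntegrable_age hu q) hpos ?_ ?_
  · have h := ((hc (succGen K T D n 0)).add h1).add hT1
    rw [zero_add, add_zero] at h
    refine h.congr fun q => ?_
    rw [recTime, ← succGen, hR.succGen_eq_sum q]
    ring
  · have h := (((hc (∫ t in (0 : ℝ)..recTime K T D n 0, age K T D n u₀ t)).add
      (h2.div_const 2)).add h3).add ((hT2.sub (hc (succService K T D n 0 ^ 2))).div_const 2)
    rw [zero_add, sub_zero, zero_div, add_zero] at h
    refine h.congr fun q => ?_
    rw [hR.integral_age hu q]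
    ring

theorem tendsto_peakAge (hu : u₀ ≤ 0) {m : ℝ}
    (h : Tendsto (fun q : ℕ => (∑ i ∈ Finset.range q,
      (succGap K T D n i + succService K T D n (i + 1))) / q) atTop (𝓝 m)) :
    Tendsto (fun Q : ℕ => (1 / (Q : ℝ)) * ∑ q ∈ Finset.range Q, peakAge K T D n u₀ q) atTop
      (𝓝 m) := by
  have h0 : Tendsto (fun q : ℕ => peakAge K T D n u₀ 0 / (q + 1 : ℕ)) atTop (𝓝 0) :=
    (tendsto_const_div_atTop_nhds_zero_nat _).comp (tendsto_add_atTop_nat 1)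
  have h1 := h0.add (h.div tendsto_succ_div_self one_ne_zero)
  rw [zero_add, div_one] at h1
  rw [← tendsto_add_atTop_iff_nat 1]
  refine h1.congr' ?_
  filter_upwards [eventually_gt_atTop 0] with q hq
  have hq0 : (q : ℝ) ≠ 0 := by positivity
  simp only [Pi.div_apply]
  rw [Finset.sum_range_succ' (fun q => peakAge K T D n u₀ q), div_div_div_cancel_right₀ hq0]
  simp only [hR.peakAge_succ hu]
  ring

end RegularPath

end Path

end MulticastAoI

namespace MulticastAoI

open Set

/-! ### The cycles between two receptions -/

/-- Device `n` receives the update. -/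
def Params.recSet (p : Params) (n : Fin p.N) : Set p.Update := evS p.K p.svc p.dl n 0

/-- Time from generation to termination of the update. -/
noncomputable def Params.dur (p : Params) (e : p.Update) : ℝ := duration p.K e.1 e.2

/-- Time between the generations of the first two updates that device `n` receives. -/
noncomputable def Params.gap (p : Params) (n : Fin p.N) (z : ℕ → p.Update) : ℝ :=
  p.dur (hitTerm (p.recSet n) z) +
    preHitSum (p.recSet n) p.dur (afterHit (p.recSet n) z)

/-- Service time of the first update that device `n` receives. -/
noncomputable def Params.srv (p : Params) (n : Fin p.N) (z : ℕ → p.Update) : ℝ :=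
  (hitTerm (p.recSet n) z).1 n

section Cycles

variable {p : Params} (hp : p.Valid) (n : Fin p.N)

include hp

theorem Params.Valid.isProbabilityMeasure_pathLaw : IsProbabilityMeasure p.pathLaw := by
  have := hp.isProbabilityMeasure_updateLaw
  unfold Params.pathLaw
  infer_instance

theorem Params.Valid.measurableSet_recSet : MeasurableSet (p.recSet n) :=
  hp.measurableSet_evS n 0

theorem Params.Valid.real_recSet : p.updateLaw.real (p.recSet n) = p.probS := hp.real_evS n 0

theorem Params.Valid.recSet_ne_zero : p.updateLaw (p.recSet n) ≠ 0 := fun h => by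
  have := hp.real_recSet n
  rw [measureReal_def, h, ENNReal.toReal_zero] at this
  exact hp.probS_pos.ne this

theorem Params.Valid.measurable_dur : Measurable p.dur := hp.measurable_duration

theorem Params.Valid.memLp_dur : MemLp p.dur 2 p.updateLaw := by
  rw [memLp_two_iff_integrable_sq hp.measurable_dur.aestronglyMeasurable]
  simpa [Params.dur] using hp.integrable_quadratic_duration (le_refl 0) (le_refl 0) zero_le_one

theorem Params.Valid.measurePreserving_afterHit :
    MeasurePreserving (afterHit (p.recSet n)) p.pathLaw p.pathLaw := by
  have := hp.isProbabilityMeasure_updateLaw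
  exact MulticastAoI.measurePreserving_afterHit (hp.measurableSet_recSet n) (hp.recSet_ne_zero n)

theorem Params.Valid.measurePreserving_hitTerm :
    MeasurePreserving (hitTerm (p.recSet n)) p.pathLaw (cond p.updateLaw (p.recSet n)) := by
  have := hp.isProbabilityMeasure_updateLaw
  exact map_hitTerm (hp.measurableSet_recSet n) (hp.recSet_ne_zero n)

theorem Params.Valid.integral_compl_recSet {f : p.Update → ℝ} {m : ℝ}
    (hf : Integrable f p.updateLaw)
    (h : HasMean (cond p.updateLaw (evF p.K p.svc p.dl n 0)) f m) :
    ∫ e in (p.recSet n)ᶜ, f e ∂p.updateLaw = (1 - p.probS) * m := by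
  have := hp.isProbabilityMeasure_updateLaw
  have h1 := h.2
  rw [(HasMean.of_cond hf).2, hp.real_evF n 0, div_eq_iff hp.one_sub_probS_pos.ne',
    p.evF_eq_compl] at h1
  rw [mul_comm, ← h1]
  rfl

/-- The recursion gives moments in terms of integrals over failures, which are 1 - P(C_S) times the
conditional moments; the rest is algebra. -/
theorem Params.Valid.hasMean_preHitSum_dur :
    HasMean p.pathLaw (preHitSum (p.recSet n) p.dur) p.meanW ∧
    HasMean p.pathLaw (fun z => preHitSum (p.recSet n) p.dur z ^ 2) p.sqW := by
  have := hp.isProbabilityMeasure_updateLaw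
  have hprob := hp.isProbabilityMeasure_pathLaw
  have hS := hp.measurableSet_recSet n
  have h0 := hp.recSet_ne_zero n
  have hw2 : MemLp (preHitSum (p.recSet n) p.dur) 2 p.pathLaw :=
    memLp_preHitSum hS h0 hp.measurable_dur hp.memLp_dur
  obtain ⟨h1, h2⟩ := integral_preHitSum hS h0 hp.measurable_dur hp.memLp_dur
  obtain ⟨-, -, -, -, -, -, -, -, -, -, hF, -⟩ :=
    hp.oneUpdate (T := p.svc) (D := p.dl) n 0 (MeasurePreserving.id p.updateLaw)
  have i1 := hp.integral_compl_recSet n (hp.memLp_dur.integrable one_le_two) hF.1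
  have i2 := hp.integral_compl_recSet n hp.memLp_dur.integrable_sq hF.2
  have hpos := hp.probS_pos.ne'
  rw [i1, hp.real_recSet] at h1
  have e1 : (1 - p.probS) * p.meanXF / p.probS = p.meanW := by
    rw [Params.meanW, Params.meanM]; field_simp
  rw [e1] at h1
  rw [i1, i2, h1, hp.real_recSet] at h2
  refine ⟨⟨hw2.integrable one_le_two, h1⟩, ⟨hw2.integrable_sq, h2.trans ?_⟩⟩
  rw [Params.sqW, Params.meanW, Params.meanM, Params.sqM]
  field_simp
  ring

/-- The choice f = 1 makes `preHitSum` the number of failures; the added 1 counts the reception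
itself. -/
theorem Params.Valid.hasMean_firstHit :
    HasMean p.pathLaw (fun z => (firstHit (p.recSet n) z : ℝ) + 1) p.meanM ∧
    HasMean p.pathLaw (fun z => ((firstHit (p.recSet n) z : ℝ) + 1) ^ 2) p.sqM := by
  have := hp.isProbabilityMeasure_updateLaw
  have hprob := hp.isProbabilityMeasure_pathLaw
  have hS := hp.measurableSet_recSet n
  have h0 := hp.recSet_ne_zero n
  have hone : MemLp (fun _ : p.Update => (1 : ℝ)) 2 p.updateLaw := memLp_const 1
  have e0 : preHitSum (p.recSet n) (fun _ => (1 : ℝ)) = fun z => (firstHit (p.recSet n) z : ℝ) := by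
    ext z; simp [preHitSum]
  have hw2 : MemLp (preHitSum (p.recSet n) fun _ => (1 : ℝ)) 2 p.pathLaw :=
    memLp_preHitSum hS h0 measurable_const hone
  obtain ⟨h1, h2⟩ := integral_preHitSum hS h0 measurable_const hone
  have i1 : ∫ _ in (p.recSet n)ᶜ, (1 : ℝ) ∂p.updateLaw = 1 - p.probS := by
    rw [setIntegral_const, smul_eq_mul, mul_one, probReal_compl_eq_one_sub hS, hp.real_recSet]
  have hpos := hp.probS_pos.ne'
  simp only [one_pow] at h2
  rw [i1, h1, i1, hp.real_recSet] at h2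
  rw [i1, hp.real_recSet] at h1
  rw [e0] at hw2 h1 h2
  have hw1 := hw2.integrable one_le_two
  refine ⟨⟨hw1.add (integrable_const 1), ?_⟩, ⟨(hw2.add (memLp_const 1)).integrable_sq, ?_⟩⟩
  · have h : ∫ z, ((firstHit (p.recSet n) z : ℝ) + 1) ∂p.pathLaw =
        (1 - p.probS) / p.probS + 1 := by
      rw [integral_add hw1 (integrable_const 1), integral_const, probReal_univ, one_smul]
      exact congrArg (· + 1) h1
    rw [h, Params.meanM]
    field_simp
    ring
  · have h : ∫ z, ((firstHit (p.recSet n) z : ℝ) + 1) ^ 2 ∂p.pathLaw =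
        (1 - p.probS + 2 * (1 - p.probS) * ((1 - p.probS) / p.probS)) / p.probS +
          (2 * ((1 - p.probS) / p.probS) + 1) := by
      have e : ∀ z : ℕ → p.Update, ((firstHit (p.recSet n) z : ℝ) + 1) ^ 2 =
          (firstHit (p.recSet n) z : ℝ) ^ 2 + (2 * (firstHit (p.recSet n) z : ℝ) + 1) :=
        fun z => by ring
      have i21 : Integrable (fun z : ℕ → p.Update => 2 * (firstHit (p.recSet n) z : ℝ) + 1)
          p.pathLaw := (hw1.const_mul 2).add (integrable_const 1)
      simp only [e]
      rw [integral_add hw2.integrable_sq i21,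
        integral_add (hw1.const_mul 2) (integrable_const 1), integral_const_mul, integral_const,
        probReal_univ, one_smul]
      exact congrArg₂ (· + ·) h2 (congrArg (fun x => 2 * x + 1) h1)
    rw [h, Params.sqM]
    field_simp
    ring

theorem Params.Valid.hasMean_hitTerm :
    HasMean p.pathLaw (fun z => p.dur (hitTerm (p.recSet n) z)) p.meanXS ∧
    HasMean p.pathLaw (fun z => p.dur (hitTerm (p.recSet n) z) ^ 2) p.sqXS ∧
    HasMean p.pathLaw (p.srv n) p.meanT := by
  obtain ⟨-, -, -, -, -, -, -, -, -, -, -, ⟨h1, h2⟩, h3⟩ :=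
    hp.oneUpdate (T := p.svc) (D := p.dl) n 0 (MeasurePreserving.id p.updateLaw)
  have h := hp.measurePreserving_hitTerm n
  exact ⟨h1.map h, h2.map h, h3.map h⟩

theorem Params.Valid.measurable_srv : Measurable (p.srv n) :=
  (measurable_pi_apply n).comp (measurable_fst.comp
    (measurable_hitTerm (hp.measurableSet_recSet n)))

theorem Params.Valid.memLp_service : MemLp (fun e : p.Update => e.1 n) 2
    (cond p.updateLaw (p.recSet n)) := by
  rw [memLp_two_iff_integrable_sq
    ((measurable_pi_apply n).comp measurable_fst).aestronglyMeasurable]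
  have h := (hp.hasMean_evS n 0 (le_refl 0) (le_refl 0) zero_le_one).1
  simp only [zero_mul, zero_add, one_mul] at h
  exact h

theorem Params.Valid.memLp_srv : MemLp (p.srv n) 2 p.pathLaw :=
  (hp.memLp_service n).comp_measurePreserving (hp.measurePreserving_hitTerm n)

theorem Params.Valid.measurable_dur_hitTerm :
    Measurable fun z => p.dur (hitTerm (p.recSet n) z) :=
  hp.measurable_dur.comp (measurable_hitTerm (hp.measurableSet_recSet n))

theorem Params.Valid.memLp_dur_hitTerm :
    MemLp (fun z => p.dur (hitTerm (p.recSet n) z)) 2 p.pathLaw := by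
  rw [memLp_two_iff_integrable_sq (hp.measurable_dur_hitTerm n).aestronglyMeasurable]
  exact (hp.hasMean_hitTerm n).2.1.1

theorem Params.Valid.memLp_preHitSum_dur :
    MemLp (preHitSum (p.recSet n) p.dur) 2 p.pathLaw := by
  have := hp.isProbabilityMeasure_updateLaw
  exact memLp_preHitSum (hp.measurableSet_recSet n) (hp.recSet_ne_zero n) hp.measurable_dur
    hp.memLp_dur

theorem Params.Valid.memLp_gap : MemLp (p.gap n) 2 p.pathLaw :=
  (hp.memLp_dur_hitTerm n).add
    ((hp.memLp_preHitSum_dur n).comp_measurePreserving (hp.measurePreserving_afterHit n))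

theorem Params.Valid.hasMean_gap : HasMean p.pathLaw (p.gap n) (p.meanXS + p.meanW) := by
  have h1 := (hp.hasMean_hitTerm n).1
  have h2 := (hp.hasMean_preHitSum_dur n).1.map (hp.measurePreserving_afterHit n)
  refine ⟨h1.1.add h2.1, ?_⟩
  rw [← h1.2, ← h2.2]
  exact integral_add h1.1 h2.1

/-- What happens at the first reception is independent of what comes after it. -/
theorem Params.Valid.integral_hitTerm_mul_afterHit {a : p.Update → ℝ} {b : (ℕ → p.Update) → ℝ}
    (ha : Measurable a) (hb : Measurable b) :
    ∫ z, a (hitTerm (p.recSet n) z) * b (afterHit (p.recSet n) z) ∂p.pathLaw =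
      (∫ z, a (hitTerm (p.recSet n) z) ∂p.pathLaw) *
        ∫ z, b (afterHit (p.recSet n) z) ∂p.pathLaw := by
  have := hp.isProbabilityMeasure_updateLaw
  have hS := hp.measurableSet_recSet n
  have h : IndepFun (fun z => a (hitTerm (p.recSet n) z)) (fun z => b (afterHit (p.recSet n) z))
      p.pathLaw :=
    (indepFun_block_afterHit hS (hp.recSet_ne_zero n) hp.measurable_dur).comp
      (ha.comp measurable_fst) hb
  exact h.integral_fun_mul_eq_mul_integral
    (ha.comp (measurable_hitTerm hS)).aestronglyMeasurable
    (hb.comp (measurable_afterHit hS)).aestronglyMeasurable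

theorem Params.Valid.measurable_preHitSum_dur : Measurable (preHitSum (p.recSet n) p.dur) :=
  measurable_preHitSum (hp.measurableSet_recSet n) hp.measurable_dur

/-- The two parts of a gap lie in different blocks: the duration of the received update closes one,
the failures open the next. Independence factors the cross term. -/
theorem Params.Valid.hasMean_gap_sq : HasMean p.pathLaw (fun z => p.gap n z ^ 2)
    (p.sqXS + 2 * (p.meanXS * p.meanW) + p.sqW) := by
  have hθ := hp.measurePreserving_afterHit n
  obtain ⟨h1, h2, -⟩ := hp.hasMean_hitTerm n
  obtain ⟨h3, h4⟩ := hp.hasMean_preHitSum_dur n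
  replace h3 := h3.map hθ
  replace h4 := h4.map hθ
  have hw := (hp.memLp_preHitSum_dur n).comp_measurePreserving hθ
  have h5 := hp.integral_hitTerm_mul_afterHit n hp.measurable_dur (hp.measurable_preHitSum_dur n)
  have i5 : Integrable (fun z => p.dur (hitTerm (p.recSet n) z) *
      preHitSum (p.recSet n) p.dur (afterHit (p.recSet n) z)) p.pathLaw :=
    (hp.memLp_dur_hitTerm n).integrable_mul hw
  refine ⟨(hp.memLp_gap n).integrable_sq, ?_⟩
  have e : ∀ z, p.gap n z ^ 2 = p.dur (hitTerm (p.recSet n) z) ^ 2 +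
      2 * (p.dur (hitTerm (p.recSet n) z) *
        preHitSum (p.recSet n) p.dur (afterHit (p.recSet n) z)) +
      preHitSum (p.recSet n) p.dur (afterHit (p.recSet n) z) ^ 2 := fun z => by
    rw [Params.gap]; ring
  have i12 : Integrable (fun z => p.dur (hitTerm (p.recSet n) z) ^ 2 +
      2 * (p.dur (hitTerm (p.recSet n) z) *
        preHitSum (p.recSet n) p.dur (afterHit (p.recSet n) z))) p.pathLaw :=
    h2.1.add (i5.const_mul 2)
  simp only [e]
  refine (integral_add i12 h4.1).trans ?_
  rw [integral_add h2.1 (i5.const_mul 2), integral_const_mul, h5, h2.2,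
    h1.2]
  exact congrArg₂ (· + ·) (congrArg (fun x => p.sqXS + 2 * (p.meanXS * x)) h3.2) h4.2

/-- The duration of the received update is independent of the next block. The failures and the next
service time share a block, where `integral_preHitSum_mul` is needed to factor the product. -/
theorem Params.Valid.hasMean_gap_mul_srv :
    HasMean p.pathLaw (fun z => p.gap n z * p.srv n (afterHit (p.recSet n) z))
      ((p.meanXS + p.meanW) * p.meanT) := by
  have := hp.isProbabilityMeasure_updateLaw
  have hS := hp.measurableSet_recSet n
  have hθ := hp.measurePreserving_afterHit n
  obtain ⟨h1, -, h3⟩ := hp.hasMean_hitTerm n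
  have h3' := h3.map hθ
  have h5 := hp.integral_hitTerm_mul_afterHit n hp.measurable_dur (hp.measurable_srv n)
  have h6 := integral_preHitSum_mul hS (hp.recSet_ne_zero n) hp.measurable_dur hp.memLp_dur
    ((measurable_pi_apply n).comp measurable_fst) (hp.memLp_service n)
  have h7 : HasMean p.pathLaw (fun z => preHitSum (p.recSet n) p.dur z * p.srv n z)
      (p.meanW * p.meanT) := by
    refine ⟨(hp.memLp_preHitSum_dur n).integrable_mul (hp.memLp_srv n), h6.trans ?_⟩
    exact congrArg₂ (· * ·) (hp.hasMean_preHitSum_dur n).1.2 h3.2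
  replace h7 := h7.map hθ
  have hs := (hp.memLp_srv n).comp_measurePreserving hθ
  have i5 : Integrable (fun z => p.dur (hitTerm (p.recSet n) z) *
      p.srv n (afterHit (p.recSet n) z)) p.pathLaw := (hp.memLp_dur_hitTerm n).integrable_mul hs
  refine ⟨(hp.memLp_gap n).integrable_mul hs, ?_⟩
  simp only [Params.gap, add_mul]
  refine (integral_add i5 h7.1).trans ?_
  rw [h5, h7.2, h1.2]
  exact congrArg (fun x => p.meanXS * x + p.meanW * p.meanT) h3'.2

theorem Params.Valid.hasMean_gap_add_srv :
    HasMean p.pathLaw (fun z => p.gap n z + p.srv n (afterHit (p.recSet n) z))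
      p.averagePeakAoI := by
  have h1 := hp.hasMean_gap n
  have h2 := (hp.hasMean_hitTerm n).2.2.map (hp.measurePreserving_afterHit n)
  refine ⟨h1.1.add h2.1, ?_⟩
  rw [Params.averagePeakAoI, ← h1.2, ← h2.2]
  exact integral_add h1.1 h2.1

/-- Averages over the cycles of quantities that depend on two successive cycles. -/
theorem Params.Valid.tendsto_average {h : (p.Update × ℝ) × (p.Update × ℝ) → ℝ}
    (hh : Measurable h) {m : ℝ} {V : (ℕ → p.Update) → ℝ}
    (hV : ∀ z, V z = h ((hitTerm (p.recSet n) z, preHitSum (p.recSet n) p.dur z),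
      (hitTerm (p.recSet n) (afterHit (p.recSet n) z),
        preHitSum (p.recSet n) p.dur (afterHit (p.recSet n) z))))
    (hm : HasMean p.pathLaw V m) :
    ∀ᵐ z ∂p.pathLaw, Tendsto
      (fun k : ℕ => (∑ i ∈ Finset.range k, V ((afterHit (p.recSet n))^[i] z)) / k) atTop (𝓝 m) := by
  have := hp.isProbabilityMeasure_updateLaw
  have hprob := hp.isProbabilityMeasure_pathLaw
  have hS := hp.measurableSet_recSet n
  have hθ := hp.measurePreserving_afterHit n
  have hb : Measurable fun z => (hitTerm (p.recSet n) z, preHitSum (p.recSet n) p.dur z) :=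
    (measurable_hitTerm hS).prodMk (hp.measurable_preHitSum_dur n)
  have hind := indepFun_two_blocks hθ hb
    (indepFun_block_afterHit hS (hp.recSet_ne_zero n) hp.measurable_dur)
  have e : V = h ∘ fun z => ((hitTerm (p.recSet n) z, preHitSum (p.recSet n) p.dur z),
      (hitTerm (p.recSet n) (afterHit (p.recSet n) z),
        preHitSum (p.recSet n) p.dur (afterHit (p.recSet n) z))) := funext hV
  rw [← hm.2]
  refine tendsto_average_of_indepFun_two hθ ?_ hm.1 ?_
  · rw [e]; exact hh.comp (hb.prodMk (hb.comp hθ.measurable))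
  · rw [e]; exact hind.comp hh measurable_id

theorem Params.Valid.ae_tendsto :
    ∀ᵐ z ∂p.pathLaw,
      Tendsto (fun k : ℕ => (∑ i ∈ Finset.range k, p.gap n ((afterHit (p.recSet n))^[i] z)) / k)
        atTop (𝓝 (p.meanXS + p.meanW)) ∧
      Tendsto (fun k : ℕ => (∑ i ∈ Finset.range k,
        p.gap n ((afterHit (p.recSet n))^[i] z) ^ 2) / k) atTop
        (𝓝 (p.sqXS + 2 * (p.meanXS * p.meanW) + p.sqW)) ∧
      Tendsto (fun k : ℕ => (∑ i ∈ Finset.range k, p.gap n ((afterHit (p.recSet n))^[i] z) *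
        p.srv n (afterHit (p.recSet n) ((afterHit (p.recSet n))^[i] z))) / k) atTop
        (𝓝 ((p.meanXS + p.meanW) * p.meanT)) ∧
      Tendsto (fun k : ℕ => (∑ i ∈ Finset.range k, (p.gap n ((afterHit (p.recSet n))^[i] z) +
        p.srv n (afterHit (p.recSet n) ((afterHit (p.recSet n))^[i] z)))) / k) atTop
        (𝓝 p.averagePeakAoI) := by
  have hg : Measurable fun u : (p.Update × ℝ) × (p.Update × ℝ) => p.dur u.1.1 + u.2.2 :=
    (hp.measurable_dur.comp (measurable_fst.comp measurable_fst)).add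
      (measurable_snd.comp measurable_snd)
  have hs : Measurable fun u : (p.Update × ℝ) × (p.Update × ℝ) => u.2.1.1 n :=
    (measurable_pi_apply n).comp (measurable_fst.comp (measurable_fst.comp measurable_snd))
  filter_upwards [hp.tendsto_average n hg (fun _ => rfl) (hp.hasMean_gap n),
    hp.tendsto_average n (hg.pow_const 2) (fun _ => rfl) (hp.hasMean_gap_sq n),
    hp.tendsto_average n (hg.mul hs) (fun _ => rfl) (hp.hasMean_gap_mul_srv n),
    hp.tendsto_average n (hg.add hs) (fun _ => rfl) (hp.hasMean_gap_add_srv n)] with z h1 h2 h3 h4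
  exact ⟨h1, h2, h3, h4⟩

end Cycles

end MulticastAoI

namespace MulticastAoI

open Set

/-! ### From cycles to paths -/

theorem HasMean.congr_ae {Ω : Type*} [MeasurableSpace Ω] {P : Measure Ω} {Y Y' : Ω → ℝ} {m : ℝ}
    (h : HasMean P Y m) (hY : Y' =ᵐ[P] Y) : HasMean P Y' m :=
  ⟨h.1.congr hY.symm, (integral_congr_ae hY).trans h.2⟩

section Paths

variable {p : Params} (hp : p.Valid) (n : Fin p.N)

/-- The path of updates `z` is regular for device `n`. -/
abbrev Params.Regular (p : Params) (n : Fin p.N) (z : ℕ → p.Update) : Prop :=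
  RegularPath p.K (fun j => (z j).1) (fun j => (z j).2) n

section Deterministic

variable {z : ℕ → p.Update} {n}

theorem Params.succService_eq (hz : p.Regular n z) (q : ℕ) :
    succService p.K (fun j => (z j).1) (fun j => (z j).2) n q =
      p.srv n ((afterHit (p.recSet n))^[q] z) := by
  rw [Params.srv, hitTerm_iterate_afterHit q hz.infinite]
  rfl

/-- The exponent is q + 1 because the failures following reception q belong to the block that ends
at reception q + 1. -/
theorem Params.failTime_eq (hz : p.Regular n z) (q : ℕ) :
    failTime p.K (fun j => (z j).1) (fun j => (z j).2) n q =
      preHitSum (p.recSet n) p.dur ((afterHit (p.recSet n))^[q + 1] z) :=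
  sum_Ioo_hitIdx (S := p.recSet n) p.dur hz.infinite q

theorem Params.succGap_eq (hz : p.Regular n z) (q : ℕ) :
    succGap p.K (fun j => (z j).1) (fun j => (z j).2) n q =
      p.gap n ((afterHit (p.recSet n))^[q] z) := by
  rw [succGap, p.failTime_eq hz, Params.gap, hitTerm_iterate_afterHit q hz.infinite,
    Function.iterate_succ_apply']
  rfl

theorem Params.attempts_eq (hz : p.Regular n z) (q : ℕ) :
    attempts p.K (fun j => (z j).1) (fun j => (z j).2) n q =
      (firstHit (p.recSet n) ((afterHit (p.recSet n))^[q + 1] z) : ℝ) + 1 := by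
  have h := hitIdx_succ_eq_add (S := p.recSet n) q hz.infinite
  have h' : succIdx p.K (fun j => (z j).1) (fun j => (z j).2) n (q + 1) =
      succIdx p.K (fun j => (z j).1) (fun j => (z j).2) n q + 1 +
        firstHit (p.recSet n) ((afterHit (p.recSet n))^[q + 1] z) := h
  rw [attempts, h']
  push_cast
  ring

theorem Params.peakAge_eq (hz : p.Regular n z) {u₀ : ℝ} (hu : u₀ ≤ 0) (q : ℕ) :
    peakAge p.K (fun j => (z j).1) (fun j => (z j).2) n u₀ (q + 1) =
      p.gap n ((afterHit (p.recSet n))^[q] z) +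
        p.srv n (afterHit (p.recSet n) ((afterHit (p.recSet n))^[q] z)) := by
  rw [hz.peakAge_succ hu, p.succGap_eq hz, p.succService_eq hz, Function.iterate_succ_apply']

end Deterministic

include hp

theorem Params.Valid.ae_lt_dur : ∀ᵐ e ∂p.updateLaw, (∀ m, p.c < e.1 m) ∧ p.c < p.dur e := by
  filter_upwards [hp.ae_generic] with e ⟨_, _, h3, h4⟩
  obtain ⟨i, _, hi⟩ := exists_kthSmallest_eq e.1 hp.one_le_K hp.K_le_N
  exact ⟨h3, lt_min h4 (hi ▸ h3 _)⟩

theorem Params.Valid.ae_regular :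
    ∀ᵐ z ∂p.pathLaw, p.Regular n z ∧ ∀ j, p.c < p.dur (z j) := by
  have := hp.isProbabilityMeasure_updateLaw
  have h : ∀ j : ℕ, ∀ᵐ z ∂p.pathLaw, (∀ m, p.c < (z j).1 m) ∧ p.c < p.dur (z j) := fun j =>
    (measurePreserving_eval_infinitePi (fun _ : ℕ => p.updateLaw) j).quasiMeasurePreserving.ae
      hp.ae_lt_dur
  filter_upwards [ae_all_iff.2 h,
    ae_infinite_mem (hp.measurableSet_recSet n) (hp.recSet_ne_zero n)] with z h1 h2
  exact ⟨⟨fun j => hp.c_pos.trans ((h1 j).1 n), fun j => hp.c_pos.trans (h1 j).2, h2⟩,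
    fun j => (h1 j).2⟩

/-- Every update lasts longer than c > 0, and a gap contains at least the received one. -/
theorem Params.Valid.meanXS_add_meanW_pos : 0 < p.meanXS + p.meanW := by
  have hprob := hp.isProbabilityMeasure_pathLaw
  let n : Fin p.N := ⟨0, hp.one_le_N⟩
  have hm := hp.hasMean_gap n
  have hle : ∀ᵐ z ∂p.pathLaw, p.c ≤ p.gap n z := by
    filter_upwards [hp.ae_regular n,
      (hp.measurePreserving_afterHit n).quasiMeasurePreserving.ae (hp.ae_regular n)] with z h1 h2
    exact le_add_of_le_of_nonneg (h1.2 _).le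
      (Finset.sum_nonneg fun i _ => (hp.c_pos.trans (h2.2 i)).le)
  have h := integral_mono_ae (integrable_const p.c) hm.1 hle
  rw [hm.2, integral_const, probReal_univ, one_smul] at h
  exact hp.c_pos.trans_le h

theorem Params.Valid.averageAoI_eq :
    p.averageAoI = ((p.sqXS + 2 * (p.meanXS * p.meanW) + p.sqW) / 2 +
      (p.meanXS + p.meanW) * p.meanT) / (p.meanXS + p.meanW) := by
  have h := hp.meanXS_add_meanW_pos.ne'
  have h' : 2 * p.meanW + 2 * p.meanXS ≠ 0 := by
    rw [← mul_add, add_comm]; exact mul_ne_zero two_ne_zero h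
  rw [Params.averageAoI, ← add_div, div_eq_div_iff h' h]
  ring

/-- Regularity and the cycle averages do not involve u₀, so one null set serves all initial values.
-/
theorem Params.Valid.ae_age :
    ∀ᵐ z ∂p.pathLaw, ∀ u₀ ≤ (0 : ℝ),
      Tendsto (fun τ : ℝ => (1 / τ) * ∫ t in (0 : ℝ)..τ,
          age p.K (fun j => (z j).1) (fun j => (z j).2) n u₀ t) atTop (𝓝 p.averageAoI) ∧
      Tendsto (fun Q : ℕ => (1 / (Q : ℝ)) * ∑ q ∈ Finset.range Q,
          peakAge p.K (fun j => (z j).1) (fun j => (z j).2) n u₀ q) atTop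
        (𝓝 p.averagePeakAoI) := by
  filter_upwards [hp.ae_regular n, hp.ae_tendsto n] with z ⟨hz, _⟩ ⟨h1, h2, h3, h4⟩ u₀ hu
  simp only [← Function.iterate_succ_apply' (afterHit (p.recSet n)), ← p.succGap_eq hz,
    ← p.succService_eq hz] at h1 h2 h3 h4
  rw [hp.averageAoI_eq]
  exact ⟨hz.tendsto_age hu hp.meanXS_add_meanW_pos h1 h2 h3, hz.tendsto_peakAge hu h4⟩

theorem Params.Valid.hasMean_peakAge {u₀ : ℝ} (hu : u₀ ≤ 0) {q : ℕ} (hq : 1 ≤ q) :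
    HasMean p.pathLaw (fun z => peakAge p.K (fun j => (z j).1) (fun j => (z j).2) n u₀ q)
      p.averagePeakAoI := by
  obtain ⟨q, rfl⟩ := Nat.exists_eq_add_of_le' hq
  refine ((hp.hasMean_gap_add_srv n).map ((hp.measurePreserving_afterHit n).iterate q)).congr_ae ?_
  filter_upwards [hp.ae_regular n] with z ⟨hz, _⟩
  exact p.peakAge_eq hz hu q

theorem Params.Valid.hasMean_cycle (q : ℕ) :
    HasMean p.pathLaw (fun z => attempts p.K (fun j => (z j).1) (fun j => (z j).2) n q)
      p.meanM ∧
    HasMean p.pathLaw (fun z => attempts p.K (fun j => (z j).1) (fun j => (z j).2) n q ^ 2)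
      p.sqM ∧
    HasMean p.pathLaw (fun z => failTime p.K (fun j => (z j).1) (fun j => (z j).2) n q)
      p.meanW ∧
    HasMean p.pathLaw (fun z => failTime p.K (fun j => (z j).1) (fun j => (z j).2) n q ^ 2)
      p.sqW ∧
    HasMean p.pathLaw (fun z => succService p.K (fun j => (z j).1) (fun j => (z j).2) n q)
      p.meanT := by
  have hθ := (hp.measurePreserving_afterHit n).iterate q
  have hθ' := (hp.measurePreserving_afterHit n).iterate (q + 1)
  obtain ⟨h1, h2⟩ := hp.hasMean_firstHit n
  obtain ⟨h3, h4⟩ := hp.hasMean_preHitSum_dur n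
  have h5 := (hp.hasMean_hitTerm n).2.2
  refine ⟨(h1.map hθ').congr_ae ?_, (h2.map hθ').congr_ae ?_, (h3.map hθ').congr_ae ?_,
    (h4.map hθ').congr_ae ?_, (h5.map hθ).congr_ae ?_⟩ <;>
  filter_upwards [hp.ae_regular n] with z ⟨hz, _⟩
  · exact p.attempts_eq hz q
  · exact congrArg (· ^ 2) (p.attempts_eq hz q)
  · exact p.failTime_eq hz q
  · exact congrArg (· ^ 2) (p.failTime_eq hz q)
  · exact p.succService_eq hz q

end Paths

end MulticastAoI

theorem mainTheorem2 (p : Params) (hK : 1 ≤ p.K) (hKN : p.K ≤ p.N)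
    (hS : 0 < p.lamS) (hD : 0 < p.lamD) (hc : 0 < p.c)
    {Ω : Type*} [MeasurableSpace Ω] (μ : Measure Ω) [IsProbabilityMeasure μ]
    -- `T ω j m` is the service time of update `j` to device `m`, `D ω j` the deadline of update `j`
    (T : Ω → ℕ → Fin p.N → ℝ) (D : Ω → ℕ → ℝ)
    (hTmeas : ∀ j m, Measurable (fun ω => T ω j m)) (hDmeas : ∀ j, Measurable (fun ω => D ω j))
    (hTlaw : ∀ j m, HasLaw (fun ω => T ω j m) (shiftedExp p.c p.lamS) μ)
    (hDlaw : ∀ j, HasLaw (fun ω => D ω j) (shiftedExp p.c p.lamD) μ)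
    (hindep : iIndepFun (fun (i : (ℕ × Fin p.N) ⊕ ℕ) (ω : Ω) =>
      Sum.elim (fun a : ℕ × Fin p.N => T ω a.1 a.2) (fun j : ℕ => D ω j) i) μ)
    (n : Fin p.N) :
    -- the long-run average age and the long-run average peak age
    (∀ᵐ ω ∂μ, ∀ u₀ ≤ (0 : ℝ),
      Tendsto (fun τ : ℝ => (1 / τ) * ∫ t in (0 : ℝ)..τ, age p.K (T ω) (D ω) n u₀ t)
        atTop (𝓝 p.averageAoI)) ∧
    (∀ᵐ ω ∂μ, ∀ u₀ ≤ (0 : ℝ),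
      Tendsto (fun Q : ℕ =>
          (1 / (Q : ℝ)) * ∑ q ∈ Finset.range Q, peakAge p.K (T ω) (D ω) n u₀ q)
        atTop (𝓝 p.averagePeakAoI)) ∧
    (∀ u₀ ≤ (0 : ℝ), ∀ q : ℕ, 1 ≤ q →
      HasMean μ (fun ω => peakAge p.K (T ω) (D ω) n u₀ q) p.averagePeakAoI) ∧
    -- the terms attached to the successive receptions of device `n`
    (∀ q : ℕ,
      HasMean μ (fun ω => attempts p.K (T ω) (D ω) n q) p.meanM ∧
      HasMean μ (fun ω => attempts p.K (T ω) (D ω) n q ^ 2) p.sqM ∧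
      HasMean μ (fun ω => failTime p.K (T ω) (D ω) n q) p.meanW ∧
      HasMean μ (fun ω => failTime p.K (T ω) (D ω) n q ^ 2) p.sqW ∧
      HasMean μ (fun ω => succService p.K (T ω) (D ω) n q) p.meanT) ∧
    -- the terms attached to a single update `j`
    (∀ j : ℕ,
      -- probabilities
      (∀ h, 1 ≤ h → h ≤ p.N → μ.real {ω | D ω j < kthSmallest (T ω j) h} = p.R h) ∧
      μ.real (evS p.K T D n j) = p.probS ∧
      (cond μ (evF p.K T D n j)).real (evF2 p.K T D n j) = p.probF2 ∧
      (cond μ (evF p.K T D n j)).real (evF1 p.K T D n j) = 1 - p.probF2 ∧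
      (cond μ (evS p.K T D n j)).real (evS1 p.K T D n j) = p.probS1 ∧
      (cond μ (evS p.K T D n j)).real (evS2 p.K T D n j) = 1 - p.probS1 ∧
      -- conditional moments of the time to serve and of the deadline
      (p.K < p.N →
          HasMean (cond μ (evF1 p.K T D n j))
            (fun ω => kthSmallest (T ω j) p.K) p.meanServe ∧
          HasMean (cond μ (evF1 p.K T D n j))
            (fun ω => kthSmallest (T ω j) p.K ^ 2) p.sqServe) ∧
      (HasMean (cond μ (evS1 p.K T D n j))
            (fun ω => kthSmallest (T ω j) p.K) p.meanServe ∧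
          HasMean (cond μ (evS1 p.K T D n j))
            (fun ω => kthSmallest (T ω j) p.K ^ 2) p.sqServe) ∧
      (HasMean (cond μ (evF2 p.K T D n j))
            (fun ω => D ω j) p.meanDeadlineF ∧
          HasMean (cond μ (evF2 p.K T D n j))
            (fun ω => D ω j ^ 2) p.sqDeadlineF) ∧
      (2 ≤ p.K →
          HasMean (cond μ (evS2 p.K T D n j))
            (fun ω => D ω j) p.meanDeadlineS ∧
          HasMean (cond μ (evS2 p.K T D n j))
            (fun ω => D ω j ^ 2) p.sqDeadlineS) ∧
      -- inter-generation times given failure and given success, service time given success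
      (HasMean (cond μ (evF p.K T D n j))
            (fun ω => duration p.K (T ω j) (D ω j)) p.meanXF ∧
          HasMean (cond μ (evF p.K T D n j))
            (fun ω => duration p.K (T ω j) (D ω j) ^ 2) p.sqXF) ∧
      (HasMean (cond μ (evS p.K T D n j))
            (fun ω => duration p.K (T ω j) (D ω j)) p.meanXS ∧
          HasMean (cond μ (evS p.K T D n j))
            (fun ω => duration p.K (T ω j) (D ω j) ^ 2) p.sqXS) ∧
      HasMean (cond μ (evS p.K T D n j)) (fun ω => T ω j n) p.meanT) := by
  have hp : p.Valid := ⟨hK, hKN, hS, hD, hc⟩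
  have hprob := hp.isProbabilityMeasure_updateLaw
  -- All quantities are functions of the sequence of updates, so the statements can be pulled back
  -- from the canonical path space.
  have hZ := hp.measurePreserving_path μ T D hTmeas hDmeas hTlaw hDlaw hindep
  have hage := hZ.quasiMeasurePreserving.ae (hp.ae_age n)
  refine ⟨hage.mono fun ω h u₀ hu => (h u₀ hu).1, hage.mono fun ω h u₀ hu => (h u₀ hu).2,
    fun u₀ hu q hq => (hp.hasMean_peakAge n hu hq).map hZ, fun q => ?_, fun j => ?_⟩
  · obtain ⟨h1, h2, h3, h4, h5⟩ := hp.hasMean_cycle n q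
    exact ⟨h1.map hZ, h2.map hZ, h3.map hZ, h4.map hZ, h5.map hZ⟩
  · obtain ⟨h1, h2, h3, h4, h5, h6, h7, h8, h9, h10, h11⟩ := hp.oneUpdate (T := T) (D := D) n j
      ((measurePreserving_eval_infinitePi (fun _ : ℕ => p.updateLaw) j).comp hZ)
    exact ⟨h1, h2, h3, h4, h5, h6, h7, h8, h9, fun _ => h10, h11⟩
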